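/- **Setting.** Let $S^1=\mathbb R/2\pi\mathbb Z$, $d\in\mathbb N$ and $a_0,a_1,a_2\in\mathbb R$. Derivatives in $t\in[0,1]$ are denoted by dots and derivatives in $\theta\in S^1$ by primes. For $k,\ell\in\mathbb N$ let $H^{k,\ell}$ be the Hilbert space of all $f\in L^2([0,1]\times S^1;\mathbb R^d)$ whose weak derivatives $f^{(k,0)}=\partial_t^kf$, $f^{(0,\ell)}=\partial_\theta^\ell f$ and $f^{(k,\ell)}=\partial_t^k\partial_\theta^\ell f$ exist in $L^2$, with $$\langle f,g\rangle_{H^{k,\ell}}=\langle f,g\rangle_{L^2}+\langle f^{(k,0)},g^{(k,0)}\rangle_{L^2}+\langle f^{(0,\ell)},g^{(0,\ell)}\rangle_{L^2}+\langle f^{(k,\ell)},g^{(k,\ell)}\rangle_{L^2}.$$ Let $C^{k,\ell}$ be the space of functions on $[0,1]\times S^1$ for which all $\partial_t^i\partial_\theta^j f$ with $i\le k$, $j\le\ell$ exist and are continuous. Let $U$ be the set of all $c\in H^{1,2}$ (with representative in $C^{0,1}$) such that $c'(t,\theta)\ne0$ for all $(t,\theta)\in[0,1]\times S^1$. The energy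 of $c\in U$ is $E(c)=\int_0^1\int_0^{2\pi}F(c)\,d\theta\,dt$ with $$F(c)=a_0|c'|\langle\dot c,\dot c\rangle+\frac{a_1}{|c'|}\langle\dot c',\dot c'\rangle+\frac{a_2}{|c'|^7}\langle c',c''\rangle^2\langle\dot c',\dot c'\rangle-\frac{2a_2}{|c'|^5}\langle c',c''\rangle\langle\dot c',\dot c''\rangle+\frac{a_2}{|c'|^3}\langle\dot c'',\dot c''\rangle .$$ **Splines.** Given degrees $n_t,n_\theta$ and $N_t,N_\theta\ge1$, let $B_0,\dots,B_{N_t+n_t-1}$ be the normalized B-splines of degree $n_t$ on $[0,1]$ with knots $0,\tfrac1{N_t},\dots,\tfrac{N_t-1}{N_t},1$, where $0$ and $1$ have multiplicity $n_t+1$ and the other knots are simple. Let $C_0,\dots,C_{N_\theta-1}$ be the $2\pi$-periodic normalized B-splines of degree $n_\theta$ with simple knots $2\pi j/N_\theta$, $j\in\mathbb Z$. For $c\in H^{k,\ell}$ with $k\le n_t$, $\ell\le n_\theta$, let $\mathcal S_{N_t,N_\theta}c$ be the orthogonal projection of $c$ in $H^{k,\ell}$ onto the space spanned by the tensor products $B_i\otimes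 C_j$ with coefficients in $\mathbb R^d$. **Quadrature.** For $m_t,m_\theta\ge1$ let $\mu_{N_t}^{m_t}$ and $\nu_{N_\theta}^{m_\theta}$ be the discrete measures on $[0,1]$ and $S^1$ given by Gauss–Legendre quadrature with $m_t$, respectively $m_\theta$, points on each of the $N_t$ intervals $[\frac i{N_t},\frac{i+1}{N_t}]$, respectively $N_\theta$ intervals $[\frac{2\pi j}{N_\theta},\frac{2\pi(j+1)}{N_\theta}]$. For $c\in U\cap C^{1,2}$ let $E^{m_t,m_\theta}_{N_t,N_\theta}(c)=\iint F(c)(t,\theta)\,\mu_{N_t}^{m_t}(dt)\,\nu_{N_\theta}^{m_\theta}(d\theta)$. **Theorem.** Let $2\le k\le n_t$, $3\le\ell\le n_\theta$ and $m_t,m_\theta\ge1$. Then for each $c\in U\cap H^{k,\ell}$ the function $F(c)$ is integrable, $\mathcal S_{N_t,N_\theta}c$ lies in $U\cap C^{1,2}$ for all sufficiently large $N_t,N_\theta$, and $$\lim_{N_t,N_\theta\to\infty}E^{m_t,m_\theta}_{N_t,N_\theta}(\mathcal S_{N_t,N_\theta}c)=E(c),$$ where the limit is taken as $N_t$ and $N_\theta$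 tend to infinity jointly and independently. In particular, this holds for all $n_t\ge2$, $n_\theta\ge3$ and $c\in U\cap H^{2,3}$, with $\mathcal S_{N_t,N_\theta}$ the orthogonal projection in $H^{2,3}$. -/

import Mathlib

open MeasureTheory Set Filter Topology Polynomial
open scoped ContDiff RealInnerProductSpace

noncomputable section

/-! ### The cylinder `[0,1] × S¹` and its `L²` space

Functions on `[0,1] × S¹` are functions of `(t, θ)`, `2π`-periodic in `θ`; their `L²` classes are
taken on the fundamental domain `[0,1] × (0, 2π]`. -/

/-- Lebesgue measure `dt dθ` on `[0,1] × S¹`. -/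
def cylMeasure : Measure (ℝ × ℝ) :=
  volume.restrict (Icc (0 : ℝ) 1 ×ˢ Ioc (0 : ℝ) (2 * Real.pi))

instance : IsFiniteMeasure cylMeasure where
  measure_univ_lt_top := by
    rw [cylMeasure, Measure.restrict_apply_univ, Measure.volume_eq_prod, Measure.prod_prod]
    simp [ENNReal.mul_lt_top_iff]

/-- `L²([0,1] × S¹; ℝᵈ)`. -/
abbrev CylL2 (d : ℕ) : Type := Lp (EuclideanSpace ℝ (Fin d)) 2 cylMeasure

/-! ### Weak derivatives and Sobolev spaces of mixed order -/

/-- The partial derivative `∂_t^i ∂_θ^j φ` of a smooth function on `ℝ × ℝ`. -/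
def smoothPartial (i j : ℕ) (φ : ℝ × ℝ → ℝ) : ℝ × ℝ → ℝ :=
  (fun ψ : ℝ × ℝ → ℝ => fun p => fderiv ℝ ψ p (1, 0))^[i]
    ((fun ψ : ℝ × ℝ → ℝ => fun p => fderiv ℝ ψ p (0, 1))^[j] φ)

/-- Smooth functions on `(0,1) × S¹` with compact support. -/
structure IsCylTest (φ : ℝ × ℝ → ℝ) : Prop where
  smooth : ContDiff ℝ ∞ φ
  periodic : ∀ t θ, φ (t, θ + 2 * Real.pi) = φ (t, θ)
  support : ∃ a b : ℝ, 0 < a ∧ b < 1 ∧ ∀ t θ, t ∉ Icc a b → φ (t, θ) = 0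

/-- `g` is the weak derivative `f^{(i,j)} = ∂_t^i ∂_θ^j f` on `(0,1) × S¹`. -/
def HasCylWeakDeriv {d : ℕ} (i j : ℕ) (f g : CylL2 d) : Prop :=
  ∀ φ : ℝ × ℝ → ℝ, IsCylTest φ →
    ∫ p, smoothPartial i j φ p • f p ∂cylMeasure
      = (-1 : ℝ) ^ (i + j) • ∫ p, φ p • g p ∂cylMeasure

theorem contDiff_smoothPartial (i j : ℕ) {φ : ℝ × ℝ → ℝ} (hφ : ContDiff ℝ ∞ φ) :
    ContDiff ℝ ∞ (smoothPartial i j φ) := by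
  have step : ∀ (v : ℝ × ℝ) (n : ℕ) (ψ : ℝ × ℝ → ℝ), ContDiff ℝ ∞ ψ →
      ContDiff ℝ ∞ ((fun ψ : ℝ × ℝ → ℝ => fun p => fderiv ℝ ψ p v)^[n] ψ) := by
    intro v n
    induction n with
    | zero => intro ψ h; exact h
    | succ n ih =>
      intro ψ h
      rw [Function.iterate_succ_apply]
      exact ih _ ((h.fderiv_right (m := ∞) (by simp)).clm_apply contDiff_const)
  exact step _ _ _ (step _ _ _ hφ)

theorem integrable_continuous_smul {d : ℕ} {ψ : ℝ × ℝ → ℝ} (hψ : Continuous ψ) (f : CylL2 d) :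
    Integrable (fun p => ψ p • f p) cylMeasure := by
  have hf : Integrable (fun p => f p) cylMeasure := (Lp.memLp f).integrable (by norm_num)
  have hK : IsCompact (Icc (0 : ℝ) 1 ×ˢ Icc (0 : ℝ) (2 * Real.pi)) := isCompact_Icc.prod isCompact_Icc
  obtain ⟨C, hC⟩ := hK.exists_bound_of_continuousOn hψ.continuousOn
  refine hf.bdd_smul C hψ.aestronglyMeasurable ?_
  have hm : MeasurableSet (Icc (0 : ℝ) 1 ×ˢ Ioc (0 : ℝ) (2 * Real.pi)) :=
    measurableSet_Icc.prod measurableSet_Ioc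
  filter_upwards [ae_restrict_mem hm] with p hp
  exact hC p ⟨hp.1, Ioc_subset_Icc_self hp.2⟩

theorem HasCylWeakDeriv.zero {d : ℕ} (i j : ℕ) : HasCylWeakDeriv i j (0 : CylL2 d) 0 := by
  intro φ _
  have h0 : ∀ ψ : ℝ × ℝ → ℝ, ∫ p, ψ p • (0 : CylL2 d) p ∂cylMeasure = 0 := by
    intro ψ
    refine integral_eq_zero_of_ae ?_
    filter_upwards [Lp.coeFn_zero (EuclideanSpace ℝ (Fin d)) 2 cylMeasure] with p hp
    rw [hp, Pi.zero_apply, smul_zero]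
  rw [h0, h0, smul_zero]

theorem HasCylWeakDeriv.add {d : ℕ} {i j : ℕ} {f f' g g' : CylL2 d}
    (h : HasCylWeakDeriv i j f g) (h' : HasCylWeakDeriv i j f' g') :
    HasCylWeakDeriv i j (f + f') (g + g') := by
  intro φ hφ
  have key : ∀ (ψ : ℝ × ℝ → ℝ) (_ : Continuous ψ) (u v : CylL2 d),
      ∫ p, ψ p • (u + v) p ∂cylMeasure
        = ∫ p, ψ p • u p ∂cylMeasure + ∫ p, ψ p • v p ∂cylMeasure := by
    intro ψ hψ u v
    rw [← integral_add (integrable_continuous_smul hψ u) (integrable_continuous_smul hψ v)]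
    refine integral_congr_ae ?_
    filter_upwards [Lp.coeFn_add u v] with p hp
    rw [hp, Pi.add_apply, smul_add]
  rw [key _ (contDiff_smoothPartial i j hφ.smooth).continuous, key _ hφ.smooth.continuous,
    h φ hφ, h' φ hφ, smul_add]

theorem HasCylWeakDeriv.smul {d : ℕ} {i j : ℕ} {f g : CylL2 d} (r : ℝ)
    (h : HasCylWeakDeriv i j f g) : HasCylWeakDeriv i j (r • f) (r • g) := by
  intro φ hφ
  have key : ∀ (ψ : ℝ × ℝ → ℝ) (u : CylL2 d),
      ∫ p, ψ p • (r • u) p ∂cylMeasure = r • ∫ p, ψ p • u p ∂cylMeasure := by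
    intro ψ u
    rw [← integral_smul]
    refine integral_congr_ae ?_
    filter_upwards [Lp.coeFn_smul r u] with p hp
    rw [hp, Pi.smul_apply, smul_comm]
  rw [key, key, h φ hφ, smul_comm]

/-- The Hilbert space `H^{k,ℓ}([0,1] × S¹; ℝᵈ)`. An element is the tuple
`(f, f^{(k,0)}, f^{(0,ℓ)}, f^{(k,ℓ)})` of a function in `L²` and its weak derivatives in `L²`, so the
inner product inherited from `(L²)⁴` is
`⟪f,g⟫ + ⟪f^{(k,0)},g^{(k,0)}⟫ + ⟪f^{(0,ℓ)},g^{(0,ℓ)}⟫ + ⟪f^{(k,ℓ)},g^{(k,ℓ)}⟫`. -/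
def mixedSobolev (d k l : ℕ) : Submodule ℝ (PiLp 2 (fun _ : Fin 4 => CylL2 d)) where
  carrier := {x | HasCylWeakDeriv k 0 (x 0) (x 1) ∧ HasCylWeakDeriv 0 l (x 0) (x 2) ∧
    HasCylWeakDeriv k l (x 0) (x 3)}
  zero_mem' := ⟨.zero _ _, .zero _ _, .zero _ _⟩
  add_mem' := fun hx hy => ⟨hx.1.add hy.1, hx.2.1.add hy.2.1, hx.2.2.add hy.2.2⟩
  smul_mem' := fun r _ hx => ⟨hx.1.smul r, hx.2.1.smul r, hx.2.2.smul r⟩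

instance (d k l : ℕ) : NormedAddCommGroup (mixedSobolev d k l) :=
  Submodule.normedAddCommGroup _

instance (d k l : ℕ) : InnerProductSpace ℝ (mixedSobolev d k l) :=
  Submodule.innerProductSpace _

/-- The underlying `L²` function of an element of `H^{k,ℓ}`. -/
def sobolevFun {d k l : ℕ} (x : mixedSobolev d k l) : CylL2 d := x.1 0

open Classical in
/-- The weak derivative `f^{(i,j)}` in `L²` (zero if there is none). -/
def weakPartial {d : ℕ} (i j : ℕ) (f : CylL2 d) : CylL2 d :=
  if h : ∃ g, HasCylWeakDeriv i j f g then h.choose else 0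

open Classical in
/-- The element of `H^{k,ℓ}` given by the function `u` (zero if `u` is not in `H^{k,ℓ}`). -/
def toSobolev {d : ℕ} (k l : ℕ) (u : ℝ × ℝ → EuclideanSpace ℝ (Fin d)) : mixedSobolev d k l :=
  if h : ∃ x : mixedSobolev d k l, ⇑(sobolevFun x) =ᵐ[cylMeasure] u then h.choose else 0

/-! ### Classical differentiability of mixed order -/

/-- The classical derivative `∂_t^i ∂_θ^j u` on `[0,1] × ℝ`, one-sided in `t` at `t = 0, 1`. -/
def cylPartial {d : ℕ} (i j : ℕ) (u : ℝ → ℝ → EuclideanSpace ℝ (Fin d)) (t θ : ℝ) :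
    EuclideanSpace ℝ (Fin d) :=
  iteratedDerivWithin i (fun s => iteratedDeriv j (u s) θ) (Icc 0 1) t

/-- `u ∈ C^{k,ℓ}([0,1] × S¹; ℝᵈ)`: the derivatives `∂_t^i ∂_θ^j u` with `i ≤ k` and `j ≤ ℓ` exist and
are continuous on `[0,1] × S¹`. -/
structure IsMixedC {d : ℕ} (k l : ℕ) (u : ℝ → ℝ → EuclideanSpace ℝ (Fin d)) : Prop where
  periodic : ∀ t ∈ Icc (0 : ℝ) 1, ∀ θ, u t (θ + 2 * Real.pi) = u t θ
  contDiff_space : ∀ t ∈ Icc (0 : ℝ) 1, ContDiff ℝ l (u t)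
  contDiffOn_time : ∀ j ≤ l, ∀ θ, ContDiffOn ℝ k (fun s => iteratedDeriv j (u s) θ) (Icc 0 1)
  continuousOn : ∀ i ≤ k, ∀ j ≤ l,
    ContinuousOn (fun p : ℝ × ℝ => cylPartial i j u p.1 p.2) (Icc 0 1 ×ˢ univ)

/-- `u` is a representative of class `C^{k,ℓ}([0,1] × S¹)` of `f ∈ L²`. -/
def IsMixedCRep {d : ℕ} (k l : ℕ) (f : CylL2 d) (u : ℝ → ℝ → EuclideanSpace ℝ (Fin d)) : Prop :=
  IsMixedC k l u ∧ ⇑f =ᵐ[cylMeasure] fun p => u p.1 p.2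

open Classical in
/-- The representative of class `C^{k,ℓ}` of `f`, which is unique on `[0,1] × S¹` (zero if there is
none). -/
def mixedCRep {d : ℕ} (k l : ℕ) (f : CylL2 d) : ℝ → ℝ → EuclideanSpace ℝ (Fin d) :=
  if h : ∃ u, IsMixedCRep k l f u then h.choose else 0

/-- `C^{k,ℓ}([0,1] × S¹; ℝᵈ)` as a set of `L²` functions. -/
def mixedC (d k l : ℕ) : Set (CylL2 d) := {f | ∃ u, IsMixedCRep k l f u}

/-- The set `U` of paths `c ∈ H^{1,2}([0,1] × S¹; ℝᵈ)` such that `∂_θ c(t,θ) ≠ 0` for all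
`(t,θ) ∈ [0,1] × S¹`, where `c` is identified with its representative of class `C^{0,1}`. -/
def immersedPaths (d : ℕ) : Set (CylL2 d) :=
  {f | (∃ x : mixedSobolev d 1 2, sobolevFun x = f) ∧
    ∃ u, IsMixedCRep 0 1 f u ∧ ∀ t ∈ Icc (0 : ℝ) 1, ∀ θ, cylPartial 0 1 u t θ ≠ 0}

/-! ### The energy -/

/-- The integrand of the energy, as a function of `c' = ∂_θ c`, `c'' = ∂_θ² c`, `v = ∂_t c`,
`v' = ∂_t ∂_θ c` and `v'' = ∂_t ∂_θ² c`. -/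
def energyDensity {d : ℕ} (a₀ a₁ a₂ : ℝ) (c' c'' v v' v'' : EuclideanSpace ℝ (Fin d)) : ℝ :=
  a₀ * ‖c'‖ * ⟪v, v⟫ + a₁ / ‖c'‖ * ⟪v', v'⟫ + a₂ / ‖c'‖ ^ 7 * ⟪c', c''⟫ ^ 2 * ⟪v', v'⟫
    - 2 * a₂ / ‖c'‖ ^ 5 * ⟪c', c''⟫ * ⟪v', v''⟫ + a₂ / ‖c'‖ ^ 3 * ⟪v'', v''⟫

/-- The integrand of the energy of a path. -/
def energyIntegrand {d : ℕ} (a₀ a₁ a₂ : ℝ) (f : CylL2 d) (p : ℝ × ℝ) : ℝ :=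
  energyDensity a₀ a₁ a₂ (weakPartial 0 1 f p) (weakPartial 0 2 f p) (weakPartial 1 0 f p)
    (weakPartial 1 1 f p) (weakPartial 1 2 f p)

/-- The energy `E(c)`. -/
def energy {d : ℕ} (a₀ a₁ a₂ : ℝ) (f : CylL2 d) : ℝ :=
  ∫ p, energyIntegrand a₀ a₁ a₂ f p ∂cylMeasure

/-! ### Gaussian quadrature -/

/-- The nodes of the `m`-point Gauss–Legendre rule on `[0,1]`: the zeros of the Legendre polynomial
of degree `m`, shifted to `[0,1]`. -/
def gaussNodes (m : ℕ) : Finset ℝ :=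
  ((shiftedLegendre m).map (Int.castRingHom ℝ)).roots.toFinset

/-- The weight of the node `ξ` of the `m`-point Gauss–Legendre rule on `[0,1]`. -/
def gaussWeight (m : ℕ) (ξ : ℝ) : ℝ :=
  ∫ x in (0 : ℝ)..1, (Lagrange.basis (gaussNodes m) id ξ).eval x

/-- Composite Gaussian quadrature of `f` on `[a,b]`, with `m` points on each of the `N` intervals
`[a + (b - a) i / N, a + (b - a) (i + 1) / N]`. -/
def gaussQuadrature (m N : ℕ) (a b : ℝ) (f : ℝ → ℝ) : ℝ :=
  ∑ i ∈ Finset.range N, ∑ ξ ∈ gaussNodes m,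
    (b - a) / N * gaussWeight m ξ * f (a + (b - a) * (i + ξ) / N)

/-- The discretized energy of a path of class `C^{1,2}`. -/
def discreteEnergy {d : ℕ} (a₀ a₁ a₂ : ℝ) (mt mθ Nt Nθ : ℕ) (f : CylL2 d) : ℝ :=
  gaussQuadrature mt Nt 0 1 fun t => gaussQuadrature mθ Nθ 0 (2 * Real.pi) fun θ =>
    energyDensity a₀ a₁ a₂ (cylPartial 0 1 (mixedCRep 1 2 f) t θ)
      (cylPartial 0 2 (mixedCRep 1 2 f) t θ) (cylPartial 1 0 (mixedCRep 1 2 f) t θ)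
      (cylPartial 1 1 (mixedCRep 1 2 f) t θ) (cylPartial 1 2 (mixedCRep 1 2 f) t θ)

/-! ### Splines -/

/-- The normalized B-spline of degree `n` on the knots `x i ≤ … ≤ x (i + n + 1)`, by the
Cox–de Boor recursion (a quotient with denominator `0` counts as `0`). -/
def bspline (x : ℕ → ℝ) : ℕ → ℕ → ℝ → ℝ
  | 0, i, s => if x i ≤ s ∧ s < x (i + 1) then 1 else 0
  | n + 1, i, s => (s - x i) / (x (i + n + 1) - x i) * bspline x n i s
      + (x (i + n + 2) - s) / (x (i + n + 2) - x (i + 1)) * bspline x n (i + 1) s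

/-- The uniform knots on `[0,1]`, with full multiplicity `n + 1` at `0` and at `1`. -/
def timeKnot (n N i : ℕ) : ℝ :=
  if i < n then 0 else if i < n + N then ((i : ℝ) - n) / N else 1

/-- The B-splines `B_i` of degree `n` on `[0,1]`, `0 ≤ i < n + N`. -/
def timeSpline (n N i : ℕ) (t : ℝ) : ℝ := bspline (timeKnot n N) n i t

/-- The uniform knots `2π(j - n)/N` for splines on `S¹`. -/
def circleKnot (n N j : ℕ) : ℝ := 2 * Real.pi * ((j : ℝ) - n) / N

/-- The `2π`-periodic B-splines `C_j` of degree `n`, `0 ≤ j < N` (for each `θ` only finitely many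
summands are nonzero). -/
def circleSpline (n N j : ℕ) (θ : ℝ) : ℝ :=
  ∑' z : ℤ, bspline (circleKnot n N) n j (θ + 2 * Real.pi * z)

/-- The subspace of `H^{k,ℓ}([0,1] × S¹; ℝᵈ)` spanned by the tensor product splines `B_i ⊗ C_j` with
coefficients in `ℝᵈ`. -/
def splineSpace (d k l nt nθ Nt Nθ : ℕ) : Submodule ℝ (mixedSobolev d k l) :=
  Submodule.span ℝ (range fun q : Fin (nt + Nt) × Fin Nθ × Fin d =>
    toSobolev k l fun p =>
      (timeSpline nt Nt q.1 p.1 * circleSpline nθ Nθ q.2.1 p.2) • EuclideanSpace.single q.2.2 1)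

theorem hasOrthogonalProjection_span {F : Type*} [NormedAddCommGroup F] [InnerProductSpace ℝ F]
    {s : Set F} (hs : s.Finite) : (Submodule.span ℝ s).HasOrthogonalProjection :=
  haveI : FiniteDimensional ℝ (Submodule.span ℝ s) := FiniteDimensional.span_of_finite ℝ hs
  inferInstance

instance (d k l nt nθ Nt Nθ : ℕ) : (splineSpace d k l nt nθ Nt Nθ).HasOrthogonalProjection :=
  hasOrthogonalProjection_span (finite_range _)

/-- The spline approximation `𝒮 c` of `c`: the orthogonal projection in `H^{k,ℓ}` onto the tensor
product splines. -/
def splineProjection {d k l : ℕ} (nt nθ Nt Nθ : ℕ) (c : mixedSobolev d k l) :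
    mixedSobolev d k l :=
  (splineSpace d k l nt nθ Nt Nθ).starProjection c

end

/-!
# Convergence of the discretized energy of spline approximations

Write `H = H^{k,ℓ}`. The proof rests on two facts about `H`.

*Sobolev embedding.* For `i < k` and `j < ℓ` the derivative `∂_t^i ∂_θ^j x` of `x ∈ H` is continuous,
and as such depends continuously on `x` in the supremum norm (`exists_partialSystem`). In one
variable the value of a derivative of order less than `k` is an integral of the function and of its
`k`-th derivative against bounded kernels (`exists_kernel`). Products of these kernels express the
mixed derivatives of tensor products, hence of all of `H`, because the tensor products `A(t) B(θ) e`
with `B` trigonometric span a dense subspace (`mixedSobolev_eq_top`). An element orthogonal to them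
vanishes since, `B` being an eigenfunction of `∂_θ²`, orthogonality in `H` reduces to a weighted
`H^k` orthogonality of the Fourier coefficients (`eq_zero_of_forall_inner_tensor`).

*Density of splines.* The orthogonal projections `𝒮 x` converge to `x` in `H` as both numbers of
knots tend to infinity (`tendsto_splineProjection`). The set of such `x` is a closed subspace, so
tensor products with trigonometric functions suffice, and for those one approximates each factor:
in `t` the `k`-th derivative is approximated in `L²` by splines of degree `n_t - k`, which are
integrated `k` times (`exists_timeSpline_approx`); in `θ` the spline whose coefficients are the
values at the knots has derivatives given by difference quotients of these values, which converge
uniformly (`exists_circleSpline_approx`).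

Since `k ≥ 2` and `ℓ ≥ 3`, all derivatives entering the energy density are covered by the embedding.
As `∂_θ c` is bounded away from zero, the splines `𝒮 c` are eventually immersed, and the energy
densities of `𝒮 c` converge uniformly to the continuous energy density of `c`. Composite
Gauss–Legendre quadrature is exact on constants, uniformly bounded, and evaluates at points of each
cell, so it converges to the integral for uniformly convergent continuous integrands
(`tendsto_iterated_gaussQuadrature`).
-/


/-! ### Chains of primitives on an interval -/

/-- `A 0, …, A k` is a function on `[0,T]` with its derivatives up to order `k`, each being a
primitive of the next one. The last one is only integrable and matters only almost everywhere. -/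
structure PrimChain (T : ℝ) (k : ℕ) (A : ℕ → ℝ → ℝ) : Prop where
  top : IntervalIntegrable (A k) volume 0 T
  step : ∀ i < k, ∀ t ∈ Icc (0 : ℝ) T, A i t = A i 0 + ∫ s in (0 : ℝ)..t, A (i + 1) s

theorem continuousOn_of_primitive {T : ℝ} (hT : 0 ≤ T) {a a₁ : ℝ → ℝ}
    (h : IntervalIntegrable a₁ volume 0 T)
    (ha : ∀ t ∈ Icc (0 : ℝ) T, a t = a 0 + ∫ s in (0 : ℝ)..t, a₁ s) : ContinuousOn a (Icc 0 T) := by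
  have h1 : ContinuousOn (fun t => a 0 + ∫ s in (0 : ℝ)..t, a₁ s) (Icc 0 T) := by
    have := intervalIntegral.continuousOn_primitive_interval' h (left_mem_uIcc)
    rw [uIcc_of_le hT] at this
    exact continuousOn_const.add this
  exact h1.congr ha

theorem PrimChain.intervalIntegrable {T : ℝ} (hT : 0 ≤ T) {k : ℕ} {A : ℕ → ℝ → ℝ}
    (hA : PrimChain T k A) : ∀ {i : ℕ}, i ≤ k → IntervalIntegrable (A i) volume 0 T := by
  have key : ∀ m i, i + m = k → IntervalIntegrable (A i) volume 0 T := by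
    intro m
    induction m with
    | zero => intro i hi; obtain rfl : i = k := by omega
              exact hA.top
    | succ m ih =>
      intro i hi
      have := continuousOn_of_primitive hT (ih (i + 1) (by omega)) (hA.step i (by omega))
      exact ContinuousOn.intervalIntegrable (by rwa [uIcc_of_le hT])
  intro i hi
  exact key (k - i) i (by omega)

theorem PrimChain.continuousOn {T : ℝ} (hT : 0 ≤ T) {k : ℕ} {A : ℕ → ℝ → ℝ}
    (hA : PrimChain T k A) {i : ℕ} (hi : i < k) : ContinuousOn (A i) (Icc 0 T) :=
  continuousOn_of_primitive hT (hA.intervalIntegrable hT (by omega)) (hA.step i hi)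

theorem PrimChain.mono {T : ℝ} (hT : 0 ≤ T) {k j : ℕ} {A : ℕ → ℝ → ℝ}
    (hA : PrimChain T k A) (hj : j ≤ k) : PrimChain T j A :=
  ⟨hA.intervalIntegrable hT hj, fun i hi => hA.step i (by omega)⟩

theorem integral_deriv_mul_primitive {T : ℝ} (hT : 0 ≤ T) {a a₁ φ : ℝ → ℝ}
    (h : IntervalIntegrable a₁ volume 0 T)
    (ha : ∀ t ∈ Icc (0 : ℝ) T, a t = a 0 + ∫ s in (0 : ℝ)..t, a₁ s) (hφ : ContDiff ℝ ∞ φ) :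
    ∫ t in (0 : ℝ)..T, deriv φ t * a t
      = φ T * a T - φ 0 * a 0 - ∫ t in (0 : ℝ)..T, φ t * a₁ t := by
  set g : ℝ → ℝ := fun t => a 0 + ∫ s in (0 : ℝ)..t, a₁ s with hg
  have hgac : AbsolutelyContinuousOnInterval g 0 T := by
    have h1 := h.absolutelyContinuousOnInterval_intervalIntegral (c := 0) left_mem_uIcc
    have h2 : AbsolutelyContinuousOnInterval (fun _ : ℝ => a 0) 0 T :=
      (LipschitzOnWith.of_dist_le_mul (K := 0) (by simp)).absolutelyContinuousOnInterval
    exact h2.fun_add h1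
  have hφac : AbsolutelyContinuousOnInterval φ 0 T :=
    (hφ.of_le (by simp)).contDiffOn.absolutelyContinuousOnInterval
  have key := hφac.integral_mul_deriv_eq_deriv_mul hgac
  have e1 : ∫ x in (0 : ℝ)..T, φ x * deriv g x = ∫ x in (0 : ℝ)..T, φ x * a₁ x := by
    apply intervalIntegral.integral_congr_ae
    filter_upwards [h.ae_hasDerivAt_integral] with x hx hx2
    have := hx (uIoc_subset_uIcc hx2) 0 left_mem_uIcc
    rw [show deriv g x = a₁ x from (this.const_add (a 0)).deriv]
  have e2 : ∫ x in (0 : ℝ)..T, deriv φ x * g x = ∫ x in (0 : ℝ)..T, deriv φ x * a x := by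
    apply intervalIntegral.integral_congr
    intro x hx
    rw [uIcc_of_le hT] at hx
    simp only [hg, ← ha x hx]
  rw [e1, e2] at key
  rw [key, ha T ⟨hT, le_rfl⟩]
  simp [hg]

/-- Integration by parts along a chain, when the boundary terms cancel. -/
theorem PrimChain.integral_iteratedDeriv_mul {T : ℝ} (hT : 0 ≤ T) {k : ℕ} {A : ℕ → ℝ → ℝ}
    (hA : PrimChain T k A) {φ : ℝ → ℝ} (hφ : ContDiff ℝ ∞ φ)
    (hb : ∀ j, ∀ m < k, iteratedDeriv j φ T * A m T = iteratedDeriv j φ 0 * A m 0)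
    {i : ℕ} (hi : i ≤ k) :
    ∫ t in (0 : ℝ)..T, iteratedDeriv i φ t * A 0 t
      = (-1) ^ i * ∫ t in (0 : ℝ)..T, φ t * A i t := by
  induction i generalizing φ with
  | zero => simp
  | succ i ih =>
    have hφ' : ContDiff ℝ ∞ (deriv φ) := (contDiff_infty_iff_deriv.1 hφ).2
    rw [iteratedDeriv_succ', ih hφ' _ (by omega),
      integral_deriv_mul_primitive hT (hA.intervalIntegrable hT hi) (hA.step i (by omega)) hφ]
    · have := hb 0 i (by omega)
      simp only [iteratedDeriv_zero] at this
      rw [this]; ring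
    · intro j m hm
      rw [← iteratedDeriv_succ']
      exact hb (j + 1) m hm

theorem iteratedDeriv_eq_zero_of_eventuallyEq {φ : ℝ → ℝ} {t : ℝ} (h : φ =ᶠ[𝓝 t] 0) (j : ℕ) :
    iteratedDeriv j φ t = 0 := by
  rw [h.iteratedDeriv_eq]
  simp

/-! ### Reconstruction of intermediate derivatives -/

theorem exists_smooth_step {T : ℝ} (hT : 0 < T) : ∃ Q : ℝ → ℝ, ContDiff ℝ ∞ Q ∧
    (∀ r, 0 ≤ Q r ∧ Q r ≤ 1) ∧ Q 0 = 0 ∧ Q T = 1 ∧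
    deriv Q =ᶠ[𝓝 0] 0 ∧ deriv Q =ᶠ[𝓝 T] 0 ∧ HasCompactSupport (deriv Q) := by
  refine ⟨fun r => Real.smoothTransition (3 * r / T - 1), ?_, fun r =>
    ⟨Real.smoothTransition.nonneg _, Real.smoothTransition.le_one _⟩, ?_, ?_, ?_, ?_, ?_⟩
  · exact Real.smoothTransition.contDiff.comp (by fun_prop)
  · exact Real.smoothTransition.zero_of_nonpos (by norm_num)
  · exact Real.smoothTransition.one_of_one_le (by rw [mul_div_assoc, div_self hT.ne']; norm_num)
  · have h1 : (fun r => Real.smoothTransition (3 * r / T - 1)) =ᶠ[𝓝 0] fun _ => 0 := by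
      filter_upwards [Iio_mem_nhds (show (0 : ℝ) < T / 3 by positivity)] with r hr
      refine Real.smoothTransition.zero_of_nonpos ?_
      rw [sub_nonpos, div_le_one hT]
      rw [mem_Iio] at hr; linarith
    refine h1.deriv.trans ?_
    simp [Pi.zero_def]
  · have h1 : (fun r => Real.smoothTransition (3 * r / T - 1)) =ᶠ[𝓝 T] fun _ => 1 := by
      filter_upwards [Ioi_mem_nhds (show 2 * T / 3 < T by linarith)] with r hr
      refine Real.smoothTransition.one_of_one_le ?_
      rw [le_sub_iff_add_le, le_div_iff₀ hT]
      rw [mem_Ioi] at hr; linarith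
    refine h1.deriv.trans ?_
    simp [Pi.zero_def]
  · refine HasCompactSupport.intro (isCompact_Icc (a := 0) (b := T)) fun x hx => ?_
    rw [mem_Icc, not_and_or, not_le, not_le] at hx
    rcases hx with hx | hx
    · have h1 : (fun r => Real.smoothTransition (3 * r / T - 1)) =ᶠ[𝓝 x] fun _ => 0 := by
        filter_upwards [Iio_mem_nhds hx] with r hr
        refine Real.smoothTransition.zero_of_nonpos ?_
        rw [sub_nonpos, div_le_one hT]
        rw [mem_Iio] at hr; linarith
      rw [h1.deriv_eq]; simp
    · have h1 : (fun r => Real.smoothTransition (3 * r / T - 1)) =ᶠ[𝓝 x] fun _ => 1 := by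
        filter_upwards [Ioi_mem_nhds hx] with r hr
        refine Real.smoothTransition.one_of_one_le ?_
        rw [le_sub_iff_add_le, le_div_iff₀ hT]
        rw [mem_Ioi] at hr; linarith
      rw [h1.deriv_eq]; simp

/-- The value of a function is recovered from its average against `Q'` and its derivative. -/
theorem primitive_eq_average_add {T : ℝ} (hT : 0 < T) {a a₁ Q : ℝ → ℝ}
    (h : IntervalIntegrable a₁ volume 0 T)
    (ha : ∀ t ∈ Icc (0 : ℝ) T, a t = a 0 + ∫ s in (0 : ℝ)..t, a₁ s) (hQ : ContDiff ℝ ∞ Q)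
    (hQ0 : Q 0 = 0) (hQT : Q T = 1) {t : ℝ} (ht : t ∈ Icc (0 : ℝ) T) :
    a t = (∫ s in (0 : ℝ)..T, deriv Q s * a s)
      + ∫ r in (0 : ℝ)..T, (Q r - (Ioi t).indicator 1 r) * a₁ r := by
  have h1 := integral_deriv_mul_primitive hT.le h ha hQ
  rw [hQ0, hQT] at h1
  have hsub : uIcc 0 t ⊆ uIcc 0 T := by
    rw [uIcc_of_le ht.1, uIcc_of_le hT.le]; exact Icc_subset_Icc_right ht.2
  have hsub' : uIcc t T ⊆ uIcc 0 T := by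
    rw [uIcc_of_le ht.2, uIcc_of_le hT.le]; exact Icc_subset_Icc_left ht.1
  have h2 : ∫ r in (0 : ℝ)..T, (Ioi t).indicator 1 r * a₁ r = ∫ r in t..T, a₁ r := by
    rw [intervalIntegral.integral_of_le hT.le, intervalIntegral.integral_of_le ht.2,
      ← integral_indicator measurableSet_Ioc, ← integral_indicator measurableSet_Ioc]
    congr 1
    ext r
    by_cases h1 : t < r <;> by_cases h2 : r ≤ T <;> by_cases h3 : 0 < r <;>
      simp [indicator, h1, h2, h3]
    exact absurd (ht.1.trans_lt h1) h3
  have hint1 : IntervalIntegrable (fun r => Q r * a₁ r) volume 0 T :=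
    h.continuousOn_mul hQ.continuous.continuousOn
  have hint2 : IntervalIntegrable (fun r => (Ioi t).indicator 1 r * a₁ r) volume 0 T := by
    have : (fun r => (Ioi t).indicator 1 r * a₁ r) = (Ioi t).indicator a₁ := by
      ext r; by_cases h1 : r ∈ Ioi t <;> simp [h1]
    rw [this, intervalIntegrable_iff]
    exact (intervalIntegrable_iff.1 h).indicator measurableSet_Ioi
  have h3 : ∫ r in (0 : ℝ)..T, (Q r - (Ioi t).indicator 1 r) * a₁ r
      = (∫ r in (0 : ℝ)..T, Q r * a₁ r) - ∫ r in t..T, a₁ r := by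
    rw [← h2, ← intervalIntegral.integral_sub hint1 hint2]
    simp only [sub_mul]
  have h4 := intervalIntegral.integral_add_adjacent_intervals (h.mono_set hsub) (h.mono_set hsub')
  rw [h1, h3, ha t ht, ha T ⟨hT.le, le_rfl⟩]
  linarith

theorem integrable_bounded_mul {μ ν : Measure ℝ} [SFinite μ] [IsFiniteMeasure μ] [SFinite ν]
    {G : ℝ → ℝ → ℝ} (hG : Measurable (Function.uncurry G)) {M : ℝ} (hM : ∀ r s, |G r s| ≤ M)
    {f : ℝ → ℝ} (hf : Integrable f ν) :
    Integrable (fun z : ℝ × ℝ => G z.1 z.2 * f z.2) (μ.prod ν) := by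
  refine Integrable.bdd_mul (c := M) (hf.comp_snd μ) ?_ ?_
  · exact hG.aestronglyMeasurable
  · exact ae_of_all _ fun z => hM z.1 z.2

/-- Intermediate derivatives are bounded integral functionals of the function and its highest
derivative: this is the one-dimensional Sobolev inequality in a form that tensorizes. -/
theorem exists_kernel {T : ℝ} (hT : 0 < T) {k i : ℕ} (hi : i < k) :
    ∃ (p q : ℝ → ℝ → ℝ) (M : ℝ), Measurable (Function.uncurry p) ∧
      Measurable (Function.uncurry q) ∧ (∀ t s, |p t s| ≤ M) ∧ (∀ t s, |q t s| ≤ M) ∧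
      ∀ A, PrimChain T k A → ∀ t ∈ Icc (0 : ℝ) T,
        A i t = ∫ s in Ioc 0 T, (p t s * A 0 s + q t s * A k s) := by
  obtain ⟨Q, hQ, hQb, hQ0, hQT, hd0, hdT, hcs⟩ := exists_smooth_step hT
  have hρ : ContDiff ℝ ∞ (deriv Q) := (contDiff_infty_iff_deriv.1 hQ).2
  have hρi : ∀ j, Continuous (iteratedDeriv j (deriv Q)) := fun j =>
    hρ.continuous_iteratedDeriv j (by exact_mod_cast le_top)
  have hρb : ∀ j, ∃ M, ∀ s, |iteratedDeriv j (deriv Q) s| ≤ M := by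
    intro j
    have : HasCompactSupport (iteratedDeriv j (deriv Q)) := by
      rw [iteratedDeriv_eq_iterate]
      clear hρi hρ
      induction j with
      | zero => exact hcs
      | succ j ih => rw [Function.iterate_succ_apply']; exact ih.deriv
    obtain ⟨M, hM⟩ := (hρi j).bounded_above_of_compact_support this
    exact ⟨M, hM⟩
  -- the average of `A i` against `Q'` only involves `A 0`, after integration by parts
  have havg : ∀ A, PrimChain T k A → ∀ i < k, ∫ s in (0 : ℝ)..T, deriv Q s * A i s
      = ∫ s in (0 : ℝ)..T, ((-1) ^ i * iteratedDeriv i (deriv Q) s) * A 0 s := by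
    intro A hA i hi
    have := hA.integral_iteratedDeriv_mul hT.le hρ (fun j m _ => by
      rw [iteratedDeriv_eq_zero_of_eventuallyEq hd0, iteratedDeriv_eq_zero_of_eventuallyEq hdT,
        zero_mul, zero_mul]) hi.le
    simp only [mul_assoc]
    rw [intervalIntegral.integral_const_mul, this, ← mul_assoc, ← mul_pow]
    simp
  set q₀ : ℝ → ℝ → ℝ := fun t r => Q r - (Ioi t).indicator 1 r with hq₀
  have hq₀m : Measurable (Function.uncurry q₀) := by
    have : Function.uncurry q₀ = fun z : ℝ × ℝ => Q z.2 - ({z : ℝ × ℝ | z.1 < z.2}.indicator 1 z) := by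
      ext ⟨t, r⟩
      simp [Function.uncurry, hq₀, indicator]
    rw [this]
    exact (hQ.continuous.measurable.comp measurable_snd).sub
      (measurable_one.indicator (measurableSet_lt measurable_fst measurable_snd))
  have hq₀b : ∀ t r, |q₀ t r| ≤ 1 := by
    intro t r
    have := hQb r
    by_cases h : t < r <;> simp only [hq₀, indicator, mem_Ioi, h, if_true, if_false, Pi.one_apply,
      abs_le] <;> constructor <;> linarith
  have key : ∀ m i, i + m + 1 = k → ∃ (p q : ℝ → ℝ → ℝ) (M : ℝ), Measurable (Function.uncurry p) ∧
      Measurable (Function.uncurry q) ∧ (∀ t s, |p t s| ≤ M) ∧ (∀ t s, |q t s| ≤ M) ∧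
      ∀ A, PrimChain T k A → ∀ t ∈ Icc (0 : ℝ) T,
        A i t = ∫ s in Ioc 0 T, (p t s * A 0 s + q t s * A k s) := by
    intro m
    induction m with
    | zero =>
      intro i hik
      obtain ⟨M, hM⟩ := hρb i
      refine ⟨fun _ s => (-1) ^ i * iteratedDeriv i (deriv Q) s, q₀, max M 1, ?_, hq₀m, ?_, ?_, ?_⟩
      · exact ((hρi i).measurable.const_mul _).comp measurable_snd
      · intro t s
        rw [abs_mul, abs_pow, abs_neg, abs_one, one_pow, one_mul]
        exact (hM s).trans (le_max_left _ _)
      · exact fun t s => (hq₀b t s).trans (le_max_right _ _)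
      · intro A hA t ht
        have h0 := hA.intervalIntegrable hT.le (Nat.zero_le k)
        have hk := hA.intervalIntegrable hT.le (show i + 1 ≤ k by omega)
        rw [primitive_eq_average_add hT hk (hA.step i (by omega)) hQ hQ0 hQT ht,
          havg A hA i (by omega), integral_add]
        · rw [intervalIntegral.integral_of_le hT.le, intervalIntegral.integral_of_le hT.le,
            show i + 1 = k by omega]
        · have := h0.continuousOn_mul ((hρi i).const_mul ((-1) ^ i)).continuousOn
          rwa [intervalIntegrable_iff, uIoc_of_le hT.le] at this
        · have h1 := hA.top
          rw [intervalIntegrable_iff, uIoc_of_le hT.le] at h1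
          exact Integrable.bdd_mul (c := 1) h1
            (hq₀m.comp (measurable_const.prodMk measurable_id)).aestronglyMeasurable
            (ae_of_all _ fun z => hq₀b t z)
    | succ m ih =>
      intro i hik
      obtain ⟨p, q, M, hp, hq, hpM, hqM, hpq⟩ := ih (i + 1) (by omega)
      obtain ⟨M₀, hM₀⟩ := hρb i
      have hbd : ∀ g : ℝ → ℝ → ℝ, (∀ t s, |g t s| ≤ M) → ∀ t s,
          |∫ r in Ioc 0 T, q₀ t r * g r s| ≤ M * T := by
        intro g hg t s
        have := norm_setIntegral_le_of_norm_le_const (μ := volume) (s := Ioc 0 T)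
          (f := fun r => q₀ t r * g r s) (C := M) (by simp) (fun r _ => by
            rw [Real.norm_eq_abs, abs_mul]
            calc |q₀ t r| * |g r s| ≤ 1 * M :=
                  mul_le_mul (hq₀b t r) (hg r s) (abs_nonneg _) zero_le_one
              _ = M := one_mul M)
        simpa [Measure.real, hT.le] using this
      have hms : ∀ g : ℝ → ℝ → ℝ, Measurable (Function.uncurry g) →
          Measurable (Function.uncurry fun t s => ∫ r in Ioc 0 T, q₀ t r * g r s) := by
        intro g hg
        have h3 : Measurable (fun z : (ℝ × ℝ) × ℝ => q₀ z.1.1 z.2 * g z.2 z.1.2) :=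
          (hq₀m.comp ((measurable_fst.comp measurable_fst).prodMk measurable_snd)).mul
            (hg.comp (measurable_snd.prodMk (measurable_snd.comp measurable_fst)))
        exact (h3.stronglyMeasurable.integral_prod_right
          (ν := volume.restrict (Ioc 0 T))).measurable
      refine ⟨fun t s => (-1) ^ i * iteratedDeriv i (deriv Q) s + ∫ r in Ioc 0 T, q₀ t r * p r s,
        fun t s => ∫ r in Ioc 0 T, q₀ t r * q r s, M₀ + M * T, ?_, hms q hq, ?_, ?_, ?_⟩
      · exact Measurable.add (((hρi i).measurable.const_mul _).comp measurable_snd) (hms p hp)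
      · intro t s
        refine (abs_add_le _ _).trans (add_le_add ?_ (hbd p hpM t s))
        rw [abs_mul, abs_pow, abs_neg, abs_one, one_pow, one_mul]
        exact hM₀ s
      · intro t s
        have := (abs_nonneg _).trans (hM₀ 0)
        linarith [hbd q hqM t s]
      · intro A hA t ht
        have h0 := hA.intervalIntegrable hT.le (Nat.zero_le k)
        have h1 := hA.top
        have hk := hA.intervalIntegrable hT.le (show i + 1 ≤ k by omega)
        rw [intervalIntegrable_iff, uIoc_of_le hT.le] at h1
        have h0' := h0
        rw [intervalIntegrable_iff, uIoc_of_le hT.le] at h0'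
        have hprod : ∀ (g : ℝ → ℝ → ℝ) (f : ℝ → ℝ), Measurable (Function.uncurry g) →
            (∀ r s, |g r s| ≤ M) → Integrable f (volume.restrict (Ioc 0 T)) →
            Integrable (fun z : ℝ × ℝ => (q₀ t z.1 * g z.1 z.2) * f z.2)
              ((volume.restrict (Ioc 0 T)).prod (volume.restrict (Ioc 0 T))) := by
          intro g f hg hgM hf
          refine integrable_bounded_mul (G := fun r s => q₀ t r * g r s) (M := M) ?_ ?_ hf
          · exact (hq₀m.comp (measurable_const.prodMk measurable_fst)).mul hg
          · intro r s
            rw [abs_mul]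
            calc |q₀ t r| * |g r s| ≤ 1 * M :=
                  mul_le_mul (hq₀b t r) (hgM r s) (abs_nonneg _) zero_le_one
              _ = M := one_mul M
        have hP := hprod p (A 0) hp hpM h0'
        have hQ' := hprod q (A k) hq hqM h1
        rw [primitive_eq_average_add hT hk (hA.step i (by omega)) hQ hQ0 hQT ht,
          havg A hA i (by omega), intervalIntegral.integral_of_le hT.le,
          intervalIntegral.integral_of_le hT.le]
        have e1 : ∫ r in Ioc 0 T, (Q r - (Ioi t).indicator 1 r) * A (i + 1) r
            = ∫ r in Ioc 0 T, ∫ s in Ioc 0 T,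
              ((q₀ t r * p r s) * A 0 s + (q₀ t r * q r s) * A k s) := by
          refine setIntegral_congr_fun measurableSet_Ioc fun r hr => ?_
          rw [hpq A hA r (Ioc_subset_Icc_self hr), ← integral_const_mul]
          refine integral_congr_ae (ae_of_all _ fun s => ?_)
          simp only [hq₀]; ring
        rw [e1, integral_integral_swap (hP.add hQ')]
        have e2 : ∀ᵐ s ∂(volume.restrict (Ioc 0 T)),
            ∫ r in Ioc 0 T, ((q₀ t r * p r s) * A 0 s + (q₀ t r * q r s) * A k s)
            = (∫ r in Ioc 0 T, q₀ t r * p r s) * A 0 s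
              + (∫ r in Ioc 0 T, q₀ t r * q r s) * A k s := by
          filter_upwards [hP.prod_left_ae, hQ'.prod_left_ae] with s hs1 hs2
          rw [integral_add hs1 hs2, integral_mul_const, integral_mul_const]
        rw [integral_congr_ae e2, ← integral_add]
        · refine integral_congr_ae (ae_of_all _ fun s => ?_)
          simp only; ring
        · have := h0.continuousOn_mul ((hρi i).const_mul ((-1) ^ i)).continuousOn
          rwa [intervalIntegrable_iff, uIoc_of_le hT.le] at this
        · exact ((hP.add hQ').integral_prod_right).congr e2
  exact key (k - i - 1) i (by omega)


/-! ### Weak derivatives on the unit interval -/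

/-- Smooth functions with compact support in `(0,1)`. -/
structure IsIntervalTest (a : ℝ → ℝ) : Prop where
  smooth : ContDiff ℝ ∞ a
  support : ∃ α β : ℝ, 0 < α ∧ β < 1 ∧ ∀ t, t ∉ Icc α β → a t = 0

theorem IsIntervalTest.eventuallyEq_zero {a : ℝ → ℝ} (ha : IsIntervalTest a) :
    a =ᶠ[𝓝 0] 0 ∧ a =ᶠ[𝓝 1] 0 := by
  obtain ⟨α, β, h0, h1, h⟩ := ha.support
  constructor
  · filter_upwards [Iio_mem_nhds h0] with s hs using h s (fun hs' => absurd hs'.1 (not_le.2 hs))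
  · filter_upwards [Ioi_mem_nhds h1] with s hs using h s (fun hs' => absurd hs'.2 (not_le.2 hs))

theorem IsIntervalTest.sub_smul {a b : ℝ → ℝ} (ha : IsIntervalTest a) (hb : IsIntervalTest b)
    (c : ℝ) : IsIntervalTest fun t => a t - c * b t := by
  refine ⟨ha.smooth.sub (contDiff_const.mul hb.smooth), ?_⟩
  obtain ⟨α, β, h0, h1, h⟩ := ha.support
  obtain ⟨α', β', h0', h1', h'⟩ := hb.support
  refine ⟨min α α', max β β', lt_min h0 h0', max_lt h1 h1', fun t ht => ?_⟩
  rw [h, h', mul_zero, sub_zero]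
  · exact fun hs => ht ⟨(min_le_right _ _).trans hs.1, hs.2.trans (le_max_right _ _)⟩
  · exact fun hs => ht ⟨(min_le_left _ _).trans hs.1, hs.2.trans (le_max_left _ _)⟩

theorem IsIntervalTest.integral_mul_eq {a : ℝ → ℝ} (ha : IsIntervalTest a) (f : ℝ → ℝ) :
    ∫ t in (0 : ℝ)..1, a t * f t = ∫ t, a t * f t := by
  rw [intervalIntegral.integral_of_le zero_le_one]
  refine setIntegral_eq_integral_of_forall_compl_eq_zero fun t ht => ?_
  obtain ⟨α, β, h0, h1, h⟩ := ha.support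
  rw [h t, zero_mul]
  exact fun hs => ht ⟨h0.trans_le hs.1, hs.2.trans h1.le⟩

theorem isIntervalTest_of_tsupport {a : ℝ → ℝ} (ha : ContDiff ℝ ∞ a) (hc : HasCompactSupport a)
    (hs : tsupport a ⊆ Ioo 0 1) : IsIntervalTest a := by
  refine ⟨ha, ?_⟩
  rcases (tsupport a).eq_empty_or_nonempty with h | h
  · refine ⟨1 / 2, 1 / 2, by norm_num, by norm_num, fun t _ => ?_⟩
    exact image_eq_zero_of_notMem_tsupport (by simp [h])
  · obtain ⟨α, hα⟩ := hc.isCompact.exists_isLeast h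
    obtain ⟨β, hβ⟩ := hc.isCompact.exists_isGreatest h
    refine ⟨α, β, (hs hα.1).1, (hs hβ.1).2, fun t ht => ?_⟩
    exact image_eq_zero_of_notMem_tsupport fun h' => ht ⟨hα.2 h', hβ.2 h'⟩

theorem exists_isIntervalTest_integral_one :
    ∃ χ : ℝ → ℝ, IsIntervalTest χ ∧ ∫ t in (0 : ℝ)..1, χ t = 1 := by
  let f : ContDiffBump (1 / 2 : ℝ) := ⟨1 / 8, 1 / 4, by norm_num, by norm_num⟩
  have ht : IsIntervalTest (f.normed volume) := by
    refine isIntervalTest_of_tsupport f.contDiff_normed f.hasCompactSupport_normed ?_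
    rw [f.tsupport_normed_eq, Real.closedBall_eq_Icc]
    intro x hx
    have h1 : 1 / 2 - 1 / 4 ≤ x := hx.1
    have h2 : x ≤ 1 / 2 + 1 / 4 := hx.2
    constructor <;> linarith
  refine ⟨_, ht, ?_⟩
  have := ht.integral_mul_eq fun _ => 1
  simp only [mul_one] at this
  rw [this, f.integral_normed]

/-- A test function with zero integral is the derivative of a test function. -/
theorem IsIntervalTest.exists_primitive {ψ : ℝ → ℝ} (hψ : IsIntervalTest ψ)
    (h0 : ∫ t in (0 : ℝ)..1, ψ t = 0) : ∃ a, IsIntervalTest a ∧ deriv a = ψ := by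
  have hc := hψ.smooth.continuous
  have hd : ∀ t, HasDerivAt (fun t => ∫ s in (0 : ℝ)..t, ψ s) (ψ t) t := fun t =>
    hc.integral_hasStrictDerivAt 0 t |>.hasDerivAt
  have hd' : deriv (fun t => ∫ s in (0 : ℝ)..t, ψ s) = ψ := funext fun t => (hd t).deriv
  refine ⟨fun t => ∫ s in (0 : ℝ)..t, ψ s, ⟨?_, ?_⟩, hd'⟩
  · rw [contDiff_infty_iff_deriv, hd']
    exact ⟨fun t => (hd t).differentiableAt, hψ.smooth⟩
  · obtain ⟨α, β, hα, hβ, h⟩ := hψ.support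
    have hz : ∀ u v : ℝ, (∀ x ∈ uIcc u v, x ∉ Icc α β) → ∫ s in u..v, ψ s = 0 := by
      intro u v huv
      rw [intervalIntegral.integral_congr (g := fun _ => 0) fun x hx => h x (huv x hx)]
      simp
    refine ⟨α, β, hα, hβ, fun t ht => ?_⟩
    rw [mem_Icc, not_and_or, not_le, not_le] at ht
    rcases ht with ht | ht
    · refine hz 0 t fun x hx hx' => ?_
      rcases le_total 0 t with h | h
      · rw [uIcc_of_le h] at hx; linarith [hx.2, hx'.1]
      · rw [uIcc_of_ge h] at hx; linarith [hx.2, hx'.1]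
    · have h1 : ∫ s in t..1, ψ s = 0 := by
        refine hz t 1 fun x hx hx' => ?_
        rcases le_total t 1 with h | h
        · rw [uIcc_of_le h] at hx; linarith [hx.1, hx'.2]
        · rw [uIcc_of_ge h] at hx; linarith [hx.1, hx'.2]
      have := intervalIntegral.integral_add_adjacent_intervals (hc.intervalIntegrable 0 t)
        (hc.intervalIntegrable (μ := volume) t 1)
      rw [h0, h1, add_zero] at this
      exact this

theorem ae_eq_of_integral_test_mul_eq {g h : ℝ → ℝ} (hg : IntervalIntegrable g volume 0 1)
    (hh : IntervalIntegrable h volume 0 1)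
    (H : ∀ a, IsIntervalTest a → ∫ t in (0 : ℝ)..1, a t * g t = ∫ t in (0 : ℝ)..1, a t * h t) :
    g =ᵐ[volume.restrict (Ioc 0 1)] h := by
  have hgh := hg.sub hh
  have key : ∀ᵐ x, x ∈ Ioo (0 : ℝ) 1 → (g - h) x = 0 := by
    refine isOpen_Ioo.ae_eq_zero_of_integral_contDiff_smul_eq_zero ?_ fun a ha hac has => ?_
    · rw [intervalIntegrable_iff, uIoc_of_le zero_le_one] at hgh
      exact (hgh.mono_set Ioo_subset_Ioc_self).locallyIntegrableOn
    · have ht := isIntervalTest_of_tsupport ha hac has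
      simp only [smul_eq_mul]
      rw [← ht.integral_mul_eq]
      simp only [Pi.sub_apply, mul_sub]
      rw [intervalIntegral.integral_sub (hg.continuousOn_mul ha.continuous.continuousOn)
        (hh.continuousOn_mul ha.continuous.continuousOn), H a ht, sub_self]
  rw [Filter.EventuallyEq, ← restrict_Ioo_eq_restrict_Ioc, ae_restrict_iff' measurableSet_Ioo]
  filter_upwards [key] with x hx hx'
  exact sub_eq_zero.1 (hx hx')

/-- A function with a weak derivative of order `k` is almost everywhere an iterated primitive of
this derivative (du Bois-Reymond). -/
theorem exists_primChain_of_weakDeriv (k : ℕ) {g h : ℝ → ℝ} (hg : IntervalIntegrable g volume 0 1)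
    (hh : IntervalIntegrable h volume 0 1)
    (H : ∀ a, IsIntervalTest a → ∫ t in (0 : ℝ)..1, iteratedDeriv k a t * g t
      = (-1) ^ k * ∫ t in (0 : ℝ)..1, a t * h t) :
    ∃ A, PrimChain 1 k A ∧ A k = h ∧ A 0 =ᵐ[volume.restrict (Ioc 0 1)] g := by
  induction k generalizing h with
  | zero =>
    refine ⟨fun _ => h, ⟨hh, by simp⟩, rfl, ?_⟩
    exact (ae_eq_of_integral_test_mul_eq hg hh (by simpa using H)).symm
  | succ k ih =>
    obtain ⟨χ, hχ, hχ1⟩ := exists_isIntervalTest_integral_one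
    set P : ℝ → ℝ := fun t => ∫ s in (0 : ℝ)..t, h s with hP
    have hPp : ∀ t ∈ Icc (0 : ℝ) 1, P t = P 0 + ∫ s in (0 : ℝ)..t, h s := by simp [hP]
    have hPc : ContinuousOn P (Icc 0 1) := continuousOn_of_primitive zero_le_one hh hPp
    have hPi : IntervalIntegrable P volume 0 1 :=
      ContinuousOn.intervalIntegrable (by rwa [uIcc_of_le zero_le_one])
    have hcont : ∀ a, IsIntervalTest a → Continuous (iteratedDeriv k a) := fun a ha =>
      ha.smooth.continuous_iteratedDeriv k (by exact_mod_cast le_top)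
    -- the weak derivative of order `k` of `g` is a primitive of `h`, up to a constant
    set C : ℝ := (-1) ^ k * (∫ t in (0 : ℝ)..1, iteratedDeriv k χ t * g t)
      - ∫ t in (0 : ℝ)..1, χ t * P t with hC
    have hPC : IntervalIntegrable (fun t => P t + C) volume 0 1 := hPi.add (by simp)
    have hkey : ∀ ψ, IsIntervalTest ψ → ∫ t in (0 : ℝ)..1, iteratedDeriv k ψ t * g t
        = (-1) ^ k * ∫ t in (0 : ℝ)..1, ψ t * (P t + C) := by
      intro ψ hψ
      set m := ∫ t in (0 : ℝ)..1, ψ t with hm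
      have hψi := hψ.smooth.continuous.intervalIntegrable (μ := volume) 0 1
      have hχi := hχ.smooth.continuous.intervalIntegrable (μ := volume) 0 1
      obtain ⟨a, ha, had⟩ := (hψ.sub_smul hχ m).exists_primitive (by
        rw [intervalIntegral.integral_sub hψi (hχi.const_mul m),
          intervalIntegral.integral_const_mul, hχ1, mul_one, ← hm, sub_self])
      have h1 := H a ha
      rw [iteratedDeriv_succ', had] at h1
      have h2 := integral_deriv_mul_primitive zero_le_one hh hPp ha.smooth
      rw [ha.eventuallyEq_zero.1.eq_of_nhds, ha.eventuallyEq_zero.2.eq_of_nhds, had] at h2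
      simp only [Pi.zero_apply, zero_mul, sub_zero, zero_sub] at h2
      have h3 : ∀ t, iteratedDeriv k (fun t => ψ t - m * χ t) t
          = iteratedDeriv k ψ t - m * iteratedDeriv k χ t := by
        intro t
        have e1 : ContDiffAt ℝ k ψ t := (hψ.smooth.of_le (by exact_mod_cast le_top)).contDiffAt
        have e2 : ContDiffAt ℝ k χ t := (hχ.smooth.of_le (by exact_mod_cast le_top)).contDiffAt
        rw [iteratedDeriv_fun_sub e1 (contDiffAt_const.mul e2), iteratedDeriv_const_mul_field]
      simp only [h3, sub_mul, mul_assoc] at h1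
      rw [intervalIntegral.integral_sub (hg.continuousOn_mul (hcont ψ hψ).continuousOn)
        ((hg.continuousOn_mul (hcont χ hχ).continuousOn).const_mul m),
        intervalIntegral.integral_const_mul] at h1
      simp only [sub_mul, mul_assoc] at h2
      have i1 := hPi.continuousOn_mul hψ.smooth.continuous.continuousOn
      rw [intervalIntegral.integral_sub i1
        ((hPi.continuousOn_mul hχ.smooth.continuous.continuousOn).const_mul m),
        intervalIntegral.integral_const_mul] at h2
      simp only [mul_add]
      rw [intervalIntegral.integral_add i1 (hψi.mul_const C),
        intervalIntegral.integral_mul_const, ← hm]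
      have h4 : ((-1 : ℝ) ^ k) * (-1) ^ k = 1 := by rw [← mul_pow]; simp
      rw [hC, mul_add, mul_sub, mul_sub, mul_left_comm m, ← mul_assoc ((-1 : ℝ) ^ k) ((-1) ^ k), h4]
      rw [pow_succ] at h1
      linear_combination h1 - (-1) ^ k * h2
    obtain ⟨A, hA, hAk, hA0⟩ := ih hPC hkey
    refine ⟨fun i => if i ≤ k then A i else h, ⟨by simpa using hh, ?_⟩, by simp, by simpa using hA0⟩
    intro i hi t ht
    rcases eq_or_lt_of_le (Nat.lt_succ_iff.1 hi) with rfl | hlt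
    · simp [hAk, hP, add_comm]
    · simpa [hlt.le, Nat.succ_le_of_lt hlt] using hA.step i hlt t ht


/-! ### B-splines -/

theorem bspline_eq_zero {x : ℕ → ℝ} (hx : Monotone x) {n i : ℕ} {s : ℝ}
    (h : s < x i ∨ x (i + n + 1) ≤ s) : bspline x n i s = 0 := by
  induction n generalizing i with
  | zero =>
    rw [bspline, if_neg]
    rintro ⟨h1, h2⟩
    rcases h with h | h
    · exact absurd h1 (not_le.2 h)
    · exact absurd h2 (not_lt.2 h)
  | succ n ih =>
    rw [bspline, ih, ih, mul_zero, mul_zero, add_zero]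
    · rcases h with h | h
      · exact Or.inl (h.trans_le (hx (by omega)))
      · exact Or.inr ((hx (by omega)).trans h)
    · rcases h with h | h
      · exact Or.inl h
      · exact Or.inr ((hx (by omega)).trans h)

theorem bspline_nonneg {x : ℕ → ℝ} (hx : Monotone x) (n i : ℕ) (s : ℝ) : 0 ≤ bspline x n i s := by
  induction n generalizing i with
  | zero => rw [bspline]; split_ifs <;> norm_num
  | succ n ih =>
    rw [bspline]
    refine add_nonneg ?_ ?_
    · by_cases h : s < x i
      · rw [bspline_eq_zero hx (Or.inl h), mul_zero]
      · exact mul_nonneg (div_nonneg (by linarith) (sub_nonneg.2 (hx (by omega)))) (ih i)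
    · by_cases h : x (i + n + 2) ≤ s
      · rw [bspline_eq_zero hx (Or.inr (by rwa [show i + 1 + n + 1 = i + n + 2 by ring])), mul_zero]
      · exact mul_nonneg (div_nonneg (by linarith) (sub_nonneg.2 (hx (by omega)))) (ih _)

theorem bspline_le {x : ℕ → ℝ} (hx : Monotone x) (n i : ℕ) (s : ℝ) :
    bspline x n i s ≤ 2 ^ n := by
  induction n generalizing i with
  | zero => rw [bspline]; split_ifs <;> norm_num
  | succ n ih =>
    rw [bspline, pow_succ, mul_two]
    have h0 := bspline_nonneg hx n
    refine add_le_add ?_ ?_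
    · by_cases h : x (i + n + 1) ≤ s
      · rw [bspline_eq_zero hx (Or.inr h), mul_zero]; positivity
      · have : (s - x i) / (x (i + n + 1) - x i) ≤ 1 :=
          div_le_one_of_le₀ (by linarith) (sub_nonneg.2 (hx (by omega)))
        calc _ ≤ 1 * bspline x n i s := mul_le_mul_of_nonneg_right this (h0 i s)
          _ ≤ _ := by rw [one_mul]; exact ih i
    · by_cases h : s < x (i + 1)
      · rw [bspline_eq_zero hx (Or.inl h), mul_zero]; positivity
      · have : (x (i + n + 2) - s) / (x (i + n + 2) - x (i + 1)) ≤ 1 :=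
          div_le_one_of_le₀ (by linarith) (sub_nonneg.2 (hx (by omega)))
        calc _ ≤ 1 * bspline x n (i + 1) s := mul_le_mul_of_nonneg_right this (h0 _ s)
          _ ≤ _ := by rw [one_mul]; exact ih _

theorem measurable_bspline (x : ℕ → ℝ) (n i : ℕ) : Measurable (bspline x n i) := by
  induction n generalizing i with
  | zero =>
    have : bspline x 0 i = fun s => if s ∈ Ico (x i) (x (i + 1)) then 1 else 0 := by
      ext s; rw [bspline]; rfl
    rw [this]
    exact Measurable.ite measurableSet_Ico measurable_const measurable_const
  | succ n ih =>
    have : bspline x (n + 1) i = fun s => (s - x i) / (x (i + n + 1) - x i) * bspline x n i s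
      + (x (i + n + 2) - s) / (x (i + n + 2) - x (i + 1)) * bspline x n (i + 1) s := by
      ext s; rw [bspline]
    rw [this]
    exact (((measurable_id.sub_const _).div_const _).mul (ih i)).add
      (((measurable_const.sub measurable_id).div_const _).mul (ih (i + 1)))

/-- The partition of unity property. -/
theorem sum_bspline {x : ℕ → ℝ} (hx : Monotone x) {m q : ℕ} {s : ℝ} (h1 : x m ≤ s) (h2 : s < x q) :
    ∑ i ∈ Finset.range q, bspline x m i s = 1 := by
  induction m with
  | zero =>
    have : ∀ q, ∑ i ∈ Finset.range q, bspline x 0 i s = if s < x q then 1 else 0 := by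
      intro q
      induction q with
      | zero => simp [not_lt.2 h1]
      | succ q ih =>
        rw [Finset.sum_range_succ, ih, bspline]
        have := hx (Nat.le_succ q)
        by_cases ha : s < x q
        · simp [ha, not_le.2 ha, ha.trans_le this]
        · by_cases hb : s < x (q + 1) <;> simp [ha, hb, not_lt.1 ha]
    rw [this, if_pos h2]
  | succ m ih =>
    have hm := ih ((hx (Nat.le_succ m)).trans h1)
    have hterm : ∀ i, bspline x (m + 1) i s
        = ((s - x i) / (x (i + m + 1) - x i) * bspline x m i s
          - (s - x (i + 1)) / (x (i + 1 + m + 1) - x (i + 1)) * bspline x m (i + 1) s)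
          + bspline x m (i + 1) s := by
      intro i
      rw [bspline, show i + 1 + m + 1 = i + m + 2 by ring]
      rcases eq_or_ne (x (i + m + 2)) (x (i + 1)) with h | h
      · have : bspline x m (i + 1) s = 0 := by
          refine bspline_eq_zero hx ?_
          rw [show i + 1 + m + 1 = i + m + 2 by ring, h]
          exact lt_or_ge s _
        rw [this]; ring
      · have : x (i + m + 2) - x (i + 1) ≠ 0 := sub_ne_zero.2 h
        field_simp; ring
    rw [Finset.sum_congr rfl fun i _ => hterm i, Finset.sum_add_distrib,
      Finset.sum_range_sub' (fun i => (s - x i) / (x (i + m + 1) - x i) * bspline x m i s)]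
    have hq : bspline x m q s = 0 := bspline_eq_zero hx (Or.inl h2)
    have h0 : bspline x m 0 s = 0 := bspline_eq_zero hx (Or.inr (by simpa using h1))
    have h3 := Finset.sum_range_succ' (fun i => bspline x m i s) q
    rw [Finset.sum_range_succ, hm, hq, h0] at h3
    rw [hq, h0, ← add_zero (∑ i ∈ Finset.range q, bspline x m (i + 1) s), ← h3]
    ring

/-- B-splines have right derivatives everywhere. -/
theorem hasDerivWithinAt_bspline {x : ℕ → ℝ} (hx : Monotone x) (n i : ℕ) (s : ℝ) :
    HasDerivWithinAt (bspline x n i) (n * (bspline x (n - 1) i s / (x (i + n) - x i)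
      - bspline x (n - 1) (i + 1) s / (x (i + n + 1) - x (i + 1)))) (Ici s) s := by
  induction n generalizing i with
  | zero =>
    have hc : bspline x 0 i =ᶠ[𝓝[≥] s] fun _ => bspline x 0 i s := by
      rcases lt_or_ge s (x i) with h | h
      · filter_upwards [mem_nhdsWithin_of_mem_nhds (Iio_mem_nhds h)] with r hr
        rw [bspline_eq_zero hx (Or.inl hr), bspline_eq_zero hx (Or.inl h)]
      · rcases lt_or_ge s (x (i + 1)) with h' | h'
        · filter_upwards [mem_nhdsWithin_of_mem_nhds (Iio_mem_nhds h'), self_mem_nhdsWithin]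
            with r hr hr'
          rw [bspline, bspline, if_pos ⟨h.trans hr', hr⟩, if_pos ⟨h, h'⟩]
        · filter_upwards [self_mem_nhdsWithin] with r hr
          rw [bspline_eq_zero hx (Or.inr (by exact h'.trans hr)), bspline_eq_zero hx (Or.inr h')]
    simpa using (hasDerivWithinAt_const s (Ici s) (bspline x 0 i s)).congr_of_eventuallyEq hc rfl
  | succ n ih =>
    have hrec : bspline x (n + 1) i = fun s => (s - x i) / (x (i + n + 1) - x i) * bspline x n i s
      + (x (i + n + 2) - s) / (x (i + n + 2) - x (i + 1)) * bspline x n (i + 1) s := by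
      ext s; rw [bspline]
    have d1 : HasDerivWithinAt (fun s => (s - x i) / (x (i + n + 1) - x i))
        (1 / (x (i + n + 1) - x i)) (Ici s) s :=
      ((hasDerivWithinAt_id s _).sub_const _).div_const _
    have d2 : HasDerivWithinAt (fun s => (x (i + n + 2) - s) / (x (i + n + 2) - x (i + 1)))
        (-1 / (x (i + n + 2) - x (i + 1))) (Ici s) s :=
      ((hasDerivWithinAt_id s _).const_sub _).div_const _
    rw [hrec]
    refine ((d1.mul (ih i)).add (d2.mul (ih (i + 1)))).congr_deriv ?_
    rw [Nat.add_sub_cancel, show i + (n + 1) = i + n + 1 by ring,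
      show i + n + 1 + 1 = i + n + 2 by ring]
    cases n with
    | zero => simp; ring
    | succ m =>
      rw [Nat.add_sub_cancel, show i + 1 + (m + 1) + 1 = i + m + 3 by ring,
        show i + 1 + (m + 1) = i + m + 2 by ring, show i + (m + 1) + 2 = i + m + 3 by ring,
        show i + (m + 1) + 1 = i + m + 2 by ring, show i + 1 + 1 = i + 2 by ring,
        show i + (m + 1) = i + m + 1 by ring]
      have e1 : bspline x (m + 1) i s = (s - x i) / (x (i + m + 1) - x i) * bspline x m i s
        + (x (i + m + 2) - s) / (x (i + m + 2) - x (i + 1)) * bspline x m (i + 1) s := by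
        rw [bspline]
      have e2 : bspline x (m + 1) (i + 1) s
          = (s - x (i + 1)) / (x (i + m + 2) - x (i + 1)) * bspline x m (i + 1) s
        + (x (i + m + 3) - s) / (x (i + m + 3) - x (i + 2)) * bspline x m (i + 2) s := by
        rw [bspline, show i + 1 + m + 1 = i + m + 2 by ring, show i + 1 + m + 2 = i + m + 3 by ring,
          show i + 1 + 1 = i + 2 by ring]
      rw [e1, e2]
      push_cast
      -- the contributions of the middle B-spline agree since `x (i+1) < x (i+m+2)` unless it vanishes
      rcases eq_or_ne (x (i + m + 2)) (x (i + 1)) with h | h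
      · simp only [h, sub_self, div_zero]
        ring
      · have h1 : x (i + m + 2) - x (i + 1) ≠ 0 := sub_ne_zero.2 h
        have hlt : x (i + 1) < x (i + m + 2) := lt_of_le_of_ne (hx (by omega)) h.symm
        have h2 : x (i + m + 2) - x i ≠ 0 := by
          have := hx (show i ≤ i + 1 by omega); exact sub_ne_zero.2 (by linarith [hlt] : x i < _).ne'
        have h3 : x (i + m + 3) - x (i + 1) ≠ 0 := by
          have := hx (show i + m + 2 ≤ i + m + 3 by omega)
          exact sub_ne_zero.2 (by linarith [hlt] : x (i + 1) < _).ne'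
        have hmid : -(s - x i) / (x (i + m + 2) - x i) + (x (i + m + 3) - s) / (x (i + m + 3) - x (i + 1))
            = (x (i + m + 2) - s) / (x (i + m + 2) - x i)
              - (s - x (i + 1)) / (x (i + m + 3) - x (i + 1)) := by
          field_simp; ring
        linear_combination ((m : ℝ) + 1) * bspline x m (i + 1) s / (x (i + m + 2) - x (i + 1)) * hmid

theorem bspline_one (x : ℕ → ℝ) (i : ℕ) (s : ℝ) : bspline x 1 i s
    = (s - x i) / (x (i + 1) - x i) * (if x i ≤ s ∧ s < x (i + 1) then 1 else 0)
      + (x (i + 2) - s) / (x (i + 2) - x (i + 1))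
        * (if x (i + 1) ≤ s ∧ s < x (i + 2) then 1 else 0) := by
  rw [bspline, bspline, bspline]

/-- B-splines of positive degree are continuous away from multiple knots. -/
theorem continuousOn_bspline {x : ℕ → ℝ} (hx : Monotone x) {α β : ℝ}
    (hs : ∀ i, x i < x (i + 1) ∨ x (i + 1) ≤ α ∨ β ≤ x i) (n i : ℕ) :
    ContinuousOn (bspline x (n + 1) i) (Ico α β) := by
  induction n generalizing i with
  | zero =>
    have h01 := hx (show i ≤ i + 1 by omega)
    have h12 := hx (show i + 1 ≤ i + 2 by omega)
    have hzero : (∀ s ∈ Ico α β, bspline x 1 i s = 0) → ContinuousOn (bspline x 1 i) (Ico α β) :=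
      fun h => continuousOn_const.congr h
    rcases hs i with h1 | h1 | h1
    · rcases hs (i + 1) with h2 | h2 | h2
      · have : bspline x 1 i = fun s => max 0 (min ((s - x i) / (x (i + 1) - x i))
            ((x (i + 2) - s) / (x (i + 2) - x (i + 1)))) := by
          ext s
          have p1 : 0 < x (i + 1) - x i := sub_pos.2 h1
          have p2 : 0 < x (i + 2) - x (i + 1) := sub_pos.2 h2
          rw [bspline_one]
          rcases lt_or_ge s (x i) with a | a
          · rw [if_neg (by rintro ⟨b, _⟩; linarith), if_neg (by rintro ⟨b, _⟩; linarith)]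
            rw [max_eq_left]; · ring
            exact (min_le_left _ _).trans (div_nonpos_of_nonpos_of_nonneg (by linarith) p1.le)
          · rcases lt_or_ge s (x (i + 1)) with b | b
            · rw [if_pos ⟨a, b⟩, if_neg (by rintro ⟨b, _⟩; linarith), min_eq_left, max_eq_right]
              · ring
              · exact div_nonneg (by linarith) p1.le
              · calc _ ≤ (1 : ℝ) := (div_le_one p1).2 (by linarith)
                  _ ≤ _ := (one_le_div p2).2 (by linarith)
            · rcases lt_or_ge s (x (i + 2)) with c | c
              · rw [if_neg (by rintro ⟨_, b⟩; linarith), if_pos ⟨b, c⟩, min_eq_right, max_eq_right]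
                · ring
                · exact div_nonneg (by linarith) p2.le
                · calc _ ≤ (1 : ℝ) := (div_le_one p2).2 (by linarith)
                    _ ≤ _ := (one_le_div p1).2 (by linarith)
              · rw [if_neg (by rintro ⟨_, b⟩; linarith), if_neg (by rintro ⟨_, b⟩; linarith),
                  max_eq_left]; · ring
                exact (min_le_right _ _).trans
                  (div_nonpos_of_nonpos_of_nonneg (by linarith) p2.le)
        rw [zero_add, this]
        fun_prop
      · exact hzero fun s hs => bspline_eq_zero hx (Or.inr (le_trans h2 hs.1))
      · have : ∀ s ∈ Ico α β, bspline x 1 i s = max 0 ((s - x i) / (x (i + 1) - x i)) := by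
          intro s hs
          have p1 : 0 < x (i + 1) - x i := sub_pos.2 h1
          have b : s < x (i + 1) := hs.2.trans_le h2
          rw [bspline_one, if_neg (show ¬(x (i + 1) ≤ s ∧ s < x (i + 2)) from
            fun h => absurd b (not_lt.2 h.1))]
          rcases lt_or_ge s (x i) with a | a
          · rw [if_neg (by rintro ⟨b, _⟩; linarith), max_eq_left]; · ring
            exact div_nonpos_of_nonpos_of_nonneg (by linarith) p1.le
          · rw [if_pos ⟨a, b⟩, max_eq_right]; · ring
            exact div_nonneg (by linarith) p1.le
        exact ContinuousOn.congr (by fun_prop) this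
    · have : ∀ s ∈ Ico α β, bspline x 1 i s
          = max 0 ((x (i + 2) - s) / (x (i + 2) - x (i + 1))) := by
        intro s hs
        have a : x (i + 1) ≤ s := h1.trans hs.1
        rw [bspline_one, if_neg (fun h => absurd h.2 (not_lt.2 a))]
        rcases lt_or_ge s (x (i + 2)) with b | b
        · rw [if_pos ⟨a, b⟩, max_eq_right]; · ring
          exact div_nonneg (by linarith) (by linarith)
        · rw [if_neg (by rintro ⟨_, b⟩; linarith), max_eq_left]; · ring
          exact div_nonpos_of_nonpos_of_nonneg (by linarith) (by linarith)
      exact ContinuousOn.congr (by fun_prop) this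
    · exact hzero fun s hs => bspline_eq_zero hx (Or.inl (hs.2.trans_le h1))
  | succ n ih =>
    have hrec : bspline x (n + 1 + 1) i = fun s =>
      (s - x i) / (x (i + (n + 1) + 1) - x i) * bspline x (n + 1) i s
      + (x (i + (n + 1) + 2) - s) / (x (i + (n + 1) + 2) - x (i + 1)) * bspline x (n + 1) (i + 1) s := by
      ext s; rw [bspline]
    rw [hrec]
    exact (ContinuousOn.mul (by fun_prop) (ih i)).add (ContinuousOn.mul (by fun_prop) (ih (i + 1)))

/-- The spline of degree `m` on the knots `x` with coefficients `c 0, …, c (q - 1)`. -/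
noncomputable def splineSum (x : ℕ → ℝ) (q m : ℕ) (c : ℕ → ℝ) (s : ℝ) : ℝ :=
  ∑ i ∈ Finset.range q, c i * bspline x m i s

/-- The coefficients of the derivative of a spline of degree `m + 1`. For `i = 0` the truncated
subtraction makes the coefficient `0`; the B-spline of index `0` and degree `m` vanishes on the
range `s ≥ x (m + 1)` where the derivative is considered. -/
noncomputable def splineDeriv (x : ℕ → ℝ) (m : ℕ) (c : ℕ → ℝ) (i : ℕ) : ℝ :=
  (m + 1) * (c i - c (i - 1)) / (x (i + m + 1) - x i)

theorem intervalIntegrable_splineSum {x : ℕ → ℝ} (hx : Monotone x) (q m : ℕ) (c : ℕ → ℝ) (a b : ℝ) :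
    IntervalIntegrable (splineSum x q m c) volume a b := by
  have : splineSum x q m c = ∑ i ∈ Finset.range q, fun s => c i * bspline x m i s := by
    ext s; simp [splineSum]
  rw [this]
  refine IntervalIntegrable.sum _ fun i _ => IntervalIntegrable.const_mul ?_ _
  rw [intervalIntegrable_iff]
  have : IsFiniteMeasure (volume.restrict (uIoc a b)) := ⟨by simp [uIoc]⟩
  refine Integrable.of_bound (measurable_bspline x m i).aestronglyMeasurable (2 ^ m)
    (ae_of_all _ fun s => ?_)
  rw [Real.norm_eq_abs, abs_of_nonneg (bspline_nonneg hx m i s)]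
  exact bspline_le hx m i s

theorem measurable_splineSum (x : ℕ → ℝ) (q m : ℕ) (c : ℕ → ℝ) : Measurable (splineSum x q m c) :=
  Finset.measurable_fun_sum _ fun i _ => (measurable_bspline x m i).const_mul (c i)

theorem hasDerivWithinAt_splineSum {x : ℕ → ℝ} (hx : Monotone x) {q m : ℕ} (c : ℕ → ℝ) {s : ℝ}
    (h1 : x (m + 1) ≤ s) (h2 : s < x q) :
    HasDerivWithinAt (splineSum x q (m + 1) c) (splineSum x q m (splineDeriv x m c) s) (Ici s) s := by
  have hd : HasDerivWithinAt (splineSum x q (m + 1) c) _ (Ici s) s :=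
    HasDerivWithinAt.fun_sum fun i (_ : i ∈ Finset.range q) =>
      (hasDerivWithinAt_bspline hx (m + 1) i s).const_mul (c i)
  refine hd.congr_deriv ?_
  set f : ℕ → ℝ := fun i => bspline x m i s / (x (i + m + 1) - x i) with hf
  have hf0 : f 0 = 0 := by
    simp only [hf]; rw [bspline_eq_zero hx (Or.inr (by simpa using h1)), zero_div]
  have hfq : f q = 0 := by
    simp only [hf]; rw [bspline_eq_zero hx (Or.inl h2), zero_div]
  have habel : ∀ q, ∑ i ∈ Finset.range q, c i * (f i - f (i + 1))
      = ∑ i ∈ Finset.range q, (c i - c (i - 1)) * f i - c (q - 1) * f q := by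
    intro q
    induction q with
    | zero => simp [hf0]
    | succ q ih => rw [Finset.sum_range_succ, ih, Finset.sum_range_succ, Nat.add_sub_cancel]; ring
  have e1 : ∀ i ∈ Finset.range q, c i * (((m + 1 : ℕ) : ℝ) *
      (bspline x (m + 1 - 1) i s / (x (i + (m + 1)) - x i)
        - bspline x (m + 1 - 1) (i + 1) s / (x (i + (m + 1) + 1) - x (i + 1))))
      = (m + 1) * (c i * (f i - f (i + 1))) := by
    intro i _
    simp only [hf, Nat.add_sub_cancel]
    rw [show i + 1 + m + 1 = i + (m + 1) + 1 by ring, show i + m + 1 = i + (m + 1) by ring]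
    push_cast; ring
  rw [Finset.sum_congr rfl e1, ← Finset.mul_sum, habel, hfq, mul_zero, sub_zero, Finset.mul_sum,
    splineSum]
  refine Finset.sum_congr rfl fun i _ => ?_
  simp only [hf, splineDeriv]; ring

/-- A spline is a primitive of its derivative. -/
theorem splineSum_eq_integral {x : ℕ → ℝ} (hx : Monotone x) {α β : ℝ}
    (hs : ∀ i, x i < x (i + 1) ∨ x (i + 1) ≤ α ∨ β ≤ x i) {q m : ℕ} (c : ℕ → ℝ)
    (h1 : x (m + 1) ≤ α) (h2 : β ≤ x q) {t : ℝ} (ht : t ∈ Ico α β) :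
    splineSum x q (m + 1) c t
      = splineSum x q (m + 1) c α + ∫ s in α..t, splineSum x q m (splineDeriv x m c) s := by
  rw [intervalIntegral.integral_eq_sub_of_hasDeriv_right_of_le ht.1
    (f := splineSum x q (m + 1) c)]
  · ring
  · have : ContinuousOn (splineSum x q (m + 1) c) (Ico α β) :=
      continuousOn_finsetSum _ fun i _ => continuousOn_const.mul (continuousOn_bspline hx hs m i)
    exact this.mono fun s hs => ⟨hs.1, hs.2.trans_lt ht.2⟩
  · intro s hs
    exact (hasDerivWithinAt_splineSum hx c (h1.trans hs.1.le)
      ((hs.2.trans ht.2).trans_le h2)).mono Ioi_subset_Ici_self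
  · exact intervalIntegrable_splineSum hx _ _ _ _ _

/-- Spline quasi-interpolation: if the coefficients are close to the value `y`, so is the spline. -/
theorem abs_splineSum_sub_le {x : ℕ → ℝ} (hx : Monotone x) {q m : ℕ} {c : ℕ → ℝ} {s y δ : ℝ}
    (h1 : x m ≤ s) (h2 : s < x q)
    (hc : ∀ i < q, x i ≤ s → s < x (i + m + 1) → |c i - y| ≤ δ) :
    |splineSum x q m c s - y| ≤ δ := by
  have hpu := sum_bspline hx h1 h2
  have e : splineSum x q m c s - y = ∑ i ∈ Finset.range q, (c i - y) * bspline x m i s := by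
    simp only [sub_mul, Finset.sum_sub_distrib, ← Finset.mul_sum, hpu, mul_one, splineSum]
  rw [e]
  calc _ ≤ ∑ i ∈ Finset.range q, |(c i - y) * bspline x m i s| := Finset.abs_sum_le_sum_abs _ _
    _ ≤ ∑ i ∈ Finset.range q, δ * bspline x m i s := by
        refine Finset.sum_le_sum fun i hi => ?_
        rw [abs_mul, abs_of_nonneg (bspline_nonneg hx m i s)]
        by_cases h : x i ≤ s ∧ s < x (i + m + 1)
        · exact mul_le_mul_of_nonneg_right (hc i (Finset.mem_range.1 hi) h.1 h.2)
            (bspline_nonneg hx m i s)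
        · rw [bspline_eq_zero hx, mul_zero, mul_zero]
          by_contra h'
          rw [not_or, not_lt, not_le] at h'
          exact h h'
    _ = δ := by rw [← Finset.mul_sum, hpu, mul_one]


/-! ### Splines on the unit interval -/

theorem PrimChain.sub {T : ℝ} (hT : 0 ≤ T) {k : ℕ} {A B : ℕ → ℝ → ℝ} (hA : PrimChain T k A)
    (hB : PrimChain T k B) : PrimChain T k fun i t => A i t - B i t := by
  refine ⟨hA.top.sub hB.top, fun i hi t ht => ?_⟩
  have hsub : uIcc 0 t ⊆ uIcc 0 T := by
    rw [uIcc_of_le ht.1, uIcc_of_le hT]; exact Icc_subset_Icc_right ht.2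
  rw [hA.step i hi t ht, hB.step i hi t ht, intervalIntegral.integral_sub
    ((hA.intervalIntegrable hT (by omega)).mono_set hsub)
    ((hB.intervalIntegrable hT (by omega)).mono_set hsub)]
  ring

/-- A function vanishing at `0` with its derivatives of order below `k` is bounded by the `L¹` norm
of its derivative of order `k`. -/
theorem PrimChain.abs_le_integral {k : ℕ} (hk : 0 < k) {A : ℕ → ℝ → ℝ} (hA : PrimChain 1 k A)
    (h0 : ∀ i < k, A i 0 = 0) {t : ℝ} (ht : t ∈ Icc (0 : ℝ) 1) :
    |A 0 t| ≤ ∫ s in (0 : ℝ)..1, |A k s| := by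
  have key : ∀ m i, i + m + 1 = k → ∀ t ∈ Icc (0 : ℝ) 1, |A i t| ≤ ∫ s in (0 : ℝ)..1, |A k s| := by
    intro m
    induction m with
    | zero =>
      intro i hi t ht
      rw [hA.step i (by omega) t ht, h0 i (by omega), zero_add, show i + 1 = k by omega]
      refine (intervalIntegral.abs_integral_le_integral_abs ht.1).trans ?_
      refine intervalIntegral.integral_mono_interval le_rfl ht.1 ht.2
        (ae_of_all _ fun s => abs_nonneg _) hA.top.abs
    | succ m ih =>
      intro i hi t ht
      rw [hA.step i (by omega) t ht, h0 i (by omega), zero_add]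
      have := intervalIntegral.norm_integral_le_of_norm_le_const (a := 0) (b := t)
        (f := A (i + 1)) (C := ∫ s in (0 : ℝ)..1, |A k s|) fun s hs => by
          rw [uIoc_of_le ht.1] at hs
          exact ih (i + 1) (by omega) s ⟨hs.1.le, hs.2.trans ht.2⟩
      rw [Real.norm_eq_abs, sub_zero, abs_of_nonneg ht.1] at this
      refine this.trans (mul_le_of_le_one_right ?_ ht.2)
      exact intervalIntegral.integral_nonneg zero_le_one fun s _ => abs_nonneg _
  exact key (k - 1) 0 (by omega) t ht

/-- The chain obtained by prepending the primitive of `A 0` with value `v` at `0`. -/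
noncomputable def chainCons (v : ℝ) (A : ℕ → ℝ → ℝ) : ℕ → ℝ → ℝ
  | 0 => fun t => v + ∫ s in (0 : ℝ)..t, A 0 s
  | i + 1 => A i

theorem chainCons_zero (v : ℝ) (A : ℕ → ℝ → ℝ) (t : ℝ) :
    chainCons v A 0 t = v + ∫ s in (0 : ℝ)..t, A 0 s := rfl

theorem PrimChain.cons {T : ℝ} {k : ℕ} {A : ℕ → ℝ → ℝ} (hA : PrimChain T k A) (v : ℝ) :
    PrimChain T (k + 1) (chainCons v A) := by
  refine ⟨hA.top, fun i hi t ht => ?_⟩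
  cases i with
  | zero => simp [chainCons]
  | succ i => exact hA.step i (by omega) t ht

theorem monotone_timeKnot (n : ℕ) {N : ℕ} (hN : 1 ≤ N) : Monotone (timeKnot n N) := by
  refine monotone_nat_of_le_succ fun i => ?_
  have hN' : (0 : ℝ) < N := by exact_mod_cast hN
  unfold timeKnot
  split_ifs with h1 h2 h3 h4 h5 h6
  · exact le_rfl
  · have : (n : ℝ) ≤ (i + 1 : ℕ) := by exact_mod_cast not_lt.1 h2
    exact div_nonneg (by linarith) hN'.le
  · exact zero_le_one
  · omega
  · gcongr; simp
  · rw [div_le_one hN']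
    have : (i : ℝ) ≤ n + N := by exact_mod_cast h4.le
    linarith
  all_goals first | omega | exact le_rfl

theorem timeKnot_simple (n : ℕ) {N : ℕ} (hN : 1 ≤ N) (i : ℕ) :
    timeKnot n N i < timeKnot n N (i + 1) ∨ timeKnot n N (i + 1) ≤ 0 ∨ 1 ≤ timeKnot n N i := by
  have hN' : (0 : ℝ) < N := by exact_mod_cast hN
  by_cases h1 : i < n
  · right; left
    unfold timeKnot
    split_ifs with h2 h3
    · exact le_rfl
    · have : i + 1 = n := by omega
      rw [← this]; simp
    · omega
  · by_cases h2 : i < n + N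
    · left
      unfold timeKnot
      rw [if_neg h1, if_pos h2, if_neg (by omega)]
      split_ifs with h3
      · push_cast; gcongr; simp
      · rw [div_lt_one hN']
        have : (i : ℝ) < n + N := by exact_mod_cast h2
        linarith
    · right; right
      unfold timeKnot
      rw [if_neg h1, if_neg h2]

theorem timeKnot_le_zero {n N m : ℕ} (hN : 1 ≤ N) (hm : m ≤ n) : timeKnot n N m ≤ 0 := by
  unfold timeKnot
  split_ifs with h1 h2
  · exact le_rfl
  · have : m = n := by omega
    subst this; simp
  · omega

theorem timeKnot_last (n N : ℕ) : timeKnot n N (n + N) = 1 := by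
  unfold timeKnot
  rw [if_neg (by omega), if_neg (by omega)]

theorem timeKnot_add_le (n : ℕ) {N : ℕ} (hN : 1 ≤ N) (i j : ℕ) :
    timeKnot n N (i + j) ≤ timeKnot n N i + j / N := by
  have hN' : (0 : ℝ) < N := by exact_mod_cast hN
  induction j with
  | zero => simp
  | succ j ih =>
    have : timeKnot n N (i + j + 1) ≤ timeKnot n N (i + j) + 1 / N := by
      have hpos : (0 : ℝ) ≤ 1 / N := by positivity
      unfold timeKnot
      by_cases h1 : i + j + 1 < n
      · rw [if_pos h1, if_pos (by omega)]; linarith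
      · rw [if_neg h1]
        by_cases h2 : i + j < n
        · have : i + j + 1 = n := by omega
          rw [if_pos h2, if_pos (by omega), this]; simp
        · rw [if_neg h2]
          by_cases h3 : i + j + 1 < n + N
          · rw [if_pos h3, if_pos (by omega), ← add_div]
            push_cast; gcongr; linarith
          · rw [if_neg h3]
            by_cases h4 : i + j < n + N
            · have h : i + j + 1 = n + N := by omega
              have h' : (i : ℝ) + j + 1 = n + N := by exact_mod_cast h
              rw [if_pos h4, ← add_div, le_div_iff₀ hN']
              push_cast; linarith
            · rw [if_neg h4]; linarith
    rw [← add_assoc]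
    push_cast
    rw [add_div]
    linarith

/-- Every time spline generates a chain of splines. -/
theorem exists_primChain_of_timeSpline {n N : ℕ} (hN : 1 ≤ N) (m j : ℕ) (hmj : m + j ≤ n)
    (c : ℕ → ℝ) : ∃ (A : ℕ → ℝ → ℝ) (e : ℕ → ℝ), PrimChain 1 j A ∧
      A j = splineSum (timeKnot n N) (n + N) m e ∧
      ∀ t ∈ Ico (0 : ℝ) 1, A 0 t = splineSum (timeKnot n N) (n + N) (m + j) c t := by
  have hx := monotone_timeKnot n hN
  induction j generalizing c with
  | zero =>
    exact ⟨fun _ => splineSum (timeKnot n N) (n + N) m c, c,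
      ⟨intervalIntegrable_splineSum hx _ _ _ _ _, by simp⟩, rfl, fun _ _ => rfl⟩
  | succ j ih =>
    obtain ⟨A, e, hA, hAj, hA0⟩ := ih (by omega) (splineDeriv (timeKnot n N) (m + j) c)
    refine ⟨chainCons (splineSum (timeKnot n N) (n + N) (m + j + 1) c 0) A, e, hA.cons _, hAj,
      fun t ht => ?_⟩
    rw [← add_assoc, splineSum_eq_integral hx (timeKnot_simple n hN) c
      (timeKnot_le_zero hN (by omega)) (timeKnot_last n N).ge ht, chainCons_zero]
    have hI : ∫ s in (0 : ℝ)..t, A 0 s = ∫ s in (0 : ℝ)..t,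
        splineSum (timeKnot n N) (n + N) (m + j) (splineDeriv (timeKnot n N) (m + j) c) s := by
      refine intervalIntegral.integral_congr fun s hs => ?_
      rw [uIcc_of_le ht.1] at hs
      exact hA0 s ⟨hs.1, hs.2.trans_lt ht.2⟩
    rw [hI]

/-- Iterated primitives of time splines are time splines of higher degree. -/
theorem exists_timeSpline_primChain {n N : ℕ} (hN : 1 ≤ N) (m j : ℕ) (hmj : m + j ≤ n)
    (e v : ℕ → ℝ) : ∃ (A : ℕ → ℝ → ℝ) (c : ℕ → ℝ), PrimChain 1 j A ∧
      A j = splineSum (timeKnot n N) (n + N) m e ∧ (∀ i < j, A i 0 = v i) ∧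
      ∀ t ∈ Ico (0 : ℝ) 1, A 0 t = splineSum (timeKnot n N) (n + N) (m + j) c t := by
  have hx := monotone_timeKnot n hN
  induction j generalizing v with
  | zero =>
    exact ⟨fun _ => splineSum (timeKnot n N) (n + N) m e, e,
      ⟨intervalIntegrable_splineSum hx _ _ _ _ _, by simp⟩, rfl, by simp, fun _ _ => rfl⟩
  | succ j ih =>
    obtain ⟨A, c, hA, hAj, hAv, hA0⟩ := ih (by omega) fun i => v (i + 1)
    set x := timeKnot n N with hxdef
    -- summation of the coefficients inverts differentiation
    set b : ℕ → ℝ := fun i => ∑ r ∈ Finset.range i,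
      c (r + 1) * (x (r + 1 + (m + j) + 1) - x (r + 1)) / ((m + j : ℕ) + 1) with hb
    set C : ℝ := v 0 - splineSum x (n + N) (m + j + 1) b 0 with hC
    have hm0 : ∀ s ∈ Ico (0 : ℝ) 1, x (m + j + 1) ≤ s := fun s hs =>
      (timeKnot_le_zero hN (by omega)).trans hs.1
    have hq : ∀ s ∈ Ico (0 : ℝ) 1, s < x (n + N) := fun s hs => by
      rw [hxdef, timeKnot_last]; exact hs.2
    have hshift : ∀ s ∈ Ico (0 : ℝ) 1, splineSum x (n + N) (m + j + 1) (fun i => b i + C) s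
        = splineSum x (n + N) (m + j + 1) b s + C := by
      intro s hs
      simp only [splineSum, add_mul, Finset.sum_add_distrib, ← Finset.mul_sum]
      rw [sum_bspline hx (hm0 s hs) (hq s hs), mul_one]
    have hder : ∀ s ∈ Ico (0 : ℝ) 1,
        splineSum x (n + N) (m + j) (splineDeriv x (m + j) fun i => b i + C) s
        = splineSum x (n + N) (m + j) c s := by
      intro s hs
      refine Finset.sum_congr rfl fun i _ => ?_
      cases i with
      | zero =>
        rw [bspline_eq_zero hx (Or.inr (by simpa using hm0 s hs)), mul_zero, mul_zero]
      | succ i =>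
        rcases eq_or_ne (x (i + 1 + (m + j) + 1)) (x (i + 1)) with h | h
        · rw [bspline_eq_zero hx (by rw [h]; exact lt_or_ge s _), mul_zero, mul_zero]
        · congr 1
          have h' := sub_ne_zero.2 h
          have h2 : ((m + j : ℕ) : ℝ) + 1 ≠ 0 := by positivity
          rw [splineDeriv, Nat.add_sub_cancel, add_sub_add_right_eq_sub]
          simp only [hb]
          rw [Finset.sum_range_succ, add_sub_cancel_left]
          field_simp
    refine ⟨chainCons (v 0) A, fun i => b i + C, hA.cons _, hAj, ?_, fun t ht => ?_⟩
    · intro i hi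
      cases i with
      | zero => simp [chainCons]
      | succ i => exact hAv i (by omega)
    · have hI : ∫ s in (0 : ℝ)..t, A 0 s = ∫ s in (0 : ℝ)..t,
          splineSum x (n + N) (m + j) (splineDeriv x (m + j) fun i => b i + C) s := by
        refine intervalIntegral.integral_congr fun s hs => ?_
        rw [uIcc_of_le ht.1] at hs
        have hs' : s ∈ Ico (0 : ℝ) 1 := ⟨hs.1, hs.2.trans_lt ht.2⟩
        rw [hder s hs']
        exact hA0 s hs'
      have h0 := hshift 0 ⟨le_rfl, zero_lt_one⟩
      rw [← add_assoc, splineSum_eq_integral hx (timeKnot_simple n hN) _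
        (timeKnot_le_zero hN (by omega)) (timeKnot_last n N).ge ht, chainCons_zero, hI, h0, hC]
      ring

/-- Functions with square integrable derivative of order `k ≤ n` are approximated by splines of
degree `n`, together with this derivative. -/
theorem exists_timeSpline_approx {n k : ℕ} (hk : 0 < k) (hkn : k ≤ n) {A : ℕ → ℝ → ℝ}
    (hA : PrimChain 1 k A) (hA2 : MemLp (A k) 2 (volume.restrict (Ioc 0 1))) {ε : ℝ} (hε : 0 < ε) :
    ∀ᶠ N : ℕ in atTop, ∃ (A' : ℕ → ℝ → ℝ) (c : ℕ → ℝ), PrimChain 1 k A' ∧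
      MemLp (A' k) 2 (volume.restrict (Ioc 0 1)) ∧
      (∀ t ∈ Ico (0 : ℝ) 1, A' 0 t = splineSum (timeKnot n N) (n + N) n c t) ∧
      eLpNorm (fun t => A k t - A' k t) 2 (volume.restrict (Ioc 0 1)) ≤ ENNReal.ofReal ε ∧
      ∀ t ∈ Icc (0 : ℝ) 1, |A 0 t - A' 0 t| ≤ ε := by
  set μ : Measure ℝ := volume.restrict (Ioc 0 1) with hμ
  have hμ1 : μ univ = 1 := by simp [hμ]
  have : IsFiniteMeasure μ := ⟨by simp [hμ1]⟩
  obtain ⟨f, hf, hf2⟩ := hA2.exists_boundedContinuous_eLpNorm_sub_le (by simp)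
    (ε := ENNReal.ofReal (ε / 2)) (by simpa using hε)
  have hfu : UniformContinuousOn f (Icc (-1 : ℝ) 2) :=
    isCompact_Icc.uniformContinuousOn_of_continuous f.continuous.continuousOn
  rw [Metric.uniformContinuousOn_iff] at hfu
  obtain ⟨δ, hδ, hfδ⟩ := hfu (ε / 2) (by positivity)
  filter_upwards [eventually_ge_atTop 1,
    (tendsto_natCast_atTop_atTop.const_div_atTop ((n : ℝ) + 1)).eventually_lt_const hδ] with N hN hNδ
  have hN' : (0 : ℝ) < N := by exact_mod_cast hN
  have hx := monotone_timeKnot n hN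
  set x := timeKnot n N with hxdef
  obtain ⟨A', c, hA', hA'k, hA'v, hA'0⟩ := exists_timeSpline_primChain (n := n) hN (n - k) k
    (by omega) (fun i => f (x i)) (fun i => A i 0)
  rw [Nat.sub_add_cancel hkn] at hA'0
  have hclose : ∀ s ∈ Ico (0 : ℝ) 1, |A' k s - f s| ≤ ε / 2 := by
    intro s hs
    rw [hA'k]
    have h1 : x (n - k) ≤ s := (timeKnot_le_zero hN (by omega)).trans hs.1
    have h2 : s < x (n + N) := by rw [hxdef, timeKnot_last]; exact hs.2
    refine abs_splineSum_sub_le hx h1 h2 fun i hi hi1 hi2 => ?_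
    have h0 : 0 ≤ x i := by
      have := hx (Nat.zero_le i)
      refine le_trans ?_ this
      simp only [hxdef, timeKnot]
      split_ifs with h1 h2
      · exact le_rfl
      · have : n = 0 := by omega
        subst this; simp
      · exact zero_le_one
    have h3 : s - x i < δ := by
      have h4 := timeKnot_add_le n hN i (n - k + 1)
      rw [← hxdef] at h4
      have h5 : (((n - k + 1 : ℕ)) : ℝ) / N ≤ (n + 1) / N := by
        gcongr
        have : n - k + 1 ≤ n + 1 := by omega
        exact_mod_cast this
      rw [← add_assoc] at h4
      linarith
    have := hfδ (x i) ⟨by linarith, by linarith [hs.2]⟩ s ⟨by linarith [hs.1], by linarith [hs.2]⟩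
      (by rw [Real.dist_eq, abs_sub_comm, abs_of_nonneg (by linarith)]; exact h3)
    rw [Real.dist_eq] at this
    exact this.le
  have hA'2 : MemLp (A' k) 2 μ := by
    rw [hA'k]
    refine MemLp.of_bound (measurable_splineSum _ _ _ _).aestronglyMeasurable
      (∑ i ∈ Finset.range (n + N), |f (x i)| * 2 ^ (n - k)) (ae_of_all _ fun s => ?_)
    refine (norm_sum_le _ _).trans (Finset.sum_le_sum fun i _ => ?_)
    rw [norm_mul, Real.norm_eq_abs, Real.norm_eq_abs, abs_of_nonneg (bspline_nonneg hx _ _ _)]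
    exact mul_le_mul_of_nonneg_left (bspline_le hx _ _ _) (abs_nonneg _)
  have hnorm : eLpNorm (fun t => A k t - A' k t) 2 μ ≤ ENNReal.ofReal ε := by
    have e : (fun t => A k t - A' k t) = (A k - f) + (f - A' k) := by ext t; simp
    rw [e]
    refine (eLpNorm_add_le (hA2.1.sub hf2.1) (hf2.1.sub hA'2.1) (by norm_num)).trans ?_
    rw [← add_halves ε, ENNReal.ofReal_add (by positivity) (by positivity)]
    refine add_le_add hf ?_
    refine (eLpNorm_le_of_ae_bound (C := ε / 2) ?_).trans (by simp [hμ1])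
    have hne : ∀ᵐ s ∂μ, s ≠ 1 := ae_restrict_of_ae (by simp [ae_iff, measure_singleton])
    filter_upwards [ae_restrict_mem measurableSet_Ioc, hne] with s hs hs1
    rw [Pi.sub_apply, Real.norm_eq_abs, abs_sub_comm]
    exact hclose s ⟨hs.1.le, lt_of_le_of_ne hs.2 hs1⟩
  refine ⟨A', c, hA', hA'2, hA'0, hnorm, fun t ht => ?_⟩
  have h1 := (hA.sub zero_le_one hA').abs_le_integral hk
    (fun i hi => by rw [hA'v i hi, sub_self]) ht
  refine h1.trans ?_
  have hint : MemLp (fun t => A k t - A' k t) 2 μ := hA2.sub hA'2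
  have h2 : eLpNorm (fun t => A k t - A' k t) 1 μ ≤ ENNReal.ofReal ε := by
    refine (eLpNorm_le_eLpNorm_mul_rpow_measure_univ (q := 2) (by norm_num) hint.1).trans ?_
    rw [hμ1, ENNReal.one_rpow, mul_one]
    exact hnorm
  rw [intervalIntegral.integral_of_le zero_le_one]
  have h3 := ENNReal.toReal_mono ENNReal.ofReal_ne_top h2
  rw [ENNReal.toReal_ofReal hε.le, eLpNorm_one_eq_lintegral_enorm,
    ← integral_norm_eq_lintegral_enorm hint.1] at h3
  exact h3


/-! ### Periodic splines -/

theorem strictMono_circleKnot (n : ℕ) {N : ℕ} (hN : 1 ≤ N) : StrictMono (circleKnot n N) := by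
  intro i j hij
  have hN' : (0 : ℝ) < N := by exact_mod_cast hN
  have : (i : ℝ) < j := by exact_mod_cast hij
  unfold circleKnot
  have := Real.pi_pos
  gcongr

theorem circleKnot_add (n : ℕ) {N : ℕ} (i r : ℕ) :
    circleKnot n N (i + r) = circleKnot n N i + r * (2 * Real.pi / N) := by
  unfold circleKnot; push_cast; ring

theorem circleKnot_add_period (n : ℕ) {N : ℕ} (hN : 1 ≤ N) (i : ℕ) :
    circleKnot n N (i + N) = circleKnot n N i + 2 * Real.pi := by
  have hN' : (N : ℝ) ≠ 0 := by positivity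
  rw [circleKnot_add]; field_simp

theorem circleKnot_self (n N : ℕ) : circleKnot n N n = 0 := by simp [circleKnot]

theorem bspline_circleKnot_add (n N m i r : ℕ) (s : ℝ) :
    bspline (circleKnot n N) m (i + r) s
      = bspline (circleKnot n N) m i (s - r * (2 * Real.pi / N)) := by
  induction m generalizing i with
  | zero =>
    rw [bspline, bspline, circleKnot_add, show i + r + 1 = i + 1 + r by ring, circleKnot_add]
    simp only [le_sub_iff_add_le, sub_lt_iff_lt_add]
  | succ m ih =>
    rw [bspline, bspline, ih, show i + r + 1 = i + 1 + r by ring, ih,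
      show i + r + m + 1 = i + m + 1 + r by ring, show i + r + m + 2 = i + m + 2 + r by ring]
    simp only [circleKnot_add _ _ r]
    congr 2 <;> congr 1 <;> ring

theorem bspline_circleKnot_add_period (n : ℕ) {N : ℕ} (hN : 1 ≤ N) (m i r : ℕ) (s : ℝ) :
    bspline (circleKnot n N) m (i + r * N) s
      = bspline (circleKnot n N) m i (s - 2 * Real.pi * r) := by
  have hN' : (N : ℝ) ≠ 0 := by positivity
  rw [bspline_circleKnot_add]
  congr 1; push_cast; field_simp

theorem circleSpline_eq_sum {n N : ℕ} (hN : 1 ≤ N) {j : ℕ} (hj : j < N) {θ : ℝ}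
    (hθ : θ ∈ Ico 0 (2 * Real.pi)) :
    circleSpline n N j θ
      = ∑ r ∈ Finset.range (n + 2), bspline (circleKnot n N) n (j + r * N) θ := by
  have hx := (strictMono_circleKnot n hN).monotone
  have h2π := circleKnot_add_period n hN n
  rw [circleKnot_self, zero_add] at h2π
  unfold circleSpline
  have hinj : Function.Injective fun r : ℕ => -(r : ℤ) := fun a b h => by simpa using h
  rw [← hinj.tsum_eq (f := fun z : ℤ => bspline (circleKnot n N) n j (θ + 2 * Real.pi * z))]
  · have : ∀ r : ℕ, bspline (circleKnot n N) n j (θ + 2 * Real.pi * ((-(r : ℤ) : ℤ) : ℝ))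
        = bspline (circleKnot n N) n (j + r * N) θ := by
      intro r
      rw [bspline_circleKnot_add_period n hN]
      push_cast; congr 1; ring
    simp only [this]
    refine tsum_eq_sum fun r hr => bspline_eq_zero hx (Or.inl (hθ.2.trans_le ?_))
    rw [← h2π]
    refine hx ?_
    rw [Finset.mem_range, not_lt] at hr
    nlinarith [Nat.mul_le_mul hr (le_refl N)]
  · intro z hz
    by_contra hz'
    refine hz (bspline_eq_zero hx (Or.inr ?_))
    have hz1 : 1 ≤ z := by
      by_contra h
      exact hz' ⟨(-z).toNat, by simp only [Int.ofNat_toNat]; omega⟩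
    have h1 : circleKnot n N (j + n + 1) ≤ 2 * Real.pi := by
      rw [← h2π]; exact hx (by omega)
    have h2 : (1 : ℝ) ≤ z := by exact_mod_cast hz1
    nlinarith [Real.pi_pos, hθ.1]

theorem sum_range_mul_eq (N R : ℕ) (f : ℕ → ℝ) :
    ∑ i ∈ Finset.range (R * N), f i
      = ∑ j ∈ Finset.range N, ∑ r ∈ Finset.range R, f (j + r * N) := by
  induction R with
  | zero => simp
  | succ R ih =>
    rw [Nat.succ_mul, Finset.sum_range_add, ih, ← Finset.sum_add_distrib]
    refine Finset.sum_congr rfl fun j _ => ?_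
    rw [Finset.sum_range_succ, add_comm j]

theorem splineSum_eq_of_le {x : ℕ → ℝ} (hx : Monotone x) {p q m : ℕ} (hpq : p ≤ q) (c : ℕ → ℝ)
    {s : ℝ} (hs : s < x p) : splineSum x q m c s = splineSum x p m c s := by
  refine (Finset.sum_subset (Finset.range_mono hpq) fun i _ hi => ?_).symm
  rw [bspline_eq_zero hx (Or.inl (hs.trans_le (hx (by simpa using hi)))), mul_zero]

/-- On one period, a combination of periodic B-splines is an ordinary spline with periodic
coefficients. -/
theorem sum_circleSpline {n N : ℕ} (hN : 1 ≤ N) {c : ℕ → ℝ} (hc : ∀ j, c (j + N) = c j) {θ : ℝ}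
    (hθ : θ ∈ Ico 0 (2 * Real.pi)) :
    ∑ j ∈ Finset.range N, c j * circleSpline n N j θ
      = splineSum (circleKnot n N) (n + N + 1) n c θ := by
  have hx := (strictMono_circleKnot n hN).monotone
  have h2π := circleKnot_add_period n hN n
  rw [circleKnot_self, zero_add] at h2π
  have hcr : ∀ r j, c (j + r * N) = c j := by
    intro r
    induction r with
    | zero => simp
    | succ r ih => intro j; rw [Nat.succ_mul, ← add_assoc, hc, ih]
  have hle : n + N ≤ (n + 2) * N := by nlinarith
  have hlt : θ < circleKnot n N (n + N) := by rw [h2π]; exact hθ.2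
  rw [splineSum_eq_of_le hx (by omega) c hlt, ← splineSum_eq_of_le hx hle c hlt, splineSum,
    sum_range_mul_eq]
  refine Finset.sum_congr rfl fun j hj => ?_
  rw [circleSpline_eq_sum hN (Finset.mem_range.1 hj) hθ, Finset.mul_sum]
  exact Finset.sum_congr rfl fun r _ => by rw [hcr]

theorem splineSum_circleKnot_two_pi {n N m : ℕ} (hN : 1 ≤ N) (hm : m ≤ n) {c : ℕ → ℝ}
    (hc : ∀ j, c (j + N) = c j) :
    splineSum (circleKnot n N) (n + N + 1) m c (2 * Real.pi)
      = splineSum (circleKnot n N) (n + N + 1) m c 0 := by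
  have hmono := strictMono_circleKnot n hN
  have hx := hmono.monotone
  have h2π := circleKnot_add_period n hN n
  rw [circleKnot_self, zero_add] at h2π
  have h0 : splineSum (circleKnot n N) (n + N + 1) m c 0 = splineSum (circleKnot n N) (n + 1) m c 0 :=
    splineSum_eq_of_le hx (by omega) c (by
      rw [← circleKnot_self n N]; exact hmono (by omega))
  rw [h0, splineSum, show n + N + 1 = N + (n + 1) by ring, Finset.sum_range_add,
    Finset.sum_eq_zero, zero_add]
  · refine Finset.sum_congr rfl fun i _ => ?_
    have := bspline_circleKnot_add_period n hN m i 1 (2 * Real.pi)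
    rw [one_mul, Nat.cast_one, mul_one, sub_self] at this
    rw [add_comm N i, hc, this]
  · intro i hi
    rw [Finset.mem_range] at hi
    rw [bspline_eq_zero hx (Or.inr _), mul_zero]
    rw [← h2π]; exact hx (by omega)

/-- The coefficients of the derivative of a spline with periodic coefficients: a backward difference
quotient, where the index `j + (N - 1)` stands for `j - 1`. -/
noncomputable def circleDeriv (N : ℕ) (c : ℕ → ℝ) (j : ℕ) : ℝ :=
  (c j - c (j + (N - 1))) / (2 * Real.pi / N)

theorem circleDeriv_periodic {N : ℕ} {c : ℕ → ℝ} (hc : ∀ j, c (j + N) = c j) (i j : ℕ) :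
    (circleDeriv N)^[i] c (j + N) = (circleDeriv N)^[i] c j := by
  induction i generalizing c with
  | zero => exact hc j
  | succ i ih =>
    rw [Function.iterate_succ_apply]
    refine ih fun j => ?_
    rw [circleDeriv, circleDeriv, hc, add_right_comm, hc]

theorem splineSum_circleDeriv {n N m : ℕ} (hN : 1 ≤ N) (hm : m + 1 ≤ n) {c : ℕ → ℝ}
    (hc : ∀ j, c (j + N) = c j) {s : ℝ} (hs : 0 ≤ s) (q : ℕ) :
    splineSum (circleKnot n N) q m (splineDeriv (circleKnot n N) m c) s
      = splineSum (circleKnot n N) q m (circleDeriv N c) s := by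
  have hx := (strictMono_circleKnot n hN).monotone
  refine Finset.sum_congr rfl fun i _ => ?_
  cases i with
  | zero =>
    rw [bspline_eq_zero hx (Or.inr _), mul_zero, mul_zero]
    refine le_trans ?_ hs
    rw [← circleKnot_self n N]; exact hx (by omega)
  | succ i =>
    congr 1
    have hN' : (N : ℝ) ≠ 0 := by positivity
    rw [splineDeriv, circleDeriv, add_assoc (i + 1) m 1, circleKnot_add, add_sub_cancel_left,
      Nat.add_sub_cancel, show i + 1 + (N - 1) = i + N by omega, hc]
    have := Real.pi_ne_zero
    push_cast
    field_simp

/-- Periodic splines generate chains of periodic splines. -/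
theorem primChain_circleSpline {n N : ℕ} (hN : 1 ≤ N) {l : ℕ} (hl : l ≤ n) {c : ℕ → ℝ}
    (hc : ∀ j, c (j + N) = c j) :
    PrimChain (2 * Real.pi) l
      fun i => splineSum (circleKnot n N) (n + N + 1) (n - i) ((circleDeriv N)^[i] c) := by
  have hmono := strictMono_circleKnot n hN
  have hx := hmono.monotone
  have h2π := circleKnot_add_period n hN n
  rw [circleKnot_self, zero_add] at h2π
  refine ⟨intervalIntegrable_splineSum hx _ _ _ _ _, fun i hi t ht => ?_⟩
  obtain ⟨m, hm⟩ : ∃ m, n - i = m + 1 := ⟨n - i - 1, by omega⟩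
  have hm' : n - (i + 1) = m := by omega
  have ht' : t ∈ Ico (0 : ℝ) (circleKnot n N (n + N + 1)) :=
    ⟨ht.1, ht.2.trans_lt (by rw [← h2π]; exact hmono (by omega))⟩
  simp only [hm, hm']
  rw [splineSum_eq_integral hx (fun i => Or.inl (hmono (by omega))) _ _ le_rfl ht']
  · congr 1
    refine intervalIntegral.integral_congr fun s hs => ?_
    rw [uIcc_of_le ht.1] at hs
    rw [splineSum_circleDeriv hN (by omega) (circleDeriv_periodic hc i) hs.1,
      ← Function.iterate_succ_apply' (circleDeriv N)]
  · rw [← circleKnot_self n N]; exact hx (by omega)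

/-- The derivative of order `i` of the function `θ ↦ cos (ν θ + φ)`. -/
noncomputable def trig (ν : ℕ) (φ : ℝ) (i : ℕ) (θ : ℝ) : ℝ :=
  (ν : ℝ) ^ i * Real.cos (ν * θ + φ + i * (Real.pi / 2))

theorem trig_periodic (ν : ℕ) (φ : ℝ) (i : ℕ) (θ : ℝ) :
    trig ν φ i (θ + 2 * Real.pi) = trig ν φ i θ := by
  unfold trig
  rw [show (ν : ℝ) * (θ + 2 * Real.pi) + φ + i * (Real.pi / 2)
    = ν * θ + φ + i * (Real.pi / 2) + ν * (2 * Real.pi) by ring, Real.cos_add_nat_mul_two_pi]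

theorem hasDerivAt_trig (ν : ℕ) (φ : ℝ) (i : ℕ) (θ : ℝ) :
    HasDerivAt (trig ν φ i) (trig ν φ (i + 1) θ) θ := by
  unfold trig
  have h1 : HasDerivAt (fun θ : ℝ => ν * θ + φ + i * (Real.pi / 2)) ν θ := by
    simpa using (((hasDerivAt_id θ).const_mul (ν : ℝ)).add_const φ).add_const (i * (Real.pi / 2))
  refine (h1.cos.const_mul ((ν : ℝ) ^ i)).congr_deriv ?_
  push_cast
  rw [show (ν : ℝ) * θ + φ + (i + 1) * (Real.pi / 2)
    = ν * θ + φ + i * (Real.pi / 2) + Real.pi / 2 by ring, Real.cos_add_pi_div_two]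
  ring

theorem contDiff_trig (ν : ℕ) (φ : ℝ) (i : ℕ) : ContDiff ℝ ∞ (trig ν φ i) := by
  unfold trig; fun_prop

theorem primChain_trig (ν : ℕ) (φ : ℝ) (T : ℝ) (l : ℕ) : PrimChain T l (trig ν φ) := by
  refine ⟨(contDiff_trig ν φ l).continuous.intervalIntegrable _ _, fun i _ t _ => ?_⟩
  rw [intervalIntegral.integral_eq_sub_of_hasDerivAt (fun s _ => hasDerivAt_trig ν φ i s)
    ((contDiff_trig ν φ (i + 1)).continuous.intervalIntegrable _ _)]
  ring

theorem circleDeriv_cos {n N : ℕ} (hN : 1 ≤ N) (ν : ℕ) (φ : ℝ) (i j : ℕ) :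
    (circleDeriv N)^[i] (fun j => Real.cos (ν * circleKnot n N j + φ)) j
      = (ν * Real.sinc (ν * (2 * Real.pi / N) / 2)) ^ i * Real.cos (ν * circleKnot n N j + φ
        - i * (ν * (2 * Real.pi / N) / 2) + i * (Real.pi / 2)) := by
  have hN' : (N : ℝ) ≠ 0 := by positivity
  set h : ℝ := 2 * Real.pi / N with hh
  have hh0 : h ≠ 0 := by have := Real.pi_pos; positivity
  induction i generalizing j with
  | zero => simp
  | succ i ih =>
    rw [Function.iterate_succ_apply', circleDeriv, ih, ih, ← hh]
    have hk : circleKnot n N (j + (N - 1)) = circleKnot n N j - h + 2 * Real.pi := by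
      have := circleKnot_add n (N := N) (j + (N - 1)) 1
      rw [show j + (N - 1) + 1 = j + N by omega, circleKnot_add_period n hN, ← hh] at this
      push_cast at this; linarith
    set y : ℝ := ν * circleKnot n N j + φ - i * (ν * h / 2) + i * (Real.pi / 2) with hy
    have e1 : (ν : ℝ) * circleKnot n N (j + (N - 1)) + φ - i * (ν * h / 2) + i * (Real.pi / 2)
        = y - ν * h + ν * (2 * Real.pi) := by rw [hk, hy]; ring
    have e2 : (ν : ℝ) * circleKnot n N j + φ - (i + 1 : ℕ) * (ν * h / 2)
        + (i + 1 : ℕ) * (Real.pi / 2) = y - ν * h / 2 + Real.pi / 2 := by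
      rw [hy]; push_cast; ring
    rw [e1, e2, Real.cos_add_nat_mul_two_pi, Real.cos_add_pi_div_two, ← mul_sub, Real.cos_sub_cos,
      show (y + (y - ν * h)) / 2 = y - ν * h / 2 by ring,
      show (y - (y - ν * h)) / 2 = ν * h / 2 by ring]
    have e3 : (ν : ℝ) * Real.sinc (ν * h / 2) * h = 2 * Real.sin (ν * h / 2) := by
      rcases eq_or_ne ν 0 with h0 | h0
      · simp [h0]
      · have : (ν : ℝ) * h / 2 ≠ 0 := by positivity
        rw [Real.sinc_of_ne_zero this]
        have : (ν : ℝ) ≠ 0 := by positivity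
        field_simp
    rw [pow_succ, div_eq_iff hh0]
    linear_combination (ν * Real.sinc (ν * h / 2)) ^ i * Real.sin (y - ν * h / 2) * e3

/-- Trigonometric functions are approximated by the periodic splines whose coefficients are their
values at the knots, together with all derivatives of order at most `n`. -/
theorem exists_circleSpline_approx {n : ℕ} (ν : ℕ) (φ : ℝ) {i : ℕ} (hi : i ≤ n) {ε : ℝ}
    (hε : 0 < ε) : ∀ᶠ N : ℕ in atTop, ∀ θ ∈ Icc 0 (2 * Real.pi),
      |splineSum (circleKnot n N) (n + N + 1) (n - i)
        ((circleDeriv N)^[i] fun j => Real.cos (ν * circleKnot n N j + φ)) θ - trig ν φ i θ| ≤ ε := by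
  have hh : Tendsto (fun N : ℕ => 2 * Real.pi / (N : ℝ)) atTop (𝓝 0) :=
    tendsto_natCast_atTop_atTop.const_div_atTop _
  have hlim : Tendsto (fun h : ℝ => |(ν * Real.sinc (ν * h / 2)) ^ i - (ν : ℝ) ^ i|
      + (ν : ℝ) ^ i * (ν * ((n + 1) * h) + i * (ν * h / 2))) (𝓝 0) (𝓝 0) := by
    have hc : Continuous fun h : ℝ => |(ν * Real.sinc (ν * h / 2)) ^ i - (ν : ℝ) ^ i|
      + (ν : ℝ) ^ i * (ν * ((n + 1) * h) + i * (ν * h / 2)) := by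
      have := Real.continuous_sinc
      fun_prop
    have := hc.tendsto 0
    simpa using this
  filter_upwards [eventually_ge_atTop 1, (hlim.comp hh).eventually_le_const hε] with N hN hNε θ hθ
  simp only [Function.comp_apply] at hNε
  have hmono := strictMono_circleKnot n hN
  have hx := hmono.monotone
  have h2π := circleKnot_add_period n hN n
  rw [circleKnot_self, zero_add] at h2π
  have hh0 : (0 : ℝ) ≤ 2 * Real.pi / N := by have := Real.pi_pos; positivity
  refine (abs_splineSum_sub_le hx (δ := _) ?_ ?_ fun j hj h1 h2 => ?_).trans hNε
  · refine le_trans ?_ hθ.1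
    rw [← circleKnot_self n N]; exact hx (by omega)
  · refine hθ.2.trans_lt ?_
    rw [← h2π]; exact hmono (by omega)
  · rw [circleDeriv_cos hN, trig]
    set h : ℝ := 2 * Real.pi / N
    set a := (ν : ℝ) * circleKnot n N j + φ - i * (ν * h / 2) + i * (Real.pi / 2)
    set b := (ν : ℝ) * θ + φ + i * (Real.pi / 2)
    have e : (ν * Real.sinc (ν * h / 2)) ^ i * Real.cos a - (ν : ℝ) ^ i * Real.cos b
        = ((ν * Real.sinc (ν * h / 2)) ^ i - (ν : ℝ) ^ i) * Real.cos a
          + (ν : ℝ) ^ i * (Real.cos a - Real.cos b) := by ring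
    rw [e]
    refine (abs_add_le _ _).trans (add_le_add ?_ ?_)
    · rw [abs_mul]
      exact mul_le_of_le_one_right (abs_nonneg _) (Real.abs_cos_le_one _)
    · rw [abs_mul, abs_pow, Nat.abs_cast]
      refine mul_le_mul_of_nonneg_left ((Real.abs_cos_sub_cos_le _ _).trans ?_) (by positivity)
      have e2 : a - b = -(ν * (θ - circleKnot n N j) + i * (ν * h / 2)) := by simp only [a, b]; ring
      have h3 : θ - circleKnot n N j ≤ (n + 1) * h := by
        rw [add_assoc, circleKnot_add] at h2
        have : ((n - i + 1 : ℕ) : ℝ) ≤ n + 1 := by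
          have : n - i + 1 ≤ n + 1 := by omega
          exact_mod_cast this
        have := mul_le_mul_of_nonneg_right this hh0
        linarith
      have h4 : 0 ≤ θ - circleKnot n N j := by linarith
      rw [e2, abs_neg, abs_of_nonneg (by positivity)]
      gcongr


/-! ### Completeness of the trigonometric system on the cylinder -/

/-- Lebesgue measure on the unit interval. -/
noncomputable abbrev timeMeasure : Measure ℝ := volume.restrict (Ioc 0 1)

/-- Lebesgue measure on one period. -/
noncomputable abbrev circleMeasure : Measure ℝ := volume.restrict (Ioc 0 (2 * Real.pi))

theorem cylMeasure_eq_prod : cylMeasure = timeMeasure.prod circleMeasure := by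
  rw [cylMeasure, Measure.volume_eq_prod, ← Measure.prod_restrict, timeMeasure, circleMeasure,
    Measure.restrict_congr_set (Ioc_ae_eq_Icc (a := (0 : ℝ)) (b := 1))]

theorem ae_eq_zero_of_integral_trig_eq_zero {f : ℝ → ℝ} (hf : MemLp f 2 circleMeasure)
    (h : ∀ (ν : ℕ) (φ : ℝ), ∫ θ, f θ * trig ν φ 0 θ ∂circleMeasure = 0) :
    f =ᵐ[circleMeasure] 0 := by
  have hpi : (0 : ℝ) < 2 * Real.pi := by have := Real.pi_pos; positivity
  have hfc : MemLp (fun θ => (f θ : ℂ)) 2 circleMeasure := hf.ofReal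
  have hfi : Integrable f circleMeasure := hf.integrable (by norm_num)
  have hzero : ∀ n : ℤ, fourierCoeffOn hpi (fun θ => (f θ : ℂ)) n = 0 := by
    intro n
    rw [fourierCoeffOn_eq_integral, intervalIntegral.integral_of_le hpi.le]
    -- `n θ` is expressed through `|n|`, the sign being absorbed into the phase
    obtain ⟨σ, hσ1, hσ⟩ : ∃ σ : ℝ, (σ = 1 ∨ σ = -1) ∧ (n : ℝ) = σ * n.natAbs := by
      rcases le_total 0 n with hn | hn
      · exact ⟨1, Or.inl rfl, by rw [one_mul, Nat.cast_natAbs, abs_of_nonneg hn]⟩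
      · exact ⟨-1, Or.inr rfl, by rw [Nat.cast_natAbs, abs_of_nonpos hn]; push_cast; ring⟩
    have e1 : ∀ θ : ℝ, (fourier (-n) (θ : AddCircle (2 * Real.pi - 0)) : ℂ) • (f θ : ℂ)
        = ((f θ * trig n.natAbs 0 0 θ : ℝ) : ℂ)
          - σ * Complex.I * ((f θ * trig n.natAbs (-(Real.pi / 2)) 0 θ : ℝ) : ℂ) := by
      intro θ
      have e2 : 2 * (Real.pi : ℂ) * Complex.I * ((-n : ℤ) : ℂ) * (θ : ℂ) / ((2 * Real.pi - 0 : ℝ) : ℂ)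
          = ((-(n : ℝ) * θ : ℝ) : ℂ) * Complex.I := by
        have : (Real.pi : ℂ) ≠ 0 := by exact_mod_cast Real.pi_ne_zero
        push_cast; field_simp; ring
      have e3 : Real.sin (n * θ) = σ * Real.sin (n.natAbs * θ) := by
        rcases hσ1 with h | h <;> rw [hσ, h] <;> simp
      have e4 : Real.cos (n * θ) = Real.cos (n.natAbs * θ) := by
        rcases hσ1 with h | h <;> rw [hσ, h] <;> simp
      rw [fourier_coe_apply, e2, Complex.exp_mul_I, ← Complex.ofReal_cos, ← Complex.ofReal_sin,
        neg_mul, Real.cos_neg, Real.sin_neg, e3, e4]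
      simp only [trig, pow_zero, one_mul, Nat.cast_zero, zero_mul, add_zero, ← sub_eq_add_neg,
        Real.cos_sub_pi_div_two, smul_eq_mul]
      push_cast; ring
    have hint : ∀ φ, Integrable (fun θ => f θ * trig n.natAbs φ 0 θ) circleMeasure := fun φ => by
      refine Integrable.mul_bdd (c := 1) hfi
        (contDiff_trig _ _ _).continuous.aestronglyMeasurable (ae_of_all _ fun θ => ?_)
      simpa [trig] using Real.abs_cos_le_one _
    simp only [e1]
    rw [integral_sub (hint _).ofReal ((hint _).ofReal.const_mul _), integral_const_mul,
      integral_complex_ofReal, integral_complex_ofReal, h, h]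
    simp
  have hp := hasSum_sq_fourierCoeffOn hpi hfc
  simp only [hzero, norm_zero] at hp
  have h0 : ∫ θ in (0 : ℝ)..(2 * Real.pi), ‖(f θ : ℂ)‖ ^ 2 = 0 := by
    have := hp.unique (by simp : HasSum (fun _ : ℤ => (0 : ℝ) ^ 2) 0)
    simpa [Real.pi_ne_zero] using this
  rw [intervalIntegral.integral_of_le hpi.le, integral_eq_zero_iff_of_nonneg
    (fun _ => by positivity) hfc.integrable_norm_pow'] at h0
  filter_upwards [h0] with θ hθ
  simpa using hθ

/-- Marginals of square integrable functions are square integrable. -/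
theorem memLp_integral_mul {X : ℝ × ℝ → ℝ} (hX : MemLp X 2 cylMeasure) {b : ℝ → ℝ}
    (hb : Continuous b) {M : ℝ} (hM : ∀ θ, |b θ| ≤ M) :
    MemLp (fun t => ∫ θ, X (t, θ) * b θ ∂circleMeasure) 2 timeMeasure := by
  rw [cylMeasure_eq_prod] at hX
  set Y : ℝ × ℝ → ℝ := fun p => X p * b p.2 with hY
  have hYm : AEStronglyMeasurable Y (timeMeasure.prod circleMeasure) :=
    hX.1.mul (hb.comp continuous_snd).aestronglyMeasurable
  have hY2 : MemLp Y 2 (timeMeasure.prod circleMeasure) := by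
    refine MemLp.of_le_mul (c := M) hX hYm (ae_of_all _ fun p => ?_)
    rw [hY, norm_mul, mul_comm]
    exact mul_le_mul_of_nonneg_right (hM _) (norm_nonneg _)
  have hsq : Integrable (fun p => Y p ^ 2) (timeMeasure.prod circleMeasure) := hY2.integrable_sq
  have hm : AEStronglyMeasurable (fun t => ∫ θ, Y (t, θ) ∂circleMeasure) timeMeasure :=
    hYm.integral_prod_right'
  rw [memLp_two_iff_integrable_sq hm]
  refine (hsq.integral_prod_left.const_mul (2 * Real.pi)).mono' (hm.pow 2) ?_
  have hpi : (0 : ℝ) < 2 * Real.pi := by have := Real.pi_pos; positivity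
  filter_upwards [hsq.prod_right_ae, (hY2.integrable (by norm_num)).prod_right_ae] with t h1 h2
  rw [Real.norm_eq_abs, abs_of_nonneg (sq_nonneg _)]
  -- Cauchy–Schwarz against the constant function, by expanding a square
  set m := ∫ θ, Y (t, θ) ∂circleMeasure with hm'
  have h3 : 0 ≤ ∫ θ, (Y (t, θ) - m / (2 * Real.pi)) ^ 2 ∂circleMeasure :=
    integral_nonneg fun θ => sq_nonneg _
  have e : ∀ θ, (Y (t, θ) - m / (2 * Real.pi)) ^ 2
      = Y (t, θ) ^ 2 - 2 * (m / (2 * Real.pi)) * Y (t, θ) + (m / (2 * Real.pi)) ^ 2 := by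
    intro θ; ring
  simp only [e] at h3
  have h12 : Integrable (fun θ => Y (t, θ) ^ 2 - 2 * (m / (2 * Real.pi)) * Y (t, θ))
      circleMeasure := h1.sub (h2.const_mul _)
  rw [integral_add h12 (integrable_const _),
    integral_sub h1 (h2.const_mul _), integral_const_mul, ← hm'] at h3
  simp only [integral_const, smul_eq_mul, Measure.real, Measure.restrict_apply_univ,
    Real.volume_Ioc, sub_zero, ENNReal.toReal_ofReal hpi.le] at h3
  have h4 : ∫ θ, Y (t, θ) ^ 2 ∂circleMeasure - m ^ 2 / (2 * Real.pi) ≥ 0 := by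
    convert h3 using 1
    field_simp; ring
  have h5 : m ^ 2 / (2 * Real.pi) ≤ ∫ θ, Y (t, θ) ^ 2 ∂circleMeasure := by linarith
  rw [div_le_iff₀ hpi] at h5
  linarith

theorem ae_eq_zero_of_forall_trig {X : ℝ × ℝ → ℝ} (hX : MemLp X 2 cylMeasure)
    (h : ∀ (ν : ℕ) (φ : ℝ),
      (fun t => ∫ θ, X (t, θ) * trig ν φ 0 θ ∂circleMeasure) =ᵐ[timeMeasure] 0) :
    X =ᵐ[cylMeasure] 0 := by
  rw [cylMeasure_eq_prod] at hX ⊢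
  -- two phases for each frequency suffice, so that only countably many conditions are used
  have h1 : ∀ᵐ t ∂timeMeasure, ∀ ν : ℕ, ∫ θ, X (t, θ) * trig ν 0 0 θ ∂circleMeasure = 0 :=
    ae_all_iff.2 fun ν => h ν 0
  have h2 : ∀ᵐ t ∂timeMeasure, ∀ ν : ℕ,
      ∫ θ, X (t, θ) * trig ν (-(Real.pi / 2)) 0 θ ∂circleMeasure = 0 :=
    ae_all_iff.2 fun ν => h ν _
  have hsec : ∀ᵐ t ∂timeMeasure, ∀ᵐ θ ∂circleMeasure, X (t, θ) = 0 := by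
    filter_upwards [h1, h2, hX.integrable_sq.prod_right_ae, hX.1.prodMk_left] with t a b c e
    have hL : MemLp (fun θ => X (t, θ)) 2 circleMeasure := (memLp_two_iff_integrable_sq e).2 c
    have hi := hL.integrable (by norm_num : (1 : ENNReal) ≤ 2)
    refine ae_eq_zero_of_integral_trig_eq_zero hL fun ν φ => ?_
    have hint : ∀ φ, Integrable (fun θ => X (t, θ) * trig ν φ 0 θ) circleMeasure := fun φ => by
      refine Integrable.mul_bdd (c := 1) hi
        (contDiff_trig _ _ _).continuous.aestronglyMeasurable (ae_of_all _ fun θ => ?_)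
      simpa [trig] using Real.abs_cos_le_one _
    have e1 : ∀ θ, X (t, θ) * trig ν φ 0 θ = Real.cos φ * (X (t, θ) * trig ν 0 0 θ)
        - Real.sin φ * (X (t, θ) * trig ν (-(Real.pi / 2)) 0 θ) := by
      intro θ
      simp only [trig, pow_zero, one_mul, Nat.cast_zero, zero_mul, add_zero, ← sub_eq_add_neg,
        Real.cos_sub_pi_div_two, Real.cos_add]
      ring
    simp only [e1]
    rw [integral_sub ((hint _).const_mul _) ((hint _).const_mul _), integral_const_mul,
      integral_const_mul, a, b]
    simp
  have hm := hX.1.stronglyMeasurable_mk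
  have h5 : ∀ᵐ p ∂(timeMeasure.prod circleMeasure), hX.1.mk X p = 0 := by
    rw [Measure.ae_prod_iff_ae_ae (measurableSet_eq_fun hm.measurable measurable_const)]
    filter_upwards [hsec, Measure.ae_ae_of_ae_prod hX.1.ae_eq_mk] with t a b
    filter_upwards [a, b] with θ c e
    rw [← e, c]
  filter_upwards [h5, hX.1.ae_eq_mk] with p a b
  rw [b, a]; rfl


/-! ### Weak derivatives of tensor products -/

theorem iterate_fderiv_time {ψ : ℝ × ℝ → ℝ} (hψ : ContDiff ℝ ∞ ψ) (i : ℕ) (t θ : ℝ) :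
    (fun ψ : ℝ × ℝ → ℝ => fun p => fderiv ℝ ψ p (1, 0))^[i] ψ (t, θ)
      = iteratedDeriv i (fun s => ψ (s, θ)) t := by
  induction i generalizing ψ with
  | zero => simp
  | succ i ih =>
    rw [Function.iterate_succ_apply, ih ((hψ.fderiv_right (m := ∞) (by simp)).clm_apply
      contDiff_const), iteratedDeriv_succ']
    congr 1
    ext s
    have h1 : HasDerivAt (fun s : ℝ => (s, θ)) (1, 0) s :=
      (hasDerivAt_id s).prodMk (hasDerivAt_const s θ)
    exact ((hψ.differentiable (by simp) (s, θ)).hasFDerivAt.comp_hasDerivAt s h1).deriv.symm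

theorem iterate_fderiv_circle {ψ : ℝ × ℝ → ℝ} (hψ : ContDiff ℝ ∞ ψ) (i : ℕ) (t θ : ℝ) :
    (fun ψ : ℝ × ℝ → ℝ => fun p => fderiv ℝ ψ p (0, 1))^[i] ψ (t, θ)
      = iteratedDeriv i (fun η => ψ (t, η)) θ := by
  induction i generalizing ψ with
  | zero => simp
  | succ i ih =>
    rw [Function.iterate_succ_apply, ih ((hψ.fderiv_right (m := ∞) (by simp)).clm_apply
      contDiff_const), iteratedDeriv_succ']
    congr 1
    ext s
    have h1 : HasDerivAt (fun s : ℝ => (t, s)) (0, 1) s :=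
      (hasDerivAt_const s t).prodMk (hasDerivAt_id s)
    exact ((hψ.differentiable (by simp) (t, s)).hasFDerivAt.comp_hasDerivAt s h1).deriv.symm

theorem smoothPartial_eq_iteratedDeriv {φ : ℝ × ℝ → ℝ} (hφ : ContDiff ℝ ∞ φ) (i j : ℕ) (t θ : ℝ) :
    smoothPartial i j φ (t, θ) = iteratedDeriv i (fun s => smoothPartial 0 j φ (s, θ)) t :=
  iterate_fderiv_time (contDiff_smoothPartial 0 j hφ) i t θ

theorem smoothPartial_zero_eq_iteratedDeriv {φ : ℝ × ℝ → ℝ} (hφ : ContDiff ℝ ∞ φ) (j : ℕ) (t θ : ℝ) :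
    smoothPartial 0 j φ (t, θ) = iteratedDeriv j (fun η => φ (t, η)) θ :=
  iterate_fderiv_circle hφ j t θ

theorem iteratedDeriv_trig (ν : ℕ) (φ : ℝ) (m j : ℕ) :
    iteratedDeriv j (trig ν φ m) = trig ν φ (m + j) := by
  induction j with
  | zero => simp
  | succ j ih =>
    rw [iteratedDeriv_succ, ih]
    ext θ
    exact (hasDerivAt_trig ν φ (m + j) θ).deriv

theorem isCylTest_mul_trig {a : ℝ → ℝ} (ha : IsIntervalTest a) (ν : ℕ) (φ : ℝ) (m : ℕ) :
    IsCylTest fun p => a p.1 * trig ν φ m p.2 := by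
  refine ⟨(ha.smooth.comp contDiff_fst).mul ((contDiff_trig ν φ m).comp contDiff_snd), ?_, ?_⟩
  · intro t θ; simp only [trig_periodic]
  · obtain ⟨α, β, h0, h1, h⟩ := ha.support
    exact ⟨α, β, h0, h1, fun t θ ht => by simp only [h t ht, zero_mul]⟩

theorem smoothPartial_mul_trig {a : ℝ → ℝ} (ha : IsIntervalTest a) (ν : ℕ) (φ : ℝ) (m i j : ℕ)
    (p : ℝ × ℝ) : smoothPartial i j (fun p => a p.1 * trig ν φ m p.2) p
      = iteratedDeriv i a p.1 * trig ν φ (m + j) p.2 := by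
  have hs := (isCylTest_mul_trig ha ν φ m).smooth
  obtain ⟨t, θ⟩ := p
  rw [smoothPartial_eq_iteratedDeriv hs]
  have : ∀ s, smoothPartial 0 j (fun p : ℝ × ℝ => a p.1 * trig ν φ m p.2) (s, θ)
      = a s * trig ν φ (m + j) θ := by
    intro s
    rw [smoothPartial_zero_eq_iteratedDeriv hs]
    simp only
    rw [iteratedDeriv_const_mul_field, iteratedDeriv_trig]
  simp only [this]
  simp only [mul_comm _ (trig ν φ (m + j) θ)]
  rw [iteratedDeriv_const_mul_field]

theorem memLp_tensor {a b : ℝ → ℝ} (ha : MemLp a 2 timeMeasure) (hb : MemLp b 2 circleMeasure) :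
    MemLp (fun p : ℝ × ℝ => a p.1 * b p.2) 2 cylMeasure := by
  rw [cylMeasure_eq_prod]
  refine (memLp_two_iff_integrable_sq (f := fun p : ℝ × ℝ => a p.1 * b p.2)
    (ha.1.comp_fst.mul hb.1.comp_snd)).2 ?_
  simp only [mul_pow]
  exact ha.integrable_sq.mul_prod hb.integrable_sq

theorem integral_tensor_mul {a b : ℝ → ℝ} (ha : MemLp a 2 timeMeasure)
    (hb : MemLp b 2 circleMeasure) {X : ℝ × ℝ → ℝ} (hX : MemLp X 2 cylMeasure) :
    ∫ p, a p.1 * b p.2 * X p ∂cylMeasure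
      = ∫ t, a t * ∫ θ, X (t, θ) * b θ ∂circleMeasure ∂timeMeasure := by
  have hint : Integrable (fun p => a p.1 * b p.2 * X p) cylMeasure :=
    (memLp_tensor ha hb).integrable_mul hX
  rw [cylMeasure_eq_prod] at hint ⊢
  rw [integral_prod _ hint]
  refine integral_congr_ae (ae_of_all _ fun t => ?_)
  simp only [← integral_const_mul]
  refine integral_congr_ae (ae_of_all _ fun θ => ?_)
  ring

theorem memLp_trig (ν : ℕ) (φ : ℝ) (i : ℕ) : MemLp (trig ν φ i) 2 circleMeasure := by
  refine MemLp.of_bound (contDiff_trig ν φ i).continuous.aestronglyMeasurable ((ν : ℝ) ^ i)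
    (ae_of_all _ fun θ => ?_)
  rw [trig, norm_mul, norm_pow, Real.norm_natCast]
  exact mul_le_of_le_one_right (by positivity) (Real.abs_cos_le_one _)

theorem abs_trig_le (ν : ℕ) (φ : ℝ) (i : ℕ) (θ : ℝ) : |trig ν φ i θ| ≤ (ν : ℝ) ^ i := by
  rw [trig, abs_mul, abs_pow, Nat.abs_cast]
  exact mul_le_of_le_one_right (by positivity) (Real.abs_cos_le_one _)

theorem MemLp.intervalIntegrable_zero_one {a : ℝ → ℝ} (ha : MemLp a 2 timeMeasure) :
    IntervalIntegrable a volume 0 1 := by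
  rw [intervalIntegrable_iff, uIoc_of_le zero_le_one]
  exact ha.integrable (by norm_num)

theorem IsIntervalTest.memLp {a : ℝ → ℝ} (ha : IsIntervalTest a) (i : ℕ) :
    MemLp (iteratedDeriv i a) 2 timeMeasure := by
  have hc : Continuous (iteratedDeriv i a) :=
    ha.smooth.continuous_iteratedDeriv i (by exact_mod_cast le_top)
  obtain ⟨M, hM⟩ := isCompact_Icc.exists_bound_of_continuousOn (s := Icc (0 : ℝ) 1) hc.continuousOn
  refine MemLp.of_bound hc.aestronglyMeasurable M ?_
  filter_upwards [ae_restrict_mem measurableSet_Ioc] with t ht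
  exact hM t (Ioc_subset_Icc_self ht)

/-- Products of a test function in `t` and a trigonometric function in `θ` separate points. -/
theorem ae_eq_zero_of_forall_test {X : ℝ × ℝ → ℝ} (hX : MemLp X 2 cylMeasure)
    (h : ∀ a, IsIntervalTest a → ∀ (ν : ℕ) (φ : ℝ),
      ∫ p, a p.1 * trig ν φ 0 p.2 * X p ∂cylMeasure = 0) :
    X =ᵐ[cylMeasure] 0 := by
  refine ae_eq_zero_of_forall_trig hX fun ν φ => ?_
  have hm := memLp_integral_mul hX (contDiff_trig ν φ 0).continuous (abs_trig_le ν φ 0)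
  refine ae_eq_of_integral_test_mul_eq (MemLp.intervalIntegrable_zero_one hm) (by simp [Pi.zero_def])
    fun a ha => ?_
  have := h a ha ν φ
  rw [integral_tensor_mul (by simpa using ha.memLp 0) (memLp_trig ν φ 0) hX] at this
  rw [intervalIntegral.integral_of_le zero_le_one, this]
  simp

section
variable {d : ℕ}

theorem memLp_apply (f : CylL2 d) (r : Fin d) : MemLp (fun p => f p r) 2 cylMeasure :=
  (EuclideanSpace.proj (𝕜 := ℝ) r : EuclideanSpace ℝ (Fin d) →L[ℝ] ℝ).comp_memLp' (Lp.memLp f)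

theorem integral_smul_apply {ψ : ℝ × ℝ → ℝ} (hψ : Continuous ψ) (f : CylL2 d) (r : Fin d) :
    (∫ p, ψ p • f p ∂cylMeasure) r = ∫ p, ψ p * f p r ∂cylMeasure := by
  have := (EuclideanSpace.proj (𝕜 := ℝ) r : EuclideanSpace ℝ (Fin d) →L[ℝ] ℝ).integral_comp_comm
    (integrable_continuous_smul hψ f)
  simpa using this.symm

theorem HasCylWeakDeriv.integral_apply {i j : ℕ} {f g : CylL2 d} (h : HasCylWeakDeriv i j f g)
    {φ : ℝ × ℝ → ℝ} (hφ : IsCylTest φ) (r : Fin d) :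
    ∫ p, smoothPartial i j φ p * f p r ∂cylMeasure
      = (-1) ^ (i + j) * ∫ p, φ p * g p r ∂cylMeasure := by
  rw [← integral_smul_apply (contDiff_smoothPartial i j hφ.smooth).continuous,
    ← integral_smul_apply hφ.smooth.continuous, h φ hφ]
  rfl

theorem CylL2.ext_apply {f g : CylL2 d}
    (h : ∀ r, (fun p => f p r - g p r) =ᵐ[cylMeasure] 0) : f = g := by
  refine Lp.ext ?_
  filter_upwards [ae_all_iff.2 h] with p hp
  ext r
  exact sub_eq_zero.1 (hp r)

/-- Weak derivatives are unique. -/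
theorem HasCylWeakDeriv.unique {i j : ℕ} {f g g' : CylL2 d} (h : HasCylWeakDeriv i j f g)
    (h' : HasCylWeakDeriv i j f g') : g = g' := by
  refine CylL2.ext_apply fun r => ?_
  refine ae_eq_zero_of_forall_test ((memLp_apply g r).sub (memLp_apply g' r)) fun a ha ν φ => ?_
  have ht := isCylTest_mul_trig ha ν φ 0
  have hmem : MemLp (fun p : ℝ × ℝ => a p.1 * trig ν φ 0 p.2) 2 cylMeasure :=
    memLp_tensor (by simpa using ha.memLp 0) (memLp_trig ν φ 0)
  have e := (h.integral_apply ht r).symm.trans (h'.integral_apply ht r)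
  have e' := mul_left_cancel₀ (pow_ne_zero _ (by norm_num)) e
  simp only [mul_sub]
  have hint : ∀ g : CylL2 d, Integrable (fun p => a p.1 * trig ν φ 0 p.2 * g p r) cylMeasure :=
    fun g => hmem.integrable_mul (memLp_apply g r)
  rw [integral_sub (hint g) (hint g'), sub_eq_zero]
  exact e'

theorem sobolevFun_injective (d k l : ℕ) :
    Function.Injective (sobolevFun : mixedSobolev d k l → CylL2 d) := by
  intro x y hxy
  have h0 : x.1 0 = y.1 0 := hxy
  have hx := x.2
  have hy := y.2
  refine Subtype.ext (PiLp.ext fun q => ?_)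
  fin_cases q
  · exact h0
  · exact hx.1.unique (by rw [h0]; exact hy.1)
  · exact hx.2.1.unique (by rw [h0]; exact hy.2.1)
  · exact hx.2.2.unique (by rw [h0]; exact hy.2.2)

theorem toSobolev_eq {k l : ℕ} {u : ℝ × ℝ → EuclideanSpace ℝ (Fin d)} {x : mixedSobolev d k l}
    (hx : ⇑(sobolevFun x) =ᵐ[cylMeasure] u) : toSobolev k l u = x := by
  have h : ∃ x : mixedSobolev d k l, ⇑(sobolevFun x) =ᵐ[cylMeasure] u := ⟨x, hx⟩
  rw [toSobolev, dif_pos h]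
  exact sobolevFun_injective d k l (Lp.ext (h.choose_spec.trans hx.symm))

theorem weakPartial_eq {i j : ℕ} {f g : CylL2 d} (h : HasCylWeakDeriv i j f g) :
    weakPartial i j f = g := by
  have h' : ∃ g, HasCylWeakDeriv i j f g := ⟨g, h⟩
  rw [weakPartial, dif_pos h']
  exact h'.choose_spec.unique h

theorem continuous_integral_smul {ψ : ℝ × ℝ → ℝ} (hψ : Continuous ψ) :
    Continuous fun f : CylL2 d => ∫ p, ψ p • f p ∂cylMeasure := by
  have hK : IsCompact (Icc (0 : ℝ) 1 ×ˢ Icc (0 : ℝ) (2 * Real.pi)) := isCompact_Icc.prod isCompact_Icc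
  obtain ⟨C, hC⟩ := hK.exists_bound_of_continuousOn hψ.continuousOn
  have hψm : MemLp ψ 2 cylMeasure := by
    refine MemLp.of_bound hψ.aestronglyMeasurable C ?_
    filter_upwards [ae_restrict_mem (measurableSet_Icc.prod measurableSet_Ioc)] with p hp
    exact hC p ⟨hp.1, Ioc_subset_Icc_self hp.2⟩
  have hcoord : ∀ r : Fin d, Continuous fun f : CylL2 d => (∫ p, ψ p • f p ∂cylMeasure) r := by
    intro r
    have hmem : MemLp (fun p => ψ p • (EuclideanSpace.single r (1 : ℝ) : EuclideanSpace ℝ (Fin d))) 2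
        cylMeasure := (ContinuousLinearMap.toSpanSingleton ℝ
          (EuclideanSpace.single r (1 : ℝ) : EuclideanSpace ℝ (Fin d))).comp_memLp' hψm
    have e : (fun f : CylL2 d => (∫ p, ψ p • f p ∂cylMeasure) r)
        = fun f => ⟪hmem.toLp _, f⟫ := by
      ext f
      rw [integral_smul_apply hψ, L2.inner_def]
      refine integral_congr_ae ?_
      filter_upwards [hmem.coeFn_toLp] with p hp
      rw [hp, real_inner_smul_left, EuclideanSpace.inner_single_left]
      simp
    rw [e]
    exact continuous_const.inner continuous_id
  have := (EuclideanSpace.equiv (Fin d) ℝ).symm.continuous.comp (continuous_pi hcoord)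
  exact this

theorem isClosed_hasCylWeakDeriv (i j : ℕ) :
    IsClosed {q : CylL2 d × CylL2 d | HasCylWeakDeriv i j q.1 q.2} := by
  simp only [HasCylWeakDeriv, ofPred_forall]
  refine isClosed_iInter fun φ => isClosed_iInter fun hφ => isClosed_eq ?_ ?_
  · exact (continuous_integral_smul (contDiff_smoothPartial i j hφ.smooth).continuous).comp
      continuous_fst
  · exact ((continuous_integral_smul hφ.smooth.continuous).comp
      (continuous_snd (X := CylL2 d) (Y := CylL2 d))).const_smul ((-1 : ℝ) ^ (i + j))

instance (d k l : ℕ) : CompleteSpace (mixedSobolev d k l) := by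
  have hc : ∀ q : Fin 4, Continuous fun x : PiLp 2 (fun _ : Fin 4 => CylL2 d) => (x q : CylL2 d) := fun q =>
    PiLp.continuous_apply (p := 2) (β := fun _ : Fin 4 => CylL2 d) q
  have h1 := (isClosed_hasCylWeakDeriv (d := d) k 0).preimage ((hc 0).prodMk (hc 1))
  have h2 := (isClosed_hasCylWeakDeriv (d := d) 0 l).preimage ((hc 0).prodMk (hc 2))
  have h3 := (isClosed_hasCylWeakDeriv (d := d) k l).preimage ((hc 0).prodMk (hc 3))
  have : IsClosed (mixedSobolev d k l : Set (PiLp 2 (fun _ : Fin 4 => CylL2 d))) :=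
    h1.inter (h2.inter h3)
  exact this.completeSpace_coe

end


/-! ### Density of tensor products -/

/-- `A` consists of a function on `[0,1]` and its derivatives up to order `k`, the last one being
square integrable. -/
structure TimeProfile (k : ℕ) (A : ℕ → ℝ → ℝ) : Prop where
  chain : PrimChain 1 k A
  memLp_top : MemLp (A k) 2 timeMeasure

/-- `B` consists of a function on `S¹` and its derivatives up to order `l`, the last one being
square integrable. -/
structure CircleProfile (l : ℕ) (B : ℕ → ℝ → ℝ) : Prop where
  chain : PrimChain (2 * Real.pi) l B
  memLp_top : MemLp (B l) 2 circleMeasure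
  closed : ∀ i < l, B i (2 * Real.pi) = B i 0

theorem memLp_of_continuousOn {T : ℝ} {a : ℝ → ℝ} (ha : ContinuousOn a (Icc 0 T)) :
    MemLp a 2 (volume.restrict (Ioc 0 T)) := by
  obtain ⟨M, hM⟩ := isCompact_Icc.exists_bound_of_continuousOn ha
  have : IsFiniteMeasure (volume.restrict (Ioc 0 T)) := ⟨by simp⟩
  refine MemLp.of_bound ?_ M ?_
  · exact (ha.mono Ioc_subset_Icc_self).aestronglyMeasurable measurableSet_Ioc
  · filter_upwards [ae_restrict_mem measurableSet_Ioc] with t ht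
    exact hM t (Ioc_subset_Icc_self ht)

theorem TimeProfile.memLp {k : ℕ} {A : ℕ → ℝ → ℝ} (hA : TimeProfile k A) {i : ℕ} (hi : i ≤ k) :
    MemLp (A i) 2 timeMeasure := by
  rcases hi.eq_or_lt with rfl | h
  · exact hA.memLp_top
  · exact memLp_of_continuousOn (hA.chain.continuousOn zero_le_one h)

theorem CircleProfile.memLp {l : ℕ} {B : ℕ → ℝ → ℝ} (hB : CircleProfile l B) {i : ℕ} (hi : i ≤ l) :
    MemLp (B i) 2 circleMeasure := by
  rcases hi.eq_or_lt with rfl | h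
  · exact hB.memLp_top
  · exact memLp_of_continuousOn (hB.chain.continuousOn (by have := Real.pi_pos; positivity) h)

theorem TimeProfile.mono {k : ℕ} {A : ℕ → ℝ → ℝ} (hA : TimeProfile k A) {i : ℕ} (hi : i ≤ k) :
    TimeProfile i A := ⟨hA.chain.mono zero_le_one hi, hA.memLp hi⟩

theorem CircleProfile.mono {l : ℕ} {B : ℕ → ℝ → ℝ} (hB : CircleProfile l B) {i : ℕ} (hi : i ≤ l) :
    CircleProfile i B :=
  ⟨hB.chain.mono (by have := Real.pi_pos; positivity) hi, hB.memLp hi, fun j hj => hB.closed j (by omega)⟩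

theorem circleProfile_trig (l ν : ℕ) (φ : ℝ) : CircleProfile l (trig ν φ) :=
  ⟨primChain_trig ν φ _ l, memLp_trig ν φ l, fun i _ => by
    rw [← trig_periodic ν φ i 0, zero_add]⟩

theorem integral_smoothPartial_mul_tensor {i j : ℕ} {A B : ℕ → ℝ → ℝ} (hA : TimeProfile i A)
    (hB : CircleProfile j B) {φ : ℝ × ℝ → ℝ} (hφ : IsCylTest φ) :
    ∫ p, smoothPartial i j φ p * (A 0 p.1 * B 0 p.2) ∂cylMeasure
      = (-1) ^ (i + j) * ∫ p, φ p * (A i p.1 * B j p.2) ∂cylMeasure := by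
  have hpi : (0 : ℝ) ≤ 2 * Real.pi := by have := Real.pi_pos; positivity
  have hint : ∀ {ψ : ℝ × ℝ → ℝ} {a b : ℝ → ℝ}, Continuous ψ → MemLp a 2 timeMeasure →
      MemLp b 2 circleMeasure → Integrable (fun p : ℝ × ℝ => ψ p * (a p.1 * b p.2)) cylMeasure := by
    intro ψ a b hψ ha hb
    have hK : IsCompact (Icc (0 : ℝ) 1 ×ˢ Icc (0 : ℝ) (2 * Real.pi)) :=
      isCompact_Icc.prod isCompact_Icc
    obtain ⟨C, hC⟩ := hK.exists_bound_of_continuousOn hψ.continuousOn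
    refine Integrable.bdd_mul (c := C) ((memLp_tensor ha hb).integrable (by norm_num))
      hψ.aestronglyMeasurable ?_
    filter_upwards [ae_restrict_mem (measurableSet_Icc.prod measurableSet_Ioc)] with p hp
    exact hC p ⟨hp.1, Ioc_subset_Icc_self hp.2⟩
  have i1 := hint (contDiff_smoothPartial i j hφ.smooth).continuous (hA.memLp (Nat.zero_le i))
    (hB.memLp (Nat.zero_le j))
  have i2 := hint (contDiff_smoothPartial 0 j hφ.smooth).continuous (hA.memLp le_rfl)
    (hB.memLp (Nat.zero_le j))
  have i3 := hint hφ.smooth.continuous (hA.memLp le_rfl) (hB.memLp le_rfl)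
  -- integration by parts in `t`
  have htime : ∀ θ, ∫ t, smoothPartial i j φ (t, θ) * (A 0 t * B 0 θ) ∂timeMeasure
      = (-1) ^ i * ∫ t, smoothPartial 0 j φ (t, θ) * (A i t * B 0 θ) ∂timeMeasure := by
    intro θ
    have hsm : ContDiff ℝ ∞ fun s => smoothPartial 0 j φ (s, θ) :=
      (contDiff_smoothPartial 0 j hφ.smooth).comp (contDiff_id.prodMk contDiff_const)
    have ht : IsIntervalTest fun s => smoothPartial 0 j φ (s, θ) := by
      refine ⟨hsm, ?_⟩
      obtain ⟨α, β, h0, h1, h⟩ := hφ.support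
      refine ⟨α, β, h0, h1, fun t ht => ?_⟩
      rw [smoothPartial_zero_eq_iteratedDeriv hφ.smooth]
      have : (fun η => φ (t, η)) = fun _ => 0 := funext fun η => h t η ht
      rw [this]; simp
    have key := hA.chain.integral_iteratedDeriv_mul zero_le_one hsm (fun n m _ => by
      rw [iteratedDeriv_eq_zero_of_eventuallyEq ht.eventuallyEq_zero.1,
        iteratedDeriv_eq_zero_of_eventuallyEq ht.eventuallyEq_zero.2, zero_mul, zero_mul]) le_rfl
    rw [intervalIntegral.integral_of_le zero_le_one,
      intervalIntegral.integral_of_le zero_le_one] at key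
    simp only [← mul_assoc, integral_mul_const]
    simp only [smoothPartial_eq_iteratedDeriv hφ.smooth i j]
    rw [key]
  -- integration by parts in `θ`
  have hcirc : ∀ t, ∫ θ, smoothPartial 0 j φ (t, θ) * (A i t * B 0 θ) ∂circleMeasure
      = (-1) ^ j * ∫ θ, φ (t, θ) * (A i t * B j θ) ∂circleMeasure := by
    intro t
    have hsm : ContDiff ℝ ∞ fun η => φ (t, η) :=
      hφ.smooth.comp (contDiff_const.prodMk contDiff_id)
    have hper : ∀ n, iteratedDeriv n (fun η => φ (t, η)) (2 * Real.pi)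
        = iteratedDeriv n (fun η => φ (t, η)) 0 := by
      intro n
      have h1 := congrFun (iteratedDeriv_comp_add_const n (fun η => φ (t, η)) (2 * Real.pi)) 0
      simp only [hφ.periodic, zero_add] at h1
      exact h1.symm
    have key := hB.chain.integral_iteratedDeriv_mul hpi hsm (fun n m hm => by
      rw [hper, hB.closed m hm]) le_rfl
    rw [intervalIntegral.integral_of_le hpi, intervalIntegral.integral_of_le hpi] at key
    simp only [mul_left_comm _ (A i t), integral_const_mul]
    simp only [smoothPartial_zero_eq_iteratedDeriv hφ.smooth j]
    rw [key, mul_left_comm]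
  rw [cylMeasure_eq_prod] at *
  rw [integral_prod_symm _ i1, integral_prod _ i3]
  simp only [htime, integral_const_mul]
  rw [← integral_prod_symm (fun p => smoothPartial 0 j φ p * (A i p.1 * B 0 p.2)) i2,
    integral_prod _ i2]
  simp only [hcirc, integral_const_mul]
  rw [pow_add, mul_assoc]

section
variable {d : ℕ}

/-- Weak derivatives of a tensor product are the tensor products of the derivatives. -/
theorem hasCylWeakDeriv_tensor {i j : ℕ} {A B : ℕ → ℝ → ℝ} (hA : TimeProfile i A)
    (hB : CircleProfile j B) {e : EuclideanSpace ℝ (Fin d)} {f g : CylL2 d}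
    (hf : f =ᵐ[cylMeasure] fun p => (A 0 p.1 * B 0 p.2) • e)
    (hg : g =ᵐ[cylMeasure] fun p => (A i p.1 * B j p.2) • e) : HasCylWeakDeriv i j f g := by
  intro φ hφ
  have h1 : ∀ (ψ : ℝ × ℝ → ℝ) (a b : ℝ → ℝ) (u : CylL2 d),
      u =ᵐ[cylMeasure] (fun p => (a p.1 * b p.2) • e) →
      ∫ p, ψ p • u p ∂cylMeasure = (∫ p, ψ p * (a p.1 * b p.2) ∂cylMeasure) • e := by
    intro ψ a b u hu
    rw [← integral_smul_const]
    refine integral_congr_ae ?_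
    filter_upwards [hu] with p hp
    rw [hp, smul_smul]
  rw [h1 _ _ _ f hf, h1 _ _ _ g hg, integral_smoothPartial_mul_tensor hA hB hφ, smul_smul]

theorem memLp_tensor_smul {a b : ℝ → ℝ} (ha : MemLp a 2 timeMeasure) (hb : MemLp b 2 circleMeasure)
    (e : EuclideanSpace ℝ (Fin d)) :
    MemLp (fun p : ℝ × ℝ => (a p.1 * b p.2) • e) 2 cylMeasure :=
  (ContinuousLinearMap.toSpanSingleton ℝ e).comp_memLp' (memLp_tensor ha hb)

/-- The square integrable function `(t,θ) ↦ a(t) b(θ) e`. -/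
noncomputable def tensorL2 {a b : ℝ → ℝ} (ha : MemLp a 2 timeMeasure) (hb : MemLp b 2 circleMeasure)
    (e : EuclideanSpace ℝ (Fin d)) : CylL2 d :=
  (memLp_tensor_smul ha hb e).toLp _

theorem coeFn_tensorL2 {a b : ℝ → ℝ} (ha : MemLp a 2 timeMeasure) (hb : MemLp b 2 circleMeasure)
    (e : EuclideanSpace ℝ (Fin d)) :
    tensorL2 ha hb e =ᵐ[cylMeasure] fun p => (a p.1 * b p.2) • e :=
  MemLp.coeFn_toLp _

theorem hasCylWeakDeriv_tensorL2 {i j : ℕ} {A B : ℕ → ℝ → ℝ} (hA : TimeProfile i A)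
    (hB : CircleProfile j B) (ha : MemLp (A 0) 2 timeMeasure) (ha' : MemLp (A i) 2 timeMeasure)
    (hb : MemLp (B 0) 2 circleMeasure) (hb' : MemLp (B j) 2 circleMeasure)
    (e : EuclideanSpace ℝ (Fin d)) :
    HasCylWeakDeriv i j (tensorL2 ha hb e) (tensorL2 ha' hb' e) :=
  hasCylWeakDeriv_tensor hA hB (coeFn_tensorL2 _ _ _) (coeFn_tensorL2 _ _ _)

/-- The element `(t,θ) ↦ A(t) B(θ) e` of `H^{k,ℓ}`. -/
noncomputable def tensorElement {k l : ℕ} {A B : ℕ → ℝ → ℝ} (hA : TimeProfile k A)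
    (hB : CircleProfile l B) (e : EuclideanSpace ℝ (Fin d)) : mixedSobolev d k l :=
  ⟨WithLp.toLp 2 ![tensorL2 (hA.memLp (Nat.zero_le k)) (hB.memLp (Nat.zero_le l)) e,
      tensorL2 hA.memLp_top (hB.memLp (Nat.zero_le l)) e,
      tensorL2 (hA.memLp (Nat.zero_le k)) hB.memLp_top e, tensorL2 hA.memLp_top hB.memLp_top e],
    hasCylWeakDeriv_tensorL2 hA (hB.mono (Nat.zero_le l)) (hA.memLp (Nat.zero_le k)) hA.memLp_top
      (hB.memLp (Nat.zero_le l)) (hB.memLp (Nat.zero_le l)) e,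
    hasCylWeakDeriv_tensorL2 (hA.mono (Nat.zero_le k)) hB (hA.memLp (Nat.zero_le k))
      (hA.memLp (Nat.zero_le k)) (hB.memLp (Nat.zero_le l)) hB.memLp_top e,
    hasCylWeakDeriv_tensorL2 hA hB (hA.memLp (Nat.zero_le k)) hA.memLp_top
      (hB.memLp (Nat.zero_le l)) hB.memLp_top e⟩

section
variable {k l : ℕ} {A B : ℕ → ℝ → ℝ} (hA : TimeProfile k A) (hB : CircleProfile l B)
  (e : EuclideanSpace ℝ (Fin d))

theorem tensorElement_zero :
    (tensorElement hA hB e).1 0 =ᵐ[cylMeasure] fun p => (A 0 p.1 * B 0 p.2) • e :=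
  coeFn_tensorL2 (hA.memLp (Nat.zero_le k)) (hB.memLp (Nat.zero_le l)) e

theorem tensorElement_one :
    (tensorElement hA hB e).1 1 =ᵐ[cylMeasure] fun p => (A k p.1 * B 0 p.2) • e :=
  coeFn_tensorL2 hA.memLp_top (hB.memLp (Nat.zero_le l)) e

theorem tensorElement_two :
    (tensorElement hA hB e).1 2 =ᵐ[cylMeasure] fun p => (A 0 p.1 * B l p.2) • e :=
  coeFn_tensorL2 (hA.memLp (Nat.zero_le k)) hB.memLp_top e

theorem tensorElement_three :
    (tensorElement hA hB e).1 3 =ᵐ[cylMeasure] fun p => (A k p.1 * B l p.2) • e :=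
  coeFn_tensorL2 hA.memLp_top hB.memLp_top e

end

theorem inner_tensor {a b : ℝ → ℝ} (ha : MemLp a 2 timeMeasure) (hb : MemLp b 2 circleMeasure)
    {r : Fin d} {f : CylL2 d} (hf : f =ᵐ[cylMeasure] fun p =>
      (a p.1 * b p.2) • (EuclideanSpace.single r (1 : ℝ) : EuclideanSpace ℝ (Fin d))) (g : CylL2 d) :
    ⟪f, g⟫ = ∫ t, a t * ∫ θ, g (t, θ) r * b θ ∂circleMeasure ∂timeMeasure := by
  rw [← integral_tensor_mul ha hb (memLp_apply g r), L2.inner_def]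
  refine integral_congr_ae ?_
  filter_upwards [hf] with p hp
  rw [hp, real_inner_smul_left, EuclideanSpace.inner_single_left]
  simp

/-- Only the zero element of `H^{k,ℓ}` is orthogonal to all tensor products with trigonometric
functions in `θ`. Differentiating twice `ℓ` times in `θ` multiplies a trigonometric function by
a constant, so that orthogonality reduces to a statement on the Fourier coefficients in `H^k`. -/
theorem eq_zero_of_forall_inner_tensor {k l : ℕ} {x : mixedSobolev d k l}
    (h : ∀ (A : ℕ → ℝ → ℝ) (hA : TimeProfile k A) (ν : ℕ) (φ : ℝ) (r : Fin d),
      ⟪tensorElement hA (circleProfile_trig l ν φ) (EuclideanSpace.single r 1), x⟫ = 0) : x = 0 := by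
  have hx0 : x.1 0 = 0 := by
    refine CylL2.ext_apply fun r => ?_
    have hz : ∀ᵐ p ∂cylMeasure, (0 : CylL2 d) p = 0 := by
      filter_upwards [Lp.coeFn_zero (EuclideanSpace ℝ (Fin d)) 2 cylMeasure] with p hp using hp
    have hgoal : (fun p => x.1 0 p r) =ᵐ[cylMeasure] 0 := by
      refine ae_eq_zero_of_forall_trig (memLp_apply (x.1 0) r) fun ν φ => ?_
      -- the Fourier coefficients of the four components of `x`, as functions of `t`
      set G : Fin 4 → ℕ → ℝ → ℝ := fun q m t =>
        ∫ θ, x.1 q (t, θ) r * trig ν φ m θ ∂circleMeasure with hG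
      have hGm : ∀ q m, MemLp (G q m) 2 timeMeasure := fun q m =>
        memLp_integral_mul (memLp_apply (x.1 q) r) (contDiff_trig ν φ m).continuous
          (abs_trig_le ν φ m)
      have hGi : ∀ q m, IntervalIntegrable (G q m) volume 0 1 := fun q m =>
        MemLp.intervalIntegrable_zero_one (hGm q m)
      have hG2 : ∀ q, G q (l + l) = fun t => (-1) ^ l * (ν : ℝ) ^ (l + l) * G q 0 t := by
        intro q
        ext t
        simp only [hG, ← integral_const_mul]
        congr 1; ext θ
        simp only [trig]
        rw [show (ν : ℝ) * θ + φ + (l + l : ℕ) * (Real.pi / 2) = ν * θ + φ + l * Real.pi by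
          push_cast; ring, Real.cos_add_nat_mul_pi]
        simp; ring
      have hweak : ∀ {i j : ℕ} {q : Fin 4}, HasCylWeakDeriv i j (x.1 0) (x.1 q) → ∀ m a,
          IsIntervalTest a → ∫ t in (0 : ℝ)..1, iteratedDeriv i a t * G 0 (m + j) t
            = (-1) ^ (i + j) * ∫ t in (0 : ℝ)..1, a t * G q m t := by
        intro i j q hw m a ha
        have := hw.integral_apply (isCylTest_mul_trig ha ν φ m) r
        simp only [smoothPartial_mul_trig ha] at this
        rw [integral_tensor_mul (ha.memLp i) (memLp_trig _ _ _) (memLp_apply _ _),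
          integral_tensor_mul (by simpa using ha.memLp 0) (memLp_trig _ _ _)
          (memLp_apply _ _)] at this
        rw [intervalIntegral.integral_of_le zero_le_one, intervalIntegral.integral_of_le zero_le_one]
        exact this
      have hsign : ∀ n : ℕ, ((-1 : ℝ) ^ n) * (-1) ^ n = 1 := fun n => by rw [← mul_pow]; simp
      have h1 := fun a ha => hweak (i := k) (j := 0) x.2.1 0 a ha
      have e2 : G 2 l =ᵐ[timeMeasure] fun t => (ν : ℝ) ^ (l + l) * G 0 0 t := by
        refine ae_eq_of_integral_test_mul_eq (hGi _ _) ((hGi _ _).const_mul _) fun a ha => ?_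
        have := hweak (i := 0) (j := l) x.2.2.1 l a ha
        rw [hG2] at this
        simp only [iteratedDeriv_zero, zero_add, mul_left_comm (a _), mul_assoc,
          intervalIntegral.integral_const_mul] at this ⊢
        linear_combination (-((-1 : ℝ) ^ l)) * this +
          ((ν : ℝ) ^ (l + l) * (∫ t in (0 : ℝ)..1, a t * G 0 0 t)
            - ∫ t in (0 : ℝ)..1, a t * G 2 l t) * hsign l
      have e3 : G 3 l =ᵐ[timeMeasure] fun t => (ν : ℝ) ^ (l + l) * G 1 0 t := by
        refine ae_eq_of_integral_test_mul_eq (hGi _ _) ((hGi _ _).const_mul _) fun a ha => ?_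
        have h3 := hweak (i := k) (j := l) x.2.2.2 l a ha
        have h1' := h1 a ha
        rw [hG2] at h3
        simp only [add_zero, mul_left_comm (iteratedDeriv k a _),
          mul_left_comm (a _), mul_assoc,
          intervalIntegral.integral_const_mul] at h3 h1' ⊢
        rw [h1', pow_add] at h3
        linear_combination (-((-1 : ℝ) ^ k * (-1) ^ l)) * h3 +
          ((-1 : ℝ) ^ k * (-1) ^ k) * ((ν : ℝ) ^ (l + l) * (∫ t in (0 : ℝ)..1, a t * G 1 0 t)
            - ∫ t in (0 : ℝ)..1, a t * G 3 l t) * hsign l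
          + ((ν : ℝ) ^ (l + l) * (∫ t in (0 : ℝ)..1, a t * G 1 0 t)
            - ∫ t in (0 : ℝ)..1, a t * G 3 l t) * hsign k
      -- `x` is tested against the tensor product with its own Fourier coefficient
      obtain ⟨A, hA, hAk, hA0⟩ := exists_primChain_of_weakDeriv k (hGi 0 0) (hGi 1 0)
        (by simpa using h1)
      have hAp : TimeProfile k A := ⟨hA, by rw [hAk]; exact hGm 1 0⟩
      have horth := h A hAp ν φ r
      rw [Submodule.coe_inner, PiLp.inner_apply, Fin.sum_univ_four] at horth
      rw [inner_tensor (hAp.memLp (Nat.zero_le k)) (memLp_trig ν φ 0) (tensorElement_zero _ _ _),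
        inner_tensor (hAp.memLp le_rfl) (memLp_trig ν φ 0) (tensorElement_one _ _ _),
        inner_tensor (hAp.memLp (Nat.zero_le k)) (memLp_trig ν φ l) (tensorElement_two _ _ _),
        inner_tensor (hAp.memLp le_rfl) (memLp_trig ν φ l) (tensorElement_three _ _ _), hAk] at horth
      have f0 : ∫ t, A 0 t * G 0 0 t ∂timeMeasure = ∫ t, G 0 0 t ^ 2 ∂timeMeasure := by
        refine integral_congr_ae ?_
        filter_upwards [hA0] with t ht
        rw [ht, sq]
      have f1 : ∫ t, G 1 0 t * G 1 0 t ∂timeMeasure = ∫ t, G 1 0 t ^ 2 ∂timeMeasure := by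
        simp only [sq]
      have f2 : ∫ t, A 0 t * G 2 l t ∂timeMeasure
          = (ν : ℝ) ^ (l + l) * ∫ t, G 0 0 t ^ 2 ∂timeMeasure := by
        rw [← integral_const_mul]
        refine integral_congr_ae ?_
        filter_upwards [hA0, e2] with t ht ht'
        rw [ht, ht']; ring
      have f3 : ∫ t, G 1 0 t * G 3 l t ∂timeMeasure
          = (ν : ℝ) ^ (l + l) * ∫ t, G 1 0 t ^ 2 ∂timeMeasure := by
        rw [← integral_const_mul]
        refine integral_congr_ae ?_
        filter_upwards [e3] with t ht'
        rw [ht']; ring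
      have horth' : ∫ t, A 0 t * G 0 0 t ∂timeMeasure + ∫ t, G 1 0 t * G 1 0 t ∂timeMeasure
        + ∫ t, A 0 t * G 2 l t ∂timeMeasure + ∫ t, G 1 0 t * G 3 l t ∂timeMeasure = 0 := horth
      rw [f0, f1, f2, f3] at horth'
      have p0 : 0 ≤ ∫ t, G 0 0 t ^ 2 ∂timeMeasure := integral_nonneg fun t => sq_nonneg _
      have p1 : 0 ≤ ∫ t, G 1 0 t ^ 2 ∂timeMeasure := integral_nonneg fun t => sq_nonneg _
      have p2 : (0 : ℝ) ≤ (ν : ℝ) ^ (l + l) := by positivity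
      have hz0 : ∫ t, G 0 0 t ^ 2 ∂timeMeasure = 0 := by
        nlinarith [mul_nonneg p2 p0, mul_nonneg p2 p1]
      rw [integral_eq_zero_iff_of_nonneg (fun t => sq_nonneg _) (hGm 0 0).integrable_sq] at hz0
      filter_upwards [hz0] with t ht
      exact pow_eq_zero_iff two_ne_zero |>.1 ht
    filter_upwards [hgoal, hz] with p hp hp'
    rw [hp', hp]
    simp
  refine sobolevFun_injective d k l ?_
  exact hx0

end


/-! ### Continuous representatives of the lower order derivatives -/

section
variable {d k l : ℕ}

/-- A closed subspace of `H^{k,ℓ}` is everything if it contains all tensor products with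
trigonometric functions in `θ`. -/
theorem mixedSobolev_eq_top {V : Submodule ℝ (mixedSobolev d k l)}
    (hV : IsClosed (V : Set (mixedSobolev d k l)))
    (h : ∀ (A : ℕ → ℝ → ℝ) (hA : TimeProfile k A) (ν : ℕ) (φ : ℝ) (r : Fin d),
      tensorElement hA (circleProfile_trig l ν φ) (EuclideanSpace.single r 1) ∈ V) : V = ⊤ := by
  rw [← hV.submodule_topologicalClosure_eq, Submodule.topologicalClosure_eq_top_iff,
    Submodule.eq_bot_iff]
  intro x hx
  exact eq_zero_of_forall_inner_tensor fun A hA ν φ r =>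
    (Submodule.mem_orthogonal V x).1 hx _ (h A hA ν φ r)

theorem clm_ext_tensor {F : Type*} [NormedAddCommGroup F] [NormedSpace ℝ F]
    {L L' : mixedSobolev d k l →L[ℝ] F}
    (h : ∀ (A : ℕ → ℝ → ℝ) (hA : TimeProfile k A) (ν : ℕ) (φ : ℝ) (r : Fin d),
      L (tensorElement hA (circleProfile_trig l ν φ) (EuclideanSpace.single r 1))
        = L' (tensorElement hA (circleProfile_trig l ν φ) (EuclideanSpace.single r 1))) :
    L = L' := by
  have := mixedSobolev_eq_top (V := LinearMap.eqLocus L.toLinearMap L'.toLinearMap)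
    (isClosed_eq L.continuous L'.continuous) h
  ext1 x
  have hx : x ∈ LinearMap.eqLocus L.toLinearMap L'.toLinearMap := this ▸ Submodule.mem_top
  exact hx

theorem exists_integral_norm_le (d : ℕ) :
    ∃ C : ℝ, 0 ≤ C ∧ ∀ f : CylL2 d, ∫ p, ‖f p‖ ∂cylMeasure ≤ C * ‖f‖ := by
  refine ⟨(cylMeasure univ ^ (1 / (1 : ENNReal).toReal - 1 / (2 : ENNReal).toReal)).toReal,
    ENNReal.toReal_nonneg, fun f => ?_⟩
  rw [integral_norm_eq_lintegral_enorm (Lp.aestronglyMeasurable f), ← eLpNorm_one_eq_lintegral_enorm,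
    Lp.norm_def, mul_comm, ← ENNReal.toReal_mul]
  refine ENNReal.toReal_mono ?_
    (eLpNorm_le_eLpNorm_mul_rpow_measure_univ (by norm_num) (Lp.aestronglyMeasurable f))
  refine ENNReal.mul_ne_top (Lp.eLpNorm_ne_top f) (ENNReal.rpow_ne_top_of_nonneg (by norm_num) ?_)
  exact measure_ne_top _ _

theorem integrable_bdd_smul {ψ : ℝ × ℝ → ℝ} (hψ : Measurable ψ) {M : ℝ} (hM : ∀ p, |ψ p| ≤ M)
    (f : CylL2 d) : Integrable (fun p => ψ p • f p) cylMeasure :=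
  ((Lp.memLp f).integrable (by norm_num)).bdd_smul M hψ.aestronglyMeasurable (ae_of_all _ hM)

/-- Integration against bounded kernels is bounded on `L²`, uniformly for uniformly bounded
kernels. -/
theorem exists_clm_integral (d : ℕ) : ∃ C : ℝ, 0 ≤ C ∧ ∀ (ψ : ℝ × ℝ → ℝ) (M : ℝ), Measurable ψ →
    0 ≤ M → (∀ p, |ψ p| ≤ M) → ∃ L : CylL2 d →L[ℝ] EuclideanSpace ℝ (Fin d),
      (∀ f, L f = ∫ p, ψ p • f p ∂cylMeasure) ∧ ∀ f, ‖L f‖ ≤ M * C * ‖f‖ := by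
  obtain ⟨C, hC, h⟩ := exists_integral_norm_le d
  refine ⟨C, hC, fun ψ M hψ hM0 hM => ?_⟩
  have hb : ∀ f : CylL2 d, ‖∫ p, ψ p • f p ∂cylMeasure‖ ≤ M * C * ‖f‖ := by
    intro f
    calc ‖∫ p, ψ p • f p ∂cylMeasure‖ ≤ ∫ p, M * ‖f p‖ ∂cylMeasure := by
          refine norm_integral_le_of_norm_le
            (((Lp.memLp f).integrable (by norm_num)).norm.const_mul M) (ae_of_all _ fun p => ?_)
          rw [norm_smul]
          exact mul_le_mul_of_nonneg_right (hM p) (norm_nonneg _)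
      _ = M * ∫ p, ‖f p‖ ∂cylMeasure := integral_const_mul _ _
      _ ≤ M * (C * ‖f‖) := mul_le_mul_of_nonneg_left (h f) hM0
      _ = _ := (mul_assoc _ _ _).symm
  refine ⟨LinearMap.mkContinuous
    { toFun := fun f => ∫ p, ψ p • f p ∂cylMeasure
      map_add' := fun f g => ?_
      map_smul' := fun r f => ?_ } (M * C) hb, fun f => rfl, hb⟩
  · rw [← integral_add (integrable_bdd_smul hψ hM f) (integrable_bdd_smul hψ hM g)]
    refine integral_congr_ae ?_
    filter_upwards [Lp.coeFn_add f g] with p hp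
    rw [hp, Pi.add_apply, smul_add]
  · rw [RingHom.id_apply, ← integral_smul]
    refine integral_congr_ae ?_
    filter_upwards [Lp.coeFn_smul r f] with p hp
    rw [hp, Pi.smul_apply, smul_comm]

theorem integral_mul_tensor_smul {a b : ℝ → ℝ} {e : EuclideanSpace ℝ (Fin d)} {f : CylL2 d}
    (hf : f =ᵐ[cylMeasure] fun p => (a p.1 * b p.2) • e) (P Q : ℝ → ℝ) :
    ∫ p, (P p.1 * Q p.2) • f p ∂cylMeasure
      = ((∫ t, P t * a t ∂timeMeasure) * ∫ θ, Q θ * b θ ∂circleMeasure) • e := by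
  rw [← integral_prod_mul, ← cylMeasure_eq_prod, ← integral_smul_const]
  refine integral_congr_ae ?_
  filter_upwards [hf] with p hp
  rw [hp, smul_smul]
  congr 1
  ring

/-- The point of `[0,1]` closest to `t`. -/
noncomputable def unitClamp (t : ℝ) : ℝ := max 0 (min 1 t)

theorem unitClamp_mem (t : ℝ) : unitClamp t ∈ Icc (0 : ℝ) 1 :=
  ⟨le_max_left _ _, max_le zero_le_one (min_le_left _ _)⟩

theorem unitClamp_of_mem {t : ℝ} (ht : t ∈ Icc (0 : ℝ) 1) : unitClamp t = t := by
  rw [unitClamp, min_eq_right ht.2, max_eq_right ht.1]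

theorem continuous_unitClamp : Continuous unitClamp :=
  continuous_const.max (continuous_const.min continuous_id)

theorem trig_toIcoMod (ν : ℕ) (φ : ℝ) (j : ℕ) (θ : ℝ) :
    trig ν φ j (toIcoMod Real.two_pi_pos 0 θ) = trig ν φ j θ := by
  have : Function.Periodic (trig ν φ j) (2 * Real.pi) := fun θ => trig_periodic ν φ j θ
  rw [toIcoMod]
  exact this.sub_zsmul_eq _

/-- Point values of the derivatives of order `(i,j)`, with `i < k` and `j < ℓ`, extend to bounded
functionals on `H^{k,ℓ}`. They are integrals against the products of the kernels which represent
the point values in one variable. -/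
theorem exists_pointEval {i j : ℕ} (hi : i < k) (hj : j < l) : ∃ C : ℝ, ∀ p : ℝ × ℝ,
    ∃ L : mixedSobolev d k l →L[ℝ] EuclideanSpace ℝ (Fin d), (∀ x, ‖L x‖ ≤ C * ‖x‖) ∧
      ∀ (A : ℕ → ℝ → ℝ) (hA : TimeProfile k A) (ν : ℕ) (φ : ℝ) (e : EuclideanSpace ℝ (Fin d)),
        L (tensorElement hA (circleProfile_trig l ν φ) e)
          = (A i (unitClamp p.1) * trig ν φ j p.2) • e := by
  obtain ⟨C, hC0, hC⟩ := exists_clm_integral d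
  obtain ⟨p₁, q₁, M₁, mp₁, mq₁, bp₁, bq₁, h₁⟩ := exists_kernel zero_lt_one hi
  obtain ⟨p₂, q₂, M₂, mp₂, mq₂, bp₂, bq₂, h₂⟩ := exists_kernel Real.two_pi_pos hj
  have hM₁ : 0 ≤ M₁ := (abs_nonneg _).trans (bp₁ 0 0)
  have hM₂ : 0 ≤ M₂ := (abs_nonneg _).trans (bp₂ 0 0)
  refine ⟨4 * (M₁ * M₂ * C), fun p => ?_⟩
  set t := unitClamp p.1
  set θ := toIcoMod Real.two_pi_pos 0 p.2
  have hθ : θ ∈ Icc (0 : ℝ) (2 * Real.pi) :=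
    ⟨(toIcoMod_mem_Ico' Real.two_pi_pos p.2).1, (toIcoMod_mem_Ico' Real.two_pi_pos p.2).2.le⟩
  have hL : ∀ P Q : ℝ → ℝ, Measurable P → Measurable Q → (∀ s, |P s| ≤ M₁) → (∀ s, |Q s| ≤ M₂) →
      ∃ L : CylL2 d →L[ℝ] EuclideanSpace ℝ (Fin d),
        (∀ f, L f = ∫ p, (P p.1 * Q p.2) • f p ∂cylMeasure) ∧ ∀ f, ‖L f‖ ≤ M₁ * M₂ * C * ‖f‖ := by
    intro P Q hP hQ bP bQ
    refine hC (fun p => P p.1 * Q p.2) (M₁ * M₂)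
      ((hP.comp measurable_fst).mul (hQ.comp measurable_snd)) (mul_nonneg hM₁ hM₂) fun p => ?_
    rw [abs_mul]
    exact mul_le_mul (bP _) (bQ _) (abs_nonneg _) hM₁
  have sec : ∀ {g : ℝ → ℝ → ℝ} (_ : Measurable (Function.uncurry g)) (a : ℝ), Measurable (g a) :=
    fun hg a => hg.comp measurable_prodMk_left
  obtain ⟨L0, e0, b0⟩ := hL (p₁ t) (p₂ θ) (sec mp₁ t) (sec mp₂ θ) (bp₁ t) (bp₂ θ)
  obtain ⟨L1, e1, b1⟩ := hL (q₁ t) (p₂ θ) (sec mq₁ t) (sec mp₂ θ) (bq₁ t) (bp₂ θ)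
  obtain ⟨L2, e2, b2⟩ := hL (p₁ t) (q₂ θ) (sec mp₁ t) (sec mq₂ θ) (bp₁ t) (bq₂ θ)
  obtain ⟨L3, e3, b3⟩ := hL (q₁ t) (q₂ θ) (sec mq₁ t) (sec mq₂ θ) (bq₁ t) (bq₂ θ)
  let pr : Fin 4 → mixedSobolev d k l →L[ℝ] CylL2 d := fun q =>
    (PiLp.proj 2 (fun _ : Fin 4 => CylL2 d) q).comp (mixedSobolev d k l).subtypeL
  have hpr : ∀ q x, pr q x = x.1 q := fun _ _ => rfl
  have nq : ∀ q x, ‖pr q x‖ ≤ ‖x‖ := fun q x => PiLp.norm_apply_le x.1 q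
  refine ⟨L0.comp (pr 0) + L1.comp (pr 1) + L2.comp (pr 2) + L3.comp (pr 3), fun x => ?_,
    fun A hA ν φ e => ?_⟩
  · have hMC : 0 ≤ M₁ * M₂ * C := by positivity
    have n0 := (b0 (pr 0 x)).trans (mul_le_mul_of_nonneg_left (nq 0 x) hMC)
    have n1 := (b1 (pr 1 x)).trans (mul_le_mul_of_nonneg_left (nq 1 x) hMC)
    have n2 := (b2 (pr 2 x)).trans (mul_le_mul_of_nonneg_left (nq 2 x) hMC)
    have n3 := (b3 (pr 3 x)).trans (mul_le_mul_of_nonneg_left (nq 3 x) hMC)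
    have := norm_add₄_le (a := L0 (pr 0 x)) (b := L1 (pr 1 x)) (c := L2 (pr 2 x)) (d := L3 (pr 3 x))
    simp only [add_apply, ContinuousLinearMap.comp_apply]
    linarith
  · have hB := circleProfile_trig l ν φ
    simp only [add_apply, ContinuousLinearMap.comp_apply, hpr, e0, e1, e2, e3]
    rw [integral_mul_tensor_smul (tensorElement_zero _ _ _),
      integral_mul_tensor_smul (tensorElement_one _ _ _),
      integral_mul_tensor_smul (tensorElement_two _ _ _),
      integral_mul_tensor_smul (tensorElement_three _ _ _)]
    have hint : ∀ {μ : Measure ℝ} [IsFiniteMeasure μ] {P a : ℝ → ℝ} {M : ℝ}, Measurable P →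
        (∀ s, |P s| ≤ M) → MemLp a 2 μ → Integrable (fun s => P s * a s) μ := by
      intro μ _ P a M hP bP ha
      exact (ha.integrable (by norm_num)).bdd_mul hP.aestronglyMeasurable (ae_of_all _ bP)
    have k1 := h₁ A hA.chain t (unitClamp_mem _)
    have k2 := h₂ _ hB.chain θ hθ
    rw [integral_add (hint (sec mp₁ t) (bp₁ t) (hA.memLp (Nat.zero_le k)))
      (hint (sec mq₁ t) (bq₁ t) hA.memLp_top)] at k1
    rw [integral_add (hint (sec mp₂ θ) (bp₂ θ) (hB.memLp (Nat.zero_le l)))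
      (hint (sec mq₂ θ) (bq₂ θ) hB.memLp_top), trig_toIcoMod] at k2
    rw [k1, k2, ← add_smul, ← add_smul, ← add_smul]
    congr 1
    ring

theorem TimeProfile.continuous_clamp {A : ℕ → ℝ → ℝ} (hA : TimeProfile k A) {i : ℕ} (hi : i < k) :
    Continuous fun t => A i (unitClamp t) :=
  (hA.chain.continuousOn zero_le_one hi).comp_continuous continuous_unitClamp unitClamp_mem

/-- The derivatives of order `(i,j)`, with `i < k` and `j < ℓ`, of the elements of `H^{k,ℓ}` are
continuous and depend continuously on the element with respect to the supremum norm. -/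
theorem exists_contDeriv (d k l : ℕ) :
    ∃ Φ : ℕ → ℕ → mixedSobolev d k l →L[ℝ] BoundedContinuousFunction (ℝ × ℝ) (EuclideanSpace ℝ (Fin d)),
      ∀ i < k, ∀ j < l, ∀ (A : ℕ → ℝ → ℝ) (hA : TimeProfile k A) (ν : ℕ) (φ : ℝ)
        (e : EuclideanSpace ℝ (Fin d)) (p : ℝ × ℝ),
        Φ i j (tensorElement hA (circleProfile_trig l ν φ) e) p
          = (A i (unitClamp p.1) * trig ν φ j p.2) • e := by
  suffices h : ∀ i j, ∃ Ψ : mixedSobolev d k l →L[ℝ]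
      BoundedContinuousFunction (ℝ × ℝ) (EuclideanSpace ℝ (Fin d)), i < k → j < l →
      ∀ (A : ℕ → ℝ → ℝ) (hA : TimeProfile k A) (ν : ℕ) (φ : ℝ)
        (e : EuclideanSpace ℝ (Fin d)) (p : ℝ × ℝ),
        Ψ (tensorElement hA (circleProfile_trig l ν φ) e) p
          = (A i (unitClamp p.1) * trig ν φ j p.2) • e by
    choose Φ hΦ using h
    exact ⟨Φ, fun i hi j hj => hΦ i j hi hj⟩
  intro i j
  by_cases hij : i < k ∧ j < l
  swap
  · exact ⟨0, fun hi hj => (hij ⟨hi, hj⟩).elim⟩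
  obtain ⟨hi, hj⟩ := hij
  obtain ⟨C, hC⟩ := exists_pointEval (d := d) hi hj
  choose L hL htens using hC
  let V : Submodule ℝ (mixedSobolev d k l) :=
    { carrier := {x | Continuous fun p => L p x}
      zero_mem' := by simpa using continuous_const
      add_mem' := fun {x y} hx hy => by
        simp only [mem_ofPred_eq, map_add] at hx hy ⊢
        exact hx.add hy
      smul_mem' := fun r x hx => by
        simp only [mem_ofPred_eq, map_smul] at hx ⊢
        exact hx.const_smul r }
  have hV : IsClosed (V : Set (mixedSobolev d k l)) := by
    refine isClosed_of_closure_subset fun x hx => ?_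
    obtain ⟨y, hy, hyx⟩ := mem_closure_iff_seq_limit.1 hx
    refine TendstoUniformly.continuous (F := fun n p => L p (y n)) (p := atTop) ?_
      (Frequently.of_forall hy)
    rw [Metric.tendstoUniformly_iff]
    intro ε hε
    have h0 : Tendsto (fun n => C * ‖x - y n‖) atTop (𝓝 0) := by
      have := ((tendsto_const_nhds (x := x)).sub hyx).norm.const_mul C
      simpa using this
    filter_upwards [h0.eventually (gt_mem_nhds hε)] with n hn p
    rw [dist_eq_norm, ← map_sub]
    exact (hL p _).trans_lt hn
  have htop : V = ⊤ := mixedSobolev_eq_top hV fun A hA ν φ r => by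
    change Continuous _
    simp only [htens]
    exact (((hA.continuous_clamp hi).comp continuous_fst).mul
      ((contDiff_trig ν φ j).continuous.comp continuous_snd)).smul continuous_const
  have hcont : ∀ x, Continuous fun p => L p x := fun x => by
    have : x ∈ V := htop ▸ Submodule.mem_top
    exact this
  have hC0 : ∀ x p, ‖L p x‖ ≤ |C| * ‖x‖ := fun x p =>
    (hL p x).trans (mul_le_mul_of_nonneg_right (le_abs_self C) (norm_nonneg _))
  refine ⟨LinearMap.mkContinuous
    { toFun := fun x => BoundedContinuousFunction.ofNormedAddCommGroup (fun p => L p x) (hcont x)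
        (|C| * ‖x‖) (hC0 x)
      map_add' := fun x y => by ext p : 1; simp
      map_smul' := fun r x => by ext p : 1; simp } |C| fun x => ?_, fun _ _ A hA ν φ e p => ?_⟩
  · exact BoundedContinuousFunction.norm_ofNormedAddCommGroup_le _ (by positivity) (hC0 x)
  · exact htens p A hA ν φ e

end


/-! ### Sobolev embedding into spaces of mixed classical differentiability -/

section
variable {d : ℕ}

/-- Integration along a path, as an operator on bounded continuous functions. -/
noncomputable def pathIntegral {E : Type*} [NormedAddCommGroup E] [NormedSpace ℝ E]
    (g : ℝ → ℝ × ℝ) (hg : Continuous g) (a b : ℝ) : BoundedContinuousFunction (ℝ × ℝ) E →L[ℝ] E where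
  toFun w := ∫ s in a..b, w (g s)
  map_add' v w := intervalIntegral.integral_add
    ((v.continuous.comp hg).intervalIntegrable _ _) ((w.continuous.comp hg).intervalIntegrable _ _)
  map_smul' r w := intervalIntegral.integral_smul r _
  cont := by
    refine intervalIntegral.continuous_parametric_intervalIntegral_of_continuous'
      (f := fun (w : BoundedContinuousFunction (ℝ × ℝ) E) s => w (g s)) ?_ a b
    exact ContinuousEval.continuous_eval.comp (continuous_fst.prodMk (hg.comp continuous_snd))

theorem pathIntegral_apply {E : Type*} [NormedAddCommGroup E] [NormedSpace ℝ E]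
    {g : ℝ → ℝ × ℝ} (hg : Continuous g) (a b : ℝ) (w : BoundedContinuousFunction (ℝ × ℝ) E) :
    pathIntegral g hg a b w = ∫ s in a..b, w (g s) := rfl

/-- The class in `L²` of a bounded continuous function. -/
noncomputable abbrev contL2 (d : ℕ) :
    BoundedContinuousFunction (ℝ × ℝ) (EuclideanSpace ℝ (Fin d)) →L[ℝ] CylL2 d :=
  BoundedContinuousFunction.toLp 2 cylMeasure ℝ

theorem coeFn_contL2 (w : BoundedContinuousFunction (ℝ × ℝ) (EuclideanSpace ℝ (Fin d))) :
    contL2 d w =ᵐ[cylMeasure] w := BoundedContinuousFunction.coeFn_toLp 2 cylMeasure ℝ w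

theorem primitive_trig (ν : ℕ) (φ : ℝ) (j : ℕ) (θ : ℝ) :
    trig ν φ j θ = trig ν φ j 0 + ∫ η in (0 : ℝ)..θ, trig ν φ (j + 1) η := by
  rw [intervalIntegral.integral_eq_sub_of_hasDerivAt (fun η _ => hasDerivAt_trig ν φ j η)
    ((contDiff_trig ν φ (j + 1)).continuous.intervalIntegrable _ _)]
  ring

/-- `W i j`, for `i < k` and `j < l`, are the partial derivatives of order `(i,j)` of the function
`W 0 0`, in integrated form. -/
structure IsPartialSystem (k l : ℕ)
    (W : ℕ → ℕ → BoundedContinuousFunction (ℝ × ℝ) (EuclideanSpace ℝ (Fin d))) : Prop where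
  periodic : ∀ i < k, ∀ j < l, ∀ t θ, W i j (t, θ + 2 * Real.pi) = W i j (t, θ)
  time : ∀ i, i + 1 < k → ∀ j < l, ∀ t ∈ Icc (0 : ℝ) 1, ∀ θ,
    W i j (t, θ) = W i j (0, θ) + ∫ s in (0 : ℝ)..t, W (i + 1) j (s, θ)
  circle : ∀ i < k, ∀ j, j + 1 < l → ∀ t θ,
    W i j (t, θ) = W i j (t, 0) + ∫ η in (0 : ℝ)..θ, W i (j + 1) (t, η)

/-- Bounded operators into the continuous functions which give the partial derivatives of order
`(i,j)`, `i < k`, `j < ℓ`, of the elements of `H^{k,ℓ}`. -/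
theorem exists_partialSystem (d k l : ℕ) :
    ∃ Φ : ℕ → ℕ → mixedSobolev d k l →L[ℝ]
        BoundedContinuousFunction (ℝ × ℝ) (EuclideanSpace ℝ (Fin d)),
      ∀ x, IsPartialSystem k l (fun i j => Φ i j x) ∧
        ∀ i < k, ∀ j < l, HasCylWeakDeriv i j (sobolevFun x) (contL2 d (Φ i j x)) := by
  obtain ⟨Φ, hΦ⟩ := exists_contDeriv d k l
  let ev : ℝ × ℝ → BoundedContinuousFunction (ℝ × ℝ) (EuclideanSpace ℝ (Fin d)) →L[ℝ]
      EuclideanSpace ℝ (Fin d) := fun p => BoundedContinuousFunction.evalCLM ℝ p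
  refine ⟨Φ, fun x => ⟨⟨fun i hi j hj t θ => ?_, fun i hi j hj t ht θ => ?_,
    fun i hi j hj t θ => ?_⟩, fun i hi j hj => ?_⟩⟩
  · have : (ev (t, θ + 2 * Real.pi)).comp (Φ i j) = (ev (t, θ)).comp (Φ i j) := by
      refine clm_ext_tensor fun A hA ν φ r => ?_
      simp only [ev, ContinuousLinearMap.comp_apply, BoundedContinuousFunction.evalCLM_apply,
        hΦ i hi j hj, trig_periodic]
    exact DFunLike.congr_fun this x
  · have : (ev (t, θ)).comp (Φ i j) = (ev (0, θ)).comp (Φ i j)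
        + (pathIntegral (fun s => (s, θ)) (by fun_prop) 0 t).comp (Φ (i + 1) j) := by
      refine clm_ext_tensor fun A hA ν φ r => ?_
      simp only [ev, ContinuousLinearMap.comp_apply, BoundedContinuousFunction.evalCLM_apply,
        hΦ i (by omega) j hj, add_apply,
        pathIntegral_apply]
      simp only [hΦ (i + 1) hi j hj]
      have hint : ∫ s in (0 : ℝ)..t, A (i + 1) (unitClamp s) = ∫ s in (0 : ℝ)..t, A (i + 1) s := by
        refine intervalIntegral.integral_congr fun s hs => ?_
        rw [uIcc_of_le ht.1] at hs
        simp only [unitClamp_of_mem ⟨hs.1, hs.2.trans ht.2⟩]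
      rw [intervalIntegral.integral_smul_const, ← add_smul, intervalIntegral.integral_mul_const,
        ← add_mul, hint, unitClamp_of_mem ht, unitClamp_of_mem ⟨le_rfl, zero_le_one⟩,
        hA.chain.step i (by omega) t ht]
    exact DFunLike.congr_fun this x
  · have : (ev (t, θ)).comp (Φ i j) = (ev (t, 0)).comp (Φ i j)
        + (pathIntegral (fun s => (t, s)) (by fun_prop) 0 θ).comp (Φ i (j + 1)) := by
      refine clm_ext_tensor fun A hA ν φ r => ?_
      simp only [ev, ContinuousLinearMap.comp_apply, BoundedContinuousFunction.evalCLM_apply,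
        hΦ i hi j (by omega), add_apply,
        pathIntegral_apply]
      simp only [hΦ i hi (j + 1) hj]
      rw [intervalIntegral.integral_smul_const, ← add_smul, intervalIntegral.integral_const_mul,
        ← mul_add, ← primitive_trig]
    exact DFunLike.congr_fun this x
  · let V : Submodule ℝ (mixedSobolev d k l) :=
      { carrier := {x | HasCylWeakDeriv i j (sobolevFun x) (contL2 d (Φ i j x))}
        zero_mem' := by
          simp only [mem_ofPred_eq, map_zero]
          exact .zero i j
        add_mem' := fun {x y} hx hy => by
          simp only [mem_ofPred_eq, map_add] at hx hy ⊢
          exact hx.add hy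
        smul_mem' := fun r x hx => by
          simp only [mem_ofPred_eq, map_smul] at hx ⊢
          exact hx.smul r }
    have hV : IsClosed (V : Set (mixedSobolev d k l)) := by
      refine (isClosed_hasCylWeakDeriv (d := d) i j).preimage
        (f := fun x : mixedSobolev d k l => (sobolevFun x, contL2 d (Φ i j x))) ?_
      refine Continuous.prodMk ?_ ((contL2 d).continuous.comp (Φ i j).continuous)
      exact (PiLp.continuous_apply (p := 2) (β := fun _ : Fin 4 => CylL2 d) 0).comp
        continuous_subtype_val
    have htop : V = ⊤ := mixedSobolev_eq_top hV fun A hA ν φ r => by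
      refine hasCylWeakDeriv_tensor (hA.mono hi.le) ((circleProfile_trig l ν φ).mono hj.le)
        (tensorElement_zero _ _ _) ?_
      filter_upwards [coeFn_contL2 (Φ i j (tensorElement hA (circleProfile_trig l ν φ)
          (EuclideanSpace.single r 1))),
        ae_restrict_mem (measurableSet_Icc.prod measurableSet_Ioc)] with p hp hp'
      rw [hp, hΦ i hi j hj, unitClamp_of_mem hp'.1]
    have : x ∈ V := htop ▸ Submodule.mem_top
    exact this

section
variable {k l : ℕ} {W : ℕ → ℕ → BoundedContinuousFunction (ℝ × ℝ) (EuclideanSpace ℝ (Fin d))}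

theorem IsPartialSystem.hasDerivAt_circle (hW : IsPartialSystem k l W) {i j : ℕ} (hi : i < k)
    (hj : j + 1 < l) (t θ : ℝ) : HasDerivAt (fun η => W i j (t, η)) (W i (j + 1) (t, θ)) θ := by
  have hc : Continuous fun η => W i (j + 1) (t, η) :=
    (W i (j + 1)).continuous.comp (by fun_prop)
  have h := (hc.integral_hasStrictDerivAt 0 θ).hasDerivAt.const_add (W i j (t, 0))
  exact h.congr_of_eventuallyEq (Eventually.of_forall fun η => hW.circle i hi j hj t η)

theorem IsPartialSystem.hasDerivWithinAt_time (hW : IsPartialSystem k l W) {i j : ℕ}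
    (hi : i + 1 < k) (hj : j < l) {t : ℝ} (ht : t ∈ Icc (0 : ℝ) 1) (θ : ℝ) :
    HasDerivWithinAt (fun s => W i j (s, θ)) (W (i + 1) j (t, θ)) (Icc 0 1) t := by
  have hc : Continuous fun s => W (i + 1) j (s, θ) :=
    (W (i + 1) j).continuous.comp (by fun_prop)
  have h := ((hc.integral_hasStrictDerivAt 0 t).hasDerivAt.const_add (W i j (0, θ))).hasDerivWithinAt
    (s := Icc 0 1)
  exact h.congr (fun s hs => hW.time i hi j hj s hs θ) (hW.time i hi j hj t ht θ)

theorem IsPartialSystem.iteratedDeriv_eq (hW : IsPartialSystem k l W) {i j : ℕ} (hi : i < k)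
    (hj : j < l) (t : ℝ) : iteratedDeriv j (fun η => W i 0 (t, η)) = fun η => W i j (t, η) := by
  induction j with
  | zero => simp
  | succ j ih =>
    rw [iteratedDeriv_succ, ih (by omega)]
    ext1 θ
    exact (hW.hasDerivAt_circle hi hj t θ).deriv

theorem IsPartialSystem.iteratedDerivWithin_eq (hW : IsPartialSystem k l W) {i j : ℕ} (hi : i < k)
    (hj : j < l) (θ : ℝ) : ∀ t ∈ Icc (0 : ℝ) 1,
      iteratedDerivWithin i (fun s => W 0 j (s, θ)) (Icc 0 1) t = W i j (t, θ) := by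
  induction i with
  | zero => simp
  | succ i ih =>
    intro t ht
    rw [iteratedDerivWithin_succ, derivWithin_congr (ih (by omega)) (ih (by omega) t ht)]
    exact (hW.hasDerivWithinAt_time hi hj ht θ).derivWithin (uniqueDiffOn_Icc zero_lt_one t ht)

theorem IsPartialSystem.cylPartial_eq (hW : IsPartialSystem k l W) {i j : ℕ} (hi : i < k)
    (hj : j < l) {t : ℝ} (ht : t ∈ Icc (0 : ℝ) 1) (θ : ℝ) :
    cylPartial i j (fun t θ => W 0 0 (t, θ)) t θ = W i j (t, θ) := by
  rw [cylPartial]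
  simp only [hW.iteratedDeriv_eq (by omega : 0 < k) hj]
  exact hW.iteratedDerivWithin_eq hi hj θ t ht

theorem IsPartialSystem.isMixedC (hW : IsPartialSystem k l W) {i j : ℕ} (hi : i < k) (hj : j < l) :
    IsMixedC i j fun t θ => W 0 0 (t, θ) := by
  have hcirc := fun m (hm : m < l) t => hW.iteratedDeriv_eq (by omega : 0 < k) hm t
  refine ⟨fun t _ θ => hW.periodic 0 (by omega) 0 (by omega) t θ, fun t _ => ?_, fun m hm θ => ?_,
    fun a ha b hb => ?_⟩
  · refine contDiff_nat_iff_iteratedDeriv.2 ⟨fun m hm => ?_, fun m hm => ?_⟩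
    · rw [hcirc m (by omega)]
      exact (W 0 m).continuous.comp (by fun_prop)
    · rw [hcirc m (by omega)]
      exact fun θ => (hW.hasDerivAt_circle (by omega) (by omega) t θ).differentiableAt
  · simp only [hcirc m (by omega)]
    refine contDiffOn_of_continuousOn_differentiableOn_deriv (fun a ha => ?_) (fun a ha => ?_)
    · have ha : a ≤ i := by exact_mod_cast ha
      refine ContinuousOn.congr (f := fun s => W a m (s, θ)) ?_
        (hW.iteratedDerivWithin_eq (by omega) (by omega) θ)
      exact ((W a m).continuous.comp (by fun_prop)).continuousOn
    · have ha : a < i := by exact_mod_cast ha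
      refine DifferentiableOn.congr (f := fun s => W a m (s, θ)) ?_
        (hW.iteratedDerivWithin_eq (by omega) (by omega) θ)
      exact fun t ht =>
        (hW.hasDerivWithinAt_time (by omega) (by omega) ht θ).differentiableWithinAt
  · refine ContinuousOn.congr (f := W a b) (W a b).continuous.continuousOn fun p hp => ?_
    exact hW.cylPartial_eq (by omega) (by omega) hp.1 p.2

end

theorem IsPartialSystem.isMixedCRep {k l : ℕ}
    {W : ℕ → ℕ → BoundedContinuousFunction (ℝ × ℝ) (EuclideanSpace ℝ (Fin d))}
    (hW : IsPartialSystem k l W) {f : CylL2 d} (hf : HasCylWeakDeriv 0 0 f (contL2 d (W 0 0)))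
    {i j : ℕ} (hi : i < k) (hj : j < l) : IsMixedCRep i j f fun t θ => W 0 0 (t, θ) := by
  refine ⟨hW.isMixedC hi hj, ?_⟩
  have h0 : HasCylWeakDeriv 0 0 f f := fun φ _ => by
    rw [add_zero, pow_zero, one_smul]; rfl
  rw [h0.unique hf]
  exact coeFn_contL2 _

theorem IsMixedC.continuousOn_zero {k l : ℕ} {u : ℝ → ℝ → EuclideanSpace ℝ (Fin d)}
    (hu : IsMixedC k l u) : ContinuousOn (fun p : ℝ × ℝ => u p.1 p.2) (Icc 0 1 ×ˢ univ) := by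
  have := hu.continuousOn 0 (Nat.zero_le k) 0 (Nat.zero_le l)
  simpa [cylPartial] using this

/-- The derivatives of a continuous representative are determined on `[0,1] × S¹`. -/
theorem IsMixedCRep.cylPartial_eq {k l k' l' : ℕ} {f : CylL2 d}
    {u v : ℝ → ℝ → EuclideanSpace ℝ (Fin d)} (hu : IsMixedCRep k l f u) (hv : IsMixedCRep k' l' f v)
    (i j : ℕ) {t : ℝ} (ht : t ∈ Icc (0 : ℝ) 1) (θ : ℝ) : cylPartial i j u t θ = cylPartial i j v t θ := by
  have hae := hu.2.symm.trans hv.2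
  have hcl : Icc (0 : ℝ) 1 ×ˢ Ioc (0 : ℝ) (2 * Real.pi)
      ⊆ closure (interior (Icc (0 : ℝ) 1 ×ˢ Ioc (0 : ℝ) (2 * Real.pi))) := by
    rw [interior_prod_eq, closure_prod_eq, interior_Icc, interior_Ioc,
      closure_Ioo zero_ne_one, closure_Ioo Real.two_pi_pos.ne]
    exact prod_mono le_rfl Ioc_subset_Icc_self
  have heq := Measure.eqOn_of_ae_eq hae (hu.1.continuousOn_zero.mono (prod_mono le_rfl (subset_univ _)))
    (hv.1.continuousOn_zero.mono (prod_mono le_rfl (subset_univ _))) hcl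
  have hall : ∀ s ∈ Icc (0 : ℝ) 1, u s = v s := by
    intro s hs
    have pu : Function.Periodic (u s) (2 * Real.pi) := hu.1.periodic s hs
    have pv : Function.Periodic (v s) (2 * Real.pi) := hv.1.periodic s hs
    ext1 η
    have hη := toIocMod_mem_Ioc Real.two_pi_pos 0 η
    rw [zero_add] at hη
    have := @heq (s, toIocMod Real.two_pi_pos 0 η) ⟨hs, hη⟩
    simp only at this
    rw [toIocMod, pu.sub_zsmul_eq, pv.sub_zsmul_eq] at this
    exact this
  refine iteratedDerivWithin_congr (fun s hs => ?_) ht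
  simp only [hall s hs]

end


/-! ### Density of splines -/

theorem memLp_splineSum {x : ℕ → ℝ} (hx : Monotone x) (q m : ℕ) (c : ℕ → ℝ) {μ : Measure ℝ}
    [IsFiniteMeasure μ] : MemLp (splineSum x q m c) 2 μ := by
  refine MemLp.of_bound (measurable_splineSum x q m c).aestronglyMeasurable
    (∑ i ∈ Finset.range q, |c i| * 2 ^ m) (ae_of_all _ fun s => ?_)
  refine (Finset.abs_sum_le_sum_abs _ _).trans (Finset.sum_le_sum fun i _ => ?_)
  rw [abs_mul, abs_of_nonneg (bspline_nonneg hx m i s)]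
  exact mul_le_mul_of_nonneg_left (bspline_le hx m i s) (abs_nonneg _)

theorem exists_timeProfile_spline {n N k : ℕ} (hN : 1 ≤ N) (hk : k ≤ n) (c : ℕ → ℝ) :
    ∃ A, TimeProfile k A ∧
      ∀ t ∈ Ico (0 : ℝ) 1, A 0 t = splineSum (timeKnot n N) (n + N) n c t := by
  obtain ⟨A, e, hA, hAk, h0⟩ := exists_primChain_of_timeSpline hN (n - k) k (n := n) (by omega) c
  rw [Nat.sub_add_cancel hk] at h0
  exact ⟨A, ⟨hA, hAk ▸ memLp_splineSum (monotone_timeKnot n hN) _ _ _⟩, h0⟩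

theorem circleProfile_spline {n N l : ℕ} (hN : 1 ≤ N) (hl : l ≤ n) {c : ℕ → ℝ}
    (hc : ∀ j, c (j + N) = c j) :
    CircleProfile l fun i => splineSum (circleKnot n N) (n + N + 1) (n - i) ((circleDeriv N)^[i] c) :=
  ⟨primChain_circleSpline hN hl hc, memLp_splineSum (strictMono_circleKnot n hN).monotone _ _ _,
    fun i _ => splineSum_circleKnot_two_pi hN (Nat.sub_le n i) (circleDeriv_periodic hc i)⟩

section
variable {d k l : ℕ}

theorem ae_mem_Ico : ∀ᵐ p ∂cylMeasure, p.1 ∈ Ico (0 : ℝ) 1 ∧ p.2 ∈ Ico (0 : ℝ) (2 * Real.pi) := by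
  rw [cylMeasure_eq_prod, timeMeasure, circleMeasure,
    Measure.restrict_congr_set (Ico_ae_eq_Ioc (a := (0 : ℝ)) (b := 1)).symm,
    Measure.restrict_congr_set (Ico_ae_eq_Ioc (a := (0 : ℝ)) (b := 2 * Real.pi)).symm,
    Measure.prod_restrict]
  exact ae_restrict_mem (measurableSet_Ico.prod measurableSet_Ico)

theorem coeFn_sum_cylL2 {ι : Type*} (s : Finset ι) (f : ι → CylL2 d) :
    ⇑(∑ i ∈ s, f i) =ᵐ[cylMeasure] fun p => ∑ i ∈ s, f i p := by
  classical
  induction s using Finset.induction_on with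
  | empty =>
    filter_upwards [Lp.coeFn_zero (EuclideanSpace ℝ (Fin d)) 2 cylMeasure] with p hp
    simpa using hp
  | insert i s hi ih =>
    rw [Finset.sum_insert hi]
    filter_upwards [Lp.coeFn_add (f i) (∑ i ∈ s, f i), ih] with p hp hp'
    rw [hp, Pi.add_apply, hp', Finset.sum_insert hi]

theorem toSobolev_bspline {nt nθ Nt Nθ : ℕ} (hNt : 1 ≤ Nt) (hNθ : 1 ≤ Nθ) (hk : k ≤ nt)
    (hl : l ≤ nθ) {i j : ℕ} (hi : i < nt + Nt) (hj : j < Nθ) (e : EuclideanSpace ℝ (Fin d)) :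
    sobolevFun (toSobolev k l fun p => (timeSpline nt Nt i p.1 * circleSpline nθ Nθ j p.2) • e)
      =ᵐ[cylMeasure] fun p => (timeSpline nt Nt i p.1 * circleSpline nθ Nθ j p.2) • e := by
  obtain ⟨A, hA, hA0⟩ := exists_timeProfile_spline hNt hk (Pi.single i 1)
  let b : ℕ → ℝ := fun m => if m % Nθ = j then 1 else 0
  have hper : ∀ m, b (m + Nθ) = b m := fun m => by simp [b]
  have hB := circleProfile_spline hNθ hl hper
  have h : sobolevFun (tensorElement hA hB e) =ᵐ[cylMeasure]
      fun p => (timeSpline nt Nt i p.1 * circleSpline nθ Nθ j p.2) • e := by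
    filter_upwards [tensorElement_zero hA hB e, ae_mem_Ico] with p hp hp'
    refine hp.trans ?_
    rw [hA0 _ hp'.1]
    simp only [Function.iterate_zero, id, Nat.sub_zero]
    rw [← sum_circleSpline hNθ hper hp'.2, splineSum]
    have e1 : ∑ m ∈ Finset.range (nt + Nt), (Pi.single i (1 : ℝ) : ℕ → ℝ) m
        * bspline (timeKnot nt Nt) nt m p.1 = timeSpline nt Nt i p.1 := by
      rw [Finset.sum_eq_single i]
      · simp [timeSpline]
      · intro b _ hb; simp [hb]
      · intro h; exact (h (Finset.mem_range.2 hi)).elim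
    have e2 : ∑ m ∈ Finset.range Nθ, b m * circleSpline nθ Nθ m p.2
        = circleSpline nθ Nθ j p.2 := by
      rw [Finset.sum_eq_single j]
      · simp [b, Nat.mod_eq_of_lt hj]
      · intro m hm hm'
        simp only [b]
        rw [Nat.mod_eq_of_lt (Finset.mem_range.1 hm), if_neg hm', zero_mul]
      · intro h; exact (h (Finset.mem_range.2 hj)).elim
    rw [e1, e2]
  rw [toSobolev_eq h]
  exact h

/-- Products of splines belong to the spline space. -/
theorem mem_splineSpace {nt nθ Nt Nθ : ℕ} (hNt : 1 ≤ Nt) (hNθ : 1 ≤ Nθ) (hk : k ≤ nt)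
    (hl : l ≤ nθ) {a b : ℕ → ℝ} (hb : ∀ j, b (j + Nθ) = b j) (r : Fin d) {x : mixedSobolev d k l}
    (hx : sobolevFun x =ᵐ[cylMeasure] fun p =>
      (splineSum (timeKnot nt Nt) (nt + Nt) nt a p.1 *
        splineSum (circleKnot nθ Nθ) (nθ + Nθ + 1) nθ b p.2) • EuclideanSpace.single r (1 : ℝ)) :
    x ∈ splineSpace d k l nt nθ Nt Nθ := by
  let g : ℕ × ℕ → mixedSobolev d k l := fun q => toSobolev k l fun p =>
    (timeSpline nt Nt q.1 p.1 * circleSpline nθ Nθ q.2 p.2) • EuclideanSpace.single r 1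
  let s := Finset.range (nt + Nt) ×ˢ Finset.range Nθ
  have hmem : ∑ q ∈ s, (a q.1 * b q.2) • g q ∈ splineSpace d k l nt nθ Nt Nθ := by
    refine Submodule.sum_mem _ fun q hq => Submodule.smul_mem _ _ (Submodule.subset_span ?_)
    have hq' := Finset.mem_product.1 hq
    exact ⟨(⟨q.1, Finset.mem_range.1 hq'.1⟩, ⟨q.2, Finset.mem_range.1 hq'.2⟩, r), rfl⟩
  suffices h : x = ∑ q ∈ s, (a q.1 * b q.2) • g q by rw [h]; exact hmem
  refine sobolevFun_injective d k l (Lp.ext (hx.trans ?_))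
  let F : mixedSobolev d k l →ₗ[ℝ] CylL2 d :=
    { toFun := sobolevFun, map_add' := fun _ _ => rfl, map_smul' := fun _ _ => rfl }
  have hF : sobolevFun (∑ q ∈ s, (a q.1 * b q.2) • g q)
      = ∑ q ∈ s, (a q.1 * b q.2) • sobolevFun (g q) := by
    change F _ = _
    rw [map_sum]
    rfl
  rw [hF]
  have hg : ∀ q ∈ s, ∀ᵐ p ∂cylMeasure, ((a q.1 * b q.2) • sobolevFun (g q)) p
      = (a q.1 * b q.2) • (timeSpline nt Nt q.1 p.1 * circleSpline nθ Nθ q.2 p.2) •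
        (EuclideanSpace.single r 1 : EuclideanSpace ℝ (Fin d)) := by
    intro q hq
    have hq' := Finset.mem_product.1 hq
    filter_upwards [Lp.coeFn_smul (a q.1 * b q.2) (sobolevFun (g q)),
      toSobolev_bspline hNt hNθ hk hl (Finset.mem_range.1 hq'.1) (Finset.mem_range.1 hq'.2)
        (EuclideanSpace.single r 1 : EuclideanSpace ℝ (Fin d))] with p hp hp'
    rw [hp, Pi.smul_apply, hp']
  filter_upwards [coeFn_sum_cylL2 s fun q => (a q.1 * b q.2) • sobolevFun (g q),
    (Filter.eventually_all_finset s).2 hg, ae_mem_Ico] with p h1 h2 h3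
  rw [h1, Finset.sum_congr rfl h2, ← sum_circleSpline hNθ hb h3.2, splineSum, Finset.sum_mul_sum,
    ← Finset.sum_product', Finset.sum_smul]
  refine Finset.sum_congr rfl fun q _ => ?_
  rw [smul_smul, timeSpline]
  congr 1
  ring

theorem norm_tensorL2 {a b : ℝ → ℝ} (ha : MemLp a 2 timeMeasure) (hb : MemLp b 2 circleMeasure)
    (e : EuclideanSpace ℝ (Fin d)) : ‖tensorL2 ha hb e‖
      = (eLpNorm a 2 timeMeasure).toReal * (eLpNorm b 2 circleMeasure).toReal * ‖e‖ := by
  rw [tensorL2, Lp.norm_toLp]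
  have h1 : eLpNorm (fun p : ℝ × ℝ => (a p.1 * b p.2) • e) 2 cylMeasure
      = eLpNorm a 2 timeMeasure * eLpNorm b 2 circleMeasure * ‖e‖ₑ := by
    have e1 : ∀ p : ℝ × ℝ, ‖(a p.1 * b p.2) • e‖ = ‖‖e‖ • (a p.1 * b p.2)‖ := by
      intro p; rw [norm_smul, norm_smul, norm_norm, mul_comm]
    rw [eLpNorm_congr_norm_ae (ae_of_all _ e1)]
    have := eLpNorm_const_smul (‖e‖) (fun p : ℝ × ℝ => a p.1 * b p.2) 2 cylMeasure
    rw [show (fun p : ℝ × ℝ => ‖e‖ • (a p.1 * b p.2)) = ‖e‖ • fun p : ℝ × ℝ => a p.1 * b p.2 from rfl,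
      this, enorm_norm, mul_comm]
    congr 1
    rw [eLpNorm_eq_lintegral_rpow_enorm_toReal (by simp) (by simp),
      eLpNorm_eq_lintegral_rpow_enorm_toReal (by simp) (by simp),
      eLpNorm_eq_lintegral_rpow_enorm_toReal (by simp) (by simp),
      ← ENNReal.mul_rpow_of_nonneg _ _ (by simp), cylMeasure_eq_prod,
      ← lintegral_prod_mul (ha.1.enorm.pow_const _) (hb.1.enorm.pow_const _)]
    congr 2
    ext p
    rw [enorm_mul, ENNReal.mul_rpow_of_nonneg _ _ (by simp)]
  rw [h1, ENNReal.toReal_mul, ENNReal.toReal_mul, toReal_enorm]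

theorem toReal_eLpNorm_sub_le {μ : Measure ℝ} {a a' : ℝ → ℝ} (ha : MemLp a 2 μ)
    (ha' : MemLp a' 2 μ) :
    (eLpNorm a' 2 μ).toReal ≤ (eLpNorm a 2 μ).toReal + (eLpNorm (fun s => a s - a' s) 2 μ).toReal := by
  have h := norm_le_norm_add_norm_sub' (ha'.toLp a') (ha.toLp a)
  have e : ‖ha.toLp a - ha'.toLp a'‖ = (eLpNorm (fun s => a s - a' s) 2 μ).toReal := by
    rw [← MemLp.toLp_sub, Lp.norm_toLp]; rfl
  rw [norm_sub_rev, e, Lp.norm_toLp, Lp.norm_toLp] at h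
  exact h

theorem norm_tensorL2_sub_le {a b a' b' : ℝ → ℝ} (ha : MemLp a 2 timeMeasure)
    (hb : MemLp b 2 circleMeasure) (ha' : MemLp a' 2 timeMeasure) (hb' : MemLp b' 2 circleMeasure)
    {e : EuclideanSpace ℝ (Fin d)} (he : ‖e‖ ≤ 1) {δ : ℝ}
    (h1 : (eLpNorm (fun s => a s - a' s) 2 timeMeasure).toReal ≤ δ)
    (h2 : (eLpNorm (fun s => b s - b' s) 2 circleMeasure).toReal ≤ δ) :
    ‖tensorL2 ha hb e - tensorL2 ha' hb' e‖ ≤ δ * ((eLpNorm a 2 timeMeasure).toReal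
      + (eLpNorm b 2 circleMeasure).toReal + δ) := by
  have hs : tensorL2 ha hb e - tensorL2 ha' hb' e
      = tensorL2 (ha.sub ha') hb e + tensorL2 ha' (hb.sub hb') e := by
    refine Lp.ext ?_
    filter_upwards [Lp.coeFn_sub (tensorL2 ha hb e) (tensorL2 ha' hb' e),
      Lp.coeFn_add (tensorL2 (ha.sub ha') hb e) (tensorL2 ha' (hb.sub hb') e),
      coeFn_tensorL2 ha hb e, coeFn_tensorL2 ha' hb' e, coeFn_tensorL2 (ha.sub ha') hb e,
      coeFn_tensorL2 ha' (hb.sub hb') e] with p h1 h2 h3 h4 h5 h6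
    rw [h1, h2, Pi.sub_apply, Pi.add_apply, h3, h4, h5, h6, ← sub_smul, ← add_smul]
    congr 1
    simp only [Pi.sub_apply]
    ring
  rw [hs]
  refine (norm_add_le _ _).trans ?_
  rw [norm_tensorL2, norm_tensorL2]
  have h3 := toReal_eLpNorm_sub_le ha ha'
  have h1' : (eLpNorm (a - a') 2 timeMeasure).toReal ≤ δ := h1
  have h2' : (eLpNorm (b - b') 2 circleMeasure).toReal ≤ δ := h2
  have hδ : 0 ≤ δ := ENNReal.toReal_nonneg.trans h1
  have p1 := mul_le_mul h1' (le_refl (eLpNorm b 2 circleMeasure).toReal) ENNReal.toReal_nonneg hδ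
  have p2 := mul_le_mul h3 h2' ENNReal.toReal_nonneg (by positivity)
  have q1 := mul_le_of_le_one_right (mul_nonneg (ENNReal.toReal_nonneg (a := eLpNorm (a - a') 2
    timeMeasure)) (ENNReal.toReal_nonneg (a := eLpNorm b 2 circleMeasure))) he
  have q2 := mul_le_of_le_one_right (mul_nonneg (ENNReal.toReal_nonneg (a := eLpNorm a' 2
    timeMeasure)) (ENNReal.toReal_nonneg (a := eLpNorm (b - b') 2 circleMeasure))) he
  have p3 := mul_le_mul_of_nonneg_right (add_le_add_right h1 (eLpNorm a 2 timeMeasure).toReal) hδ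
  nlinarith [p1, p2, q1, q2, p3]

theorem norm_tensorElement_sub_le {A A' B B' : ℕ → ℝ → ℝ} (hA : TimeProfile k A)
    (hB : CircleProfile l B) (hA' : TimeProfile k A') (hB' : CircleProfile l B')
    {e : EuclideanSpace ℝ (Fin d)} (he : ‖e‖ ≤ 1) {δ K : ℝ} (hδ : δ ≤ 1)
    (hK : ∀ i ∈ ({0, k} : Set ℕ), (eLpNorm (A i) 2 timeMeasure).toReal ≤ K)
    (hK' : ∀ j ∈ ({0, l} : Set ℕ), (eLpNorm (B j) 2 circleMeasure).toReal ≤ K)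
    (h1 : ∀ i ∈ ({0, k} : Set ℕ), (eLpNorm (fun s => A i s - A' i s) 2 timeMeasure).toReal ≤ δ)
    (h2 : ∀ j ∈ ({0, l} : Set ℕ), (eLpNorm (fun s => B j s - B' j s) 2 circleMeasure).toReal ≤ δ) :
    ‖tensorElement hA hB e - tensorElement hA' hB' e‖ ≤ 4 * (δ * (K + K + 1)) := by
  have hδ0 : 0 ≤ δ := ENNReal.toReal_nonneg.trans (h1 0 (by simp))
  have key : ∀ {i j : ℕ} (_ : i ∈ ({0, k} : Set ℕ)) (_ : j ∈ ({0, l} : Set ℕ))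
      (m1 : MemLp (A i) 2 timeMeasure) (m2 : MemLp (B j) 2 circleMeasure)
      (m3 : MemLp (A' i) 2 timeMeasure) (m4 : MemLp (B' j) 2 circleMeasure),
      ‖tensorL2 m1 m2 e - tensorL2 m3 m4 e‖ ≤ δ * (K + K + 1) := by
    intro i j hi hj m1 m2 m3 m4
    refine (norm_tensorL2_sub_le m1 m2 m3 m4 he (h1 i hi) (h2 j hj)).trans ?_
    gcongr
    · exact hK i hi
    · exact hK' j hj
  have hb : ∀ q : Fin 4, ‖(tensorElement hA hB e - tensorElement hA' hB' e).1 q‖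
      ≤ δ * (K + K + 1) := by
    intro q
    fin_cases q
    · exact key (i := 0) (j := 0) (by simp) (by simp) (hA.memLp (Nat.zero_le k))
        (hB.memLp (Nat.zero_le l)) (hA'.memLp (Nat.zero_le k)) (hB'.memLp (Nat.zero_le l))
    · exact key (i := k) (j := 0) (by simp) (by simp) hA.memLp_top
        (hB.memLp (Nat.zero_le l)) hA'.memLp_top (hB'.memLp (Nat.zero_le l))
    · exact key (i := 0) (j := l) (by simp) (by simp) (hA.memLp (Nat.zero_le k))
        hB.memLp_top (hA'.memLp (Nat.zero_le k)) hB'.memLp_top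
    · exact key (i := k) (j := l) (by simp) (by simp) hA.memLp_top hB.memLp_top hA'.memLp_top
        hB'.memLp_top
  have hnn : 0 ≤ δ * (K + K + 1) := (norm_nonneg _).trans (hb 0)
  rw [← Submodule.norm_coe, PiLp.norm_eq_of_L2]
  refine Real.sqrt_le_iff.2 ⟨by positivity, ?_⟩
  have := Finset.sum_le_sum fun q (_ : q ∈ (Finset.univ : Finset (Fin 4))) =>
    pow_le_pow_left₀ (norm_nonneg _) (hb q) 2
  refine this.trans ?_
  simp only [Finset.sum_const, Finset.card_univ, Fintype.card_fin, nsmul_eq_mul]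
  push_cast
  nlinarith [sq_nonneg (δ * (K + K + 1))]

/-- Splines approximate every tensor product with a trigonometric function in `θ`. -/
theorem eventually_exists_spline {nt nθ : ℕ} (hk0 : 0 < k) (hk : k ≤ nt) (hl : l ≤ nθ)
    {A : ℕ → ℝ → ℝ} (hA : TimeProfile k A) (ν : ℕ) (φ : ℝ) (r : Fin d) {ε : ℝ} (hε : 0 < ε) :
    ∀ᶠ N : ℕ × ℕ in atTop ×ˢ atTop, ∃ y ∈ splineSpace d k l nt nθ N.1 N.2,
      ‖tensorElement hA (circleProfile_trig l ν φ) (EuclideanSpace.single r 1) - y‖ ≤ ε := by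
  have hB := circleProfile_trig l ν φ
  obtain ⟨K, hK0, hK, hK'⟩ : ∃ K : ℝ, 0 ≤ K ∧
      (∀ i ∈ ({0, k} : Set ℕ), (eLpNorm (A i) 2 timeMeasure).toReal ≤ K) ∧
      ∀ j ∈ ({0, l} : Set ℕ), (eLpNorm (trig ν φ j) 2 circleMeasure).toReal ≤ K := by
    have n1 := ENNReal.toReal_nonneg (a := eLpNorm (A 0) 2 timeMeasure)
    have n2 := ENNReal.toReal_nonneg (a := eLpNorm (A k) 2 timeMeasure)
    have n3 := ENNReal.toReal_nonneg (a := eLpNorm (trig ν φ 0) 2 circleMeasure)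
    have n4 := ENNReal.toReal_nonneg (a := eLpNorm (trig ν φ l) 2 circleMeasure)
    refine ⟨(eLpNorm (A 0) 2 timeMeasure).toReal + (eLpNorm (A k) 2 timeMeasure).toReal
      + (eLpNorm (trig ν φ 0) 2 circleMeasure).toReal
      + (eLpNorm (trig ν φ l) 2 circleMeasure).toReal, by positivity, ?_, ?_⟩ <;>
    · rintro i (rfl | rfl) <;> linarith
  set δ := min 1 (ε / (4 * (K + K + 1))) with hδ
  have hδ0 : 0 < δ := by positivity
  have hδε : 4 * (δ * (K + K + 1)) ≤ ε := by
    have : δ ≤ ε / (4 * (K + K + 1)) := min_le_right _ _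
    rw [le_div_iff₀ (by positivity)] at this
    linarith
  -- uniform closeness implies closeness in `L²`
  have hsup : ∀ {T : ℝ} (_ : 0 < T) {η : ℝ} (_ : 0 < η), ∃ κ : ℝ, 0 < κ ∧ ∀ f : ℝ → ℝ,
      (∀ s ∈ Icc 0 T, |f s| ≤ κ) → (eLpNorm f 2 (volume.restrict (Ioc 0 T))).toReal ≤ η := by
    intro T hT η hη
    have hm : (volume.restrict (Ioc 0 T)) univ ≠ ⊤ := by simp
    set C := ((volume.restrict (Ioc 0 T)) univ ^ ((2 : ENNReal).toReal)⁻¹).toReal with hC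
    have hC0 : 0 ≤ C := ENNReal.toReal_nonneg
    refine ⟨η / (C + 1), by positivity, fun f hf => ?_⟩
    have h := eLpNorm_le_of_ae_bound (μ := volume.restrict (Ioc 0 T)) (p := 2) (f := f)
      (C := η / (C + 1)) (by
        filter_upwards [ae_restrict_mem measurableSet_Ioc] with s hs
        exact hf s (Ioc_subset_Icc_self hs))
    have h' := ENNReal.toReal_mono (ENNReal.mul_ne_top
      (ENNReal.rpow_ne_top_of_nonneg (by simp) hm) ENNReal.ofReal_ne_top) h
    rw [ENNReal.toReal_mul, ENNReal.toReal_ofReal (by positivity), ← hC] at h'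
    refine h'.trans ?_
    rw [mul_div_assoc', div_le_iff₀ (by positivity)]
    nlinarith
  obtain ⟨κ₁, hκ₁, hs₁⟩ := hsup zero_lt_one hδ0
  obtain ⟨κ₂, hκ₂, hs₂⟩ := hsup Real.two_pi_pos hδ0
  have ht := exists_timeSpline_approx hk0 hk hA.chain hA.memLp_top (lt_min hκ₁ hδ0)
  have hθ0 := exists_circleSpline_approx ν φ (Nat.zero_le nθ) hκ₂
  have hθl := exists_circleSpline_approx ν φ hl hκ₂
  filter_upwards [(ht.and (eventually_ge_atTop 1)).prod_mk
    ((hθ0.and hθl).and (eventually_ge_atTop 1))] with N hN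
  obtain ⟨⟨⟨A', c, hA', hA'm, hA'0, hA'k, hA's⟩, hN1⟩, ⟨h0, hl'⟩, hN2⟩ := hN
  have hAp : TimeProfile k A' := ⟨hA', hA'm⟩
  set b : ℕ → ℝ := fun j => Real.cos (ν * circleKnot nθ N.2 j + φ) with hb
  have hper : ∀ j, b (j + N.2) = b j := fun j => by
    simp only [hb]
    rw [circleKnot_add_period nθ hN2 j, mul_add, add_right_comm, Real.cos_add_nat_mul_two_pi]
  have hBp := circleProfile_spline hN2 hl hper
  refine ⟨tensorElement hAp hBp (EuclideanSpace.single r 1), ?_, ?_⟩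
  · refine mem_splineSpace hN1 hN2 hk hl (a := c) hper r ?_
    filter_upwards [tensorElement_zero hAp hBp (EuclideanSpace.single r 1 : EuclideanSpace ℝ (Fin d)),
      ae_mem_Ico] with p hp hp'
    refine hp.trans ?_
    rw [hA'0 _ hp'.1]
    rfl
  · refine (norm_tensorElement_sub_le hA hB hAp hBp (by simp) (min_le_left _ _) hK hK' ?_ ?_).trans hδε
    · rintro i (rfl | rfl)
      · exact hs₁ _ fun s hs => (hA's s hs).trans (min_le_left _ _)
      · refine (ENNReal.toReal_mono ENNReal.ofReal_ne_top hA'k).trans ?_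
        rw [ENNReal.toReal_ofReal (lt_min hκ₁ hδ0).le]
        exact min_le_right _ _
    · rintro j (rfl | rfl)
      · exact hs₂ _ fun s hs => by rw [abs_sub_comm]; exact h0 s hs
      · exact hs₂ _ fun s hs => by rw [abs_sub_comm]; exact hl' s hs

/-- The spline approximations converge in `H^{k,ℓ}`. -/
theorem tendsto_splineProjection {nt nθ : ℕ} (hk0 : 0 < k) (hk : k ≤ nt) (hl : l ≤ nθ)
    (c : mixedSobolev d k l) :
    Tendsto (fun N : ℕ × ℕ => splineProjection nt nθ N.1 N.2 c) (atTop ×ˢ atTop) (𝓝 c) := by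
  have hmin : ∀ (N : ℕ × ℕ) (x : mixedSobolev d k l), ∀ y ∈ splineSpace d k l nt nθ N.1 N.2,
      ‖x - splineProjection nt nθ N.1 N.2 x‖ ≤ ‖x - y‖ := by
    intro N x y hy
    rw [splineProjection, Submodule.starProjection_minimal]
    exact ciInf_le ⟨0, by rintro _ ⟨z, rfl⟩; exact norm_nonneg _⟩ (⟨y, hy⟩ : splineSpace d k l nt nθ N.1 N.2)
  let V : Submodule ℝ (mixedSobolev d k l) :=
    { carrier := {x | Tendsto (fun N : ℕ × ℕ => splineProjection nt nθ N.1 N.2 x)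
        (atTop ×ˢ atTop) (𝓝 x)}
      zero_mem' := by simp [splineProjection]
      add_mem' := fun {x y} hx hy => by
        simp only [mem_ofPred_eq, splineProjection, map_add] at hx hy ⊢
        exact hx.add hy
      smul_mem' := fun r x hx => by
        simp only [mem_ofPred_eq, splineProjection, map_smul] at hx ⊢
        exact hx.const_smul r }
  have hV : IsClosed (V : Set (mixedSobolev d k l)) := by
    refine isClosed_of_closure_subset fun x hx => ?_
    change Tendsto _ _ _
    rw [Metric.tendsto_nhds]
    intro ε hε
    obtain ⟨y, hy, hxy⟩ := Metric.mem_closure_iff.1 hx (ε / 2) (by positivity)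
    filter_upwards [Metric.tendsto_nhds.1 hy (ε / 2) (by positivity)] with N hN
    rw [dist_comm, dist_eq_norm]
    refine (hmin N x _ (Submodule.starProjection_apply_mem _ y)).trans_lt ?_
    rw [← dist_eq_norm]
    refine (dist_triangle x y _).trans_lt ?_
    rw [dist_comm] at hN
    have hN' : dist y ((splineSpace d k l nt nθ N.1 N.2).starProjection y) < ε / 2 := hN
    linarith
  have htop : V = ⊤ := mixedSobolev_eq_top hV fun A hA ν φ r => by
    change Tendsto _ _ _
    rw [Metric.tendsto_nhds]
    intro ε hε
    filter_upwards [eventually_exists_spline (d := d) hk0 hk hl hA ν φ r (half_pos hε)] with N hN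
    obtain ⟨y, hy, hy'⟩ := hN
    rw [dist_comm, dist_eq_norm]
    exact ((hmin N _ y hy).trans hy').trans_lt (half_lt_self hε)
  have : c ∈ V := htop ▸ Submodule.mem_top
  exact this

end


/-! ### Gauss–Legendre quadrature -/

theorem mem_gaussNodes {m : ℕ} {ξ : ℝ} : ξ ∈ gaussNodes m ↔ aeval ξ (shiftedLegendre m) = 0 := by
  have h0 : (shiftedLegendre m).map (Int.castRingHom ℝ) ≠ 0 := by
    rw [Ne, Polynomial.map_eq_zero_iff (RingHom.injective_int _)]
    intro h
    have := degree_shiftedLegendre m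
    rw [h, degree_zero] at this
    exact absurd this (by simp)
  rw [gaussNodes, Multiset.mem_toFinset, mem_roots h0, IsRoot, eval_map, aeval_def]
  rfl

theorem shiftedLegendre_pos {m : ℕ} {x : ℝ} (hx : x < 0) : 0 < aeval x (shiftedLegendre m) := by
  rw [shiftedLegendre, map_sum]
  refine Finset.sum_pos' (fun k hk => ?_) ⟨0, by simp, by simp⟩
  have : aeval x (C ((-1 : ℤ) ^ k * m.choose k * (m + k).choose m) * X ^ k)
      = (m.choose k : ℝ) * (m + k).choose m * (-x) ^ k := by
    rw [neg_pow x k]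
    simp
    ring
  rw [this]
  have : 0 < -x := by linarith
  positivity

theorem gaussNodes_subset {m : ℕ} {ξ : ℝ} (hξ : ξ ∈ gaussNodes m) : ξ ∈ Icc (0 : ℝ) 1 := by
  rw [mem_gaussNodes] at hξ
  constructor
  · by_contra! h
    exact (shiftedLegendre_pos h).ne' hξ
  · by_contra! h
    rw [shiftedLegendre_eval_symm] at hξ
    have h1 : (0 : ℝ) < aeval (1 - ξ) (shiftedLegendre m) := shiftedLegendre_pos (by linarith)
    exact h1.ne' ((mul_eq_zero.1 hξ).resolve_left (pow_ne_zero _ (by norm_num)))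

/-- A Legendre polynomial of positive degree has a zero, by Rodrigues' formula and Rolle's
theorem. -/
theorem gaussNodes_nonempty {m : ℕ} (hm : 1 ≤ m) : (gaussNodes m).Nonempty := by
  obtain ⟨n, rfl⟩ : ∃ n, m = n + 1 := ⟨m - 1, by omega⟩
  set Q : ℤ[X] := X ^ (n + 1) * (1 - (X : ℤ[X])) ^ (n + 1) with hQ
  set R := derivative^[n] Q with hR
  have hX : (X : ℤ[X]) ∣ R := by
    have := pow_sub_dvd_iterate_derivative_of_pow_dvd n (p := Q) (q := X) (Dvd.intro _ rfl)
    simpa using this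
  have hX' : (1 - X : ℤ[X]) ∣ R := by
    have := pow_sub_dvd_iterate_derivative_of_pow_dvd n (p := Q) (q := 1 - X)
      (Dvd.intro_left _ rfl)
    simpa using this
  have h0 : aeval (0 : ℝ) R = 0 := by obtain ⟨S, hS⟩ := hX; rw [hS]; simp
  have h1 : aeval (1 : ℝ) R = 0 := by obtain ⟨S, hS⟩ := hX'; rw [hS]; simp
  obtain ⟨ξ, -, hξ⟩ := exists_deriv_eq_zero (f := fun x : ℝ => aeval x R) zero_lt_one
    (R.continuous_aeval).continuousOn (h0.trans h1.symm)
  refine ⟨ξ, mem_gaussNodes.2 ?_⟩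
  rw [Polynomial.deriv_aeval] at hξ
  have h2 : derivative R = ((n + 1).factorial : ℤ[X]) * shiftedLegendre (n + 1) := by
    rw [factorial_mul_shiftedLegendre_eq, Function.iterate_succ_apply']
  rw [h2, map_mul] at hξ
  refine (mul_eq_zero.1 hξ).resolve_left ?_
  simpa using Nat.factorial_ne_zero (n + 1)

theorem sum_gaussWeight {m : ℕ} (hm : 1 ≤ m) : ∑ ξ ∈ gaussNodes m, gaussWeight m ξ = 1 := by
  simp only [gaussWeight]
  rw [← intervalIntegral.integral_finsetSum fun ξ _ =>
    (Polynomial.continuous _).intervalIntegrable _ _]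
  have h : ∀ x : ℝ, ∑ ξ ∈ gaussNodes m, (Lagrange.basis (gaussNodes m) id ξ).eval x = 1 := by
    intro x
    rw [← eval_finsetSum, Lagrange.sum_basis (injOn_id _) (gaussNodes_nonempty hm), eval_one]
  simp [h]

/-- The norm of the `m`-point Gauss–Legendre rule. -/
noncomputable def quadratureNorm (m : ℕ) : ℝ := ∑ ξ ∈ gaussNodes m, |gaussWeight m ξ|

theorem quadratureNorm_nonneg (m : ℕ) : 0 ≤ quadratureNorm m := Finset.sum_nonneg fun _ _ => abs_nonneg _

theorem gaussQuadrature_node_mem {m N i : ℕ} (hi : i < N) {a b : ℝ} (hab : a ≤ b) {ξ : ℝ}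
    (hξ : ξ ∈ gaussNodes m) : a + (b - a) * (i + ξ) / N ∈
      Icc (a + (b - a) * i / N) (a + (b - a) * (i + 1 : ℕ) / N) ∧
      Icc (a + (b - a) * i / N) (a + (b - a) * (i + 1 : ℕ) / N) ⊆ Icc a b := by
  obtain ⟨h0, h1⟩ := gaussNodes_subset hξ
  have hN : (0 : ℝ) < N := by exact_mod_cast (by omega : 0 < N)
  have hba : 0 ≤ b - a := sub_nonneg.2 hab
  have hiN : ((i + 1 : ℕ) : ℝ) ≤ N := by exact_mod_cast hi
  refine ⟨⟨?_, ?_⟩, Icc_subset_Icc ?_ ?_⟩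
  · gcongr; linarith
  · push_cast; gcongr
  · have : 0 ≤ (b - a) * i / N := by positivity
    linarith
  · have : (b - a) * (i + 1 : ℕ) / N ≤ b - a := by
      rw [div_le_iff₀ hN]; gcongr
    linarith

theorem abs_gaussQuadrature_sub_le {m N : ℕ} (hN : 1 ≤ N) {a b : ℝ} (hab : a ≤ b) {f g : ℝ → ℝ}
    {η : ℝ} (h : ∀ x ∈ Icc a b, |f x - g x| ≤ η) :
    |gaussQuadrature m N a b f - gaussQuadrature m N a b g| ≤ (b - a) * quadratureNorm m * η := by
  have hN' : (0 : ℝ) < N := by exact_mod_cast hN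
  have hba : 0 ≤ b - a := sub_nonneg.2 hab
  rw [gaussQuadrature, gaussQuadrature, ← Finset.sum_sub_distrib]
  have hi : ∀ i ∈ Finset.range N, |∑ ξ ∈ gaussNodes m,
      (b - a) / N * gaussWeight m ξ * f (a + (b - a) * (i + ξ) / N) - ∑ ξ ∈ gaussNodes m,
      (b - a) / N * gaussWeight m ξ * g (a + (b - a) * (i + ξ) / N)|
      ≤ (b - a) / N * quadratureNorm m * η := by
    intro i hi
    rw [← Finset.sum_sub_distrib, quadratureNorm, Finset.mul_sum, Finset.sum_mul]
    refine (Finset.abs_sum_le_sum_abs _ _).trans (Finset.sum_le_sum fun ξ hξ => ?_)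
    obtain ⟨h1, h2⟩ := gaussQuadrature_node_mem (Finset.mem_range.1 hi) hab hξ
    rw [← mul_sub, abs_mul, abs_mul, abs_of_nonneg (by positivity : 0 ≤ (b - a) / N)]
    gcongr
    exact h _ (h2 h1)
  refine (Finset.abs_sum_le_sum_abs _ _).trans ((Finset.sum_le_sum hi).trans_eq ?_)
  rw [Finset.sum_const, Finset.card_range, nsmul_eq_mul]
  field_simp

/-- The error of the composite rule is bounded by the oscillation of the integrand on intervals of
the mesh size. -/
theorem abs_gaussQuadrature_sub_integral_le {m N : ℕ} (hm : 1 ≤ m) (hN : 1 ≤ N) {a b : ℝ}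
    (hab : a ≤ b) {f : ℝ → ℝ} (hf : ContinuousOn f (Icc a b)) {η : ℝ}
    (h : ∀ x ∈ Icc a b, ∀ y ∈ Icc a b, |x - y| ≤ (b - a) / N → |f x - f y| ≤ η) :
    |gaussQuadrature m N a b f - ∫ x in a..b, f x| ≤ (b - a) * quadratureNorm m * η := by
  have hN' : (0 : ℝ) < N := by exact_mod_cast hN
  have hba : 0 ≤ b - a := sub_nonneg.2 hab
  set y : ℕ → ℝ := fun i => a + (b - a) * i / N with hy
  have hylen : ∀ i, y (i + 1) - y i = (b - a) / N := by
    intro i; simp only [hy]; push_cast; field_simp; ring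
  have hymono : ∀ i, y i ≤ y (i + 1) := fun i => by
    have := hylen i
    have : 0 ≤ (b - a) / N := by positivity
    linarith
  obtain ⟨ξ₀, hξ₀⟩ := gaussNodes_nonempty hm
  have hsub : ∀ i < N, Icc (y i) (y (i + 1)) ⊆ Icc a b := fun i hi =>
    (gaussQuadrature_node_mem hi hab hξ₀).2
  have hint : ∀ i < N, IntervalIntegrable f volume (y i) (y (i + 1)) := fun i hi =>
    ContinuousOn.intervalIntegrable (by rw [uIcc_of_le (hymono i)]; exact hf.mono (hsub i hi))
  have hsum := intervalIntegral.sum_integral_adjacent_intervals hint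
  have hy0 : y 0 = a := by simp [hy]
  have hyN : y N = b := by simp only [hy]; field_simp; ring
  rw [hy0, hyN] at hsum
  rw [← hsum, gaussQuadrature, ← Finset.sum_sub_distrib]
  have hi : ∀ i ∈ Finset.range N, |∑ ξ ∈ gaussNodes m,
      (b - a) / N * gaussWeight m ξ * f (a + (b - a) * (i + ξ) / N) - ∫ x in y i..y (i + 1), f x|
      ≤ (b - a) / N * quadratureNorm m * η := by
    intro i hi
    have hi' := Finset.mem_range.1 hi
    have e1 : ∫ x in y i..y (i + 1), f x
        = ∑ ξ ∈ gaussNodes m, gaussWeight m ξ * ∫ x in y i..y (i + 1), f x := by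
      rw [← Finset.sum_mul, sum_gaussWeight hm, one_mul]
    rw [e1, ← Finset.sum_sub_distrib, quadratureNorm, Finset.mul_sum, Finset.sum_mul]
    refine (Finset.abs_sum_le_sum_abs _ _).trans (Finset.sum_le_sum fun ξ hξ => ?_)
    obtain ⟨h1, h2⟩ := gaussQuadrature_node_mem hi' hab hξ
    set z := a + (b - a) * (i + ξ) / N with hz
    have e2 : (b - a) / N * gaussWeight m ξ * f z - gaussWeight m ξ * ∫ x in y i..y (i + 1), f x
        = gaussWeight m ξ * ∫ x in y i..y (i + 1), (f z - f x) := by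
      rw [intervalIntegral.integral_sub intervalIntegrable_const (hint i hi'),
        intervalIntegral.integral_const, hylen, smul_eq_mul]
      ring
    have e3 : |∫ x in y i..y (i + 1), (f z - f x)| ≤ η * |y (i + 1) - y i| := by
      refine (Real.norm_eq_abs _).symm.trans_le
        (intervalIntegral.norm_integral_le_of_norm_le_const fun x hx => ?_)
      rw [uIoc_of_le (hymono i)] at hx
      refine h z (h2 h1) x (h2 (Ioc_subset_Icc_self hx)) ?_
      rw [← hylen i, abs_le]
      have h3 : y i ≤ z := h1.1
      have h4 : z ≤ y (i + 1) := h1.2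
      constructor <;> linarith [hx.1, hx.2]
    rw [hylen, abs_of_nonneg (by positivity : 0 ≤ (b - a) / N)] at e3
    rw [e2, abs_mul]
    calc |gaussWeight m ξ| * |∫ x in y i..y (i + 1), (f z - f x)|
        ≤ |gaussWeight m ξ| * (η * ((b - a) / N)) := by gcongr
      _ = _ := by ring
  refine (Finset.abs_sum_le_sum_abs _ _).trans ((Finset.sum_le_sum hi).trans_eq ?_)
  rw [Finset.sum_const, Finset.card_range, nsmul_eq_mul]
  field_simp

/-- Iterated composite Gauss–Legendre quadrature of uniformly convergent integrands converges to
the integral of the limit. -/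
theorem tendsto_iterated_gaussQuadrature {m m' : ℕ} (hm : 1 ≤ m) (hm' : 1 ≤ m') {a b a' b' : ℝ}
    (hab : a ≤ b) (hab' : a' ≤ b') {G : ℝ → ℝ → ℝ} {H : ℕ × ℕ → ℝ → ℝ → ℝ}
    (hG : ContinuousOn (Function.uncurry G) (Icc a b ×ˢ Icc a' b'))
    (hH : ∀ ε > 0, ∀ᶠ N in atTop ×ˢ atTop, ∀ t ∈ Icc a b, ∀ θ ∈ Icc a' b',
      |H N t θ - G t θ| ≤ ε) :
    Tendsto (fun N : ℕ × ℕ => gaussQuadrature m N.1 a b fun t =>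
      gaussQuadrature m' N.2 a' b' (H N t)) (atTop ×ˢ atTop)
      (𝓝 (∫ t in a..b, ∫ θ in a'..b', G t θ)) := by
  have huc := (isCompact_Icc.prod isCompact_Icc).uniformContinuousOn_of_continuous hG
  rw [Metric.uniformContinuousOn_iff] at huc
  have hmod : ∀ ε > 0, ∃ δ > 0, (∀ t ∈ Icc a b, ∀ x ∈ Icc a' b', ∀ y ∈ Icc a' b', |x - y| < δ →
      |G t x - G t y| ≤ ε) ∧ ∀ s ∈ Icc a b, ∀ t ∈ Icc a b, |s - t| < δ →
        ∀ x ∈ Icc a' b', |G s x - G t x| ≤ ε := by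
    intro ε hε
    obtain ⟨δ, hδ, h⟩ := huc ε hε
    refine ⟨δ, hδ, fun t ht x hx y hy hxy => ?_, fun s hs t ht hst x hx => ?_⟩
    · refine (h (t, x) ⟨ht, hx⟩ (t, y) ⟨ht, hy⟩ ?_).le
      rw [Prod.dist_eq, dist_self, Real.dist_eq]
      exact max_lt hδ hxy
    · refine (h (s, x) ⟨hs, hx⟩ (t, x) ⟨ht, hx⟩ ?_).le
      rw [Prod.dist_eq, dist_self, Real.dist_eq]
      exact max_lt hst hδ
  have hsec : ∀ t ∈ Icc a b, ContinuousOn (G t) (Icc a' b') := fun t ht =>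
    hG.comp (f := fun θ => (t, θ)) (by fun_prop) fun θ hθ => ⟨ht, hθ⟩
  set g : ℝ → ℝ := fun t => ∫ θ in a'..b', G t θ with hg
  have hgm : ∀ {ε : ℝ} {s t : ℝ}, s ∈ Icc a b → t ∈ Icc a b →
      (∀ x ∈ Icc a' b', |G s x - G t x| ≤ ε) → |g s - g t| ≤ (b' - a') * ε := by
    intro ε s t hs ht h
    have hi : ∀ r ∈ Icc a b, IntervalIntegrable (G r) volume a' b' := fun r hr =>
      ContinuousOn.intervalIntegrable (by rw [uIcc_of_le hab']; exact hsec r hr)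
    rw [hg]
    simp only
    rw [← intervalIntegral.integral_sub (hi s hs) (hi t ht)]
    have hb : |∫ x in a'..b', (G s x - G t x)| ≤ ε * |b' - a'| := by
      refine (Real.norm_eq_abs _).symm.trans_le
        (intervalIntegral.norm_integral_le_of_norm_le_const fun x hx => ?_)
      rw [uIoc_of_le hab'] at hx
      exact h x (Ioc_subset_Icc_self hx)
    rwa [abs_of_nonneg (sub_nonneg.2 hab'), mul_comm] at hb
  have hba' : 0 ≤ b' - a' := sub_nonneg.2 hab'
  have hba : 0 ≤ b - a := sub_nonneg.2 hab
  have hgc : ContinuousOn g (Icc a b) := by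
    rw [Metric.continuousOn_iff]
    intro t ht ε hε
    obtain ⟨δ, hδ, -, h⟩ := hmod (ε / (b' - a' + 1)) (by positivity)
    refine ⟨δ, hδ, fun s hs hst => ?_⟩
    rw [Real.dist_eq] at hst ⊢
    refine (hgm hs ht (h s hs t ht hst)).trans_lt ?_
    rw [mul_div_assoc', div_lt_iff₀ (by positivity)]
    nlinarith
  rw [Metric.tendsto_nhds]
  intro ε hε
  set Λ := quadratureNorm m with hΛ
  set Λ' := quadratureNorm m' with hΛ'
  have hΛ0 : 0 ≤ Λ := quadratureNorm_nonneg m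
  have hΛ0' : 0 ≤ Λ' := quadratureNorm_nonneg m'
  set M := (b - a) * Λ * ((b' - a') * Λ') * 2 + (b - a) * Λ * (b' - a') with hM
  have hM0 : 0 ≤ M := by positivity
  set η := ε / (M + 1) with hη
  have hη0 : 0 < η := by positivity
  have hMη : M * η < ε := by
    rw [hη, mul_div_assoc', div_lt_iff₀ (by positivity)]
    nlinarith
  obtain ⟨δ, hδ, hmθ, hmt⟩ := hmod η hη0
  have hlim : ∀ c : ℝ, ∀ᶠ N : ℕ in atTop, c / N < δ := fun c =>
    (tendsto_natCast_atTop_atTop.const_div_atTop c).eventually_lt_const hδ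
  filter_upwards [hH η hη0, ((eventually_ge_atTop 1).and (hlim (b - a))).prod_mk
    ((eventually_ge_atTop 1).and (hlim (b' - a')))] with N hN hN'
  obtain ⟨⟨hN1, hd⟩, hN2, hd'⟩ := hN'
  have s1 : |(gaussQuadrature m N.1 a b fun t => gaussQuadrature m' N.2 a' b' (H N t))
      - gaussQuadrature m N.1 a b fun t => gaussQuadrature m' N.2 a' b' (G t)|
      ≤ (b - a) * Λ * ((b' - a') * Λ' * η) :=
    abs_gaussQuadrature_sub_le hN1 hab fun t ht =>
      abs_gaussQuadrature_sub_le hN2 hab' fun θ hθ => hN t ht θ hθ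
  have s2 : |(gaussQuadrature m N.1 a b fun t => gaussQuadrature m' N.2 a' b' (G t))
      - gaussQuadrature m N.1 a b g| ≤ (b - a) * Λ * ((b' - a') * Λ' * η) :=
    abs_gaussQuadrature_sub_le hN1 hab fun t ht =>
      abs_gaussQuadrature_sub_integral_le hm' hN2 hab' (hsec t ht) fun x hx y hy hxy =>
        hmθ t ht x hx y hy (hxy.trans_lt hd')
  have s3 : |gaussQuadrature m N.1 a b g - ∫ t in a..b, g t| ≤ (b - a) * Λ * ((b' - a') * η) :=
    abs_gaussQuadrature_sub_integral_le hm hN1 hab hgc fun x hx y hy hxy =>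
      hgm hx hy (hmt x hx y hy (hxy.trans_lt hd))
  rw [Real.dist_eq]
  refine lt_of_le_of_lt ?_ hMη
  have t1 := abs_sub_le (gaussQuadrature m N.1 a b fun t => gaussQuadrature m' N.2 a' b' (H N t))
    (gaussQuadrature m N.1 a b fun t => gaussQuadrature m' N.2 a' b' (G t)) (∫ t in a..b, g t)
  have t2 := abs_sub_le (gaussQuadrature m N.1 a b fun t => gaussQuadrature m' N.2 a' b' (G t))
    (gaussQuadrature m N.1 a b g) (∫ t in a..b, g t)
  have : M * η = (b - a) * Λ * ((b' - a') * Λ' * η) + ((b - a) * Λ * ((b' - a') * Λ' * η)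
      + (b - a) * Λ * ((b' - a') * η)) := by rw [hM]; ring
  linarith


/-! ### Convergence of the discretized energy -/

section
variable {d : ℕ}

theorem continuousAt_energyDensity {X : Type*} [TopologicalSpace X] (a₀ a₁ a₂ : ℝ)
    {c' c'' v v' v'' : X → EuclideanSpace ℝ (Fin d)} {z : X} (h1 : ContinuousAt c' z)
    (h2 : ContinuousAt c'' z) (h3 : ContinuousAt v z) (h4 : ContinuousAt v' z)
    (h5 : ContinuousAt v'' z) (h0 : c' z ≠ 0) :
    ContinuousAt (fun x => energyDensity a₀ a₁ a₂ (c' x) (c'' x) (v x) (v' x) (v'' x)) z := by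
  have hn : ‖c' z‖ ≠ 0 := norm_ne_zero_iff.2 h0
  have hp : ∀ (a : ℝ) (n : ℕ), ContinuousAt (fun x => a / ‖c' x‖ ^ n) z := fun a n =>
    continuousAt_const.div (h1.norm.pow n) (pow_ne_zero n hn)
  have h17 := hp a₁ 1
  simp only [pow_one] at h17
  unfold energyDensity
  exact ((((continuousAt_const.mul h1.norm).mul (h3.inner h3)).add (h17.mul (h4.inner h4))).add
    (((hp a₂ 7).mul ((h1.inner h2).pow 2)).mul (h4.inner h4))).sub
    (((hp (2 * a₂) 5).mul (h1.inner h2)).mul (h4.inner h5)) |>.add ((hp a₂ 3).mul (h5.inner h5))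

/-- The fundamental domain `[0,1] × [0,2π]`, with the boundary included. -/
abbrev closedCell : Set (ℝ × ℝ) := Icc 0 1 ×ˢ Icc 0 (2 * Real.pi)

theorem isCompact_closedCell : IsCompact closedCell := isCompact_Icc.prod isCompact_Icc

theorem ae_mem_closedCell : ∀ᵐ p ∂cylMeasure, p ∈ closedCell := by
  filter_upwards [ae_restrict_mem (measurableSet_Icc.prod measurableSet_Ioc)] with p hp
  exact ⟨hp.1, Ioc_subset_Icc_self hp.2⟩

theorem ContinuousOn.integrable_cylMeasure {G : ℝ × ℝ → ℝ} (hG : ContinuousOn G closedCell) :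
    Integrable G cylMeasure :=
  (hG.integrableOn_compact isCompact_closedCell).mono_set (prod_mono le_rfl Ioc_subset_Icc_self)

theorem integral_cylMeasure_eq {G : ℝ × ℝ → ℝ} (hG : ContinuousOn G closedCell) :
    ∫ p, G p ∂cylMeasure = ∫ t in (0 : ℝ)..1, ∫ θ in (0 : ℝ)..2 * Real.pi, G (t, θ) := by
  have hi := hG.integrable_cylMeasure
  rw [cylMeasure_eq_prod] at hi ⊢
  rw [integral_prod _ hi, intervalIntegral.integral_of_le zero_le_one]
  simp only [intervalIntegral.integral_of_le Real.two_pi_pos.le]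

theorem IsPartialSystem.ne_zero_of_closedCell {k l : ℕ}
    {W : ℕ → ℕ → BoundedContinuousFunction (ℝ × ℝ) (EuclideanSpace ℝ (Fin d))}
    (hW : IsPartialSystem k l W) {i j : ℕ} (hi : i < k) (hj : j < l)
    (h : ∀ p ∈ closedCell, W i j p ≠ 0) {t : ℝ} (ht : t ∈ Icc (0 : ℝ) 1) (θ : ℝ) :
    W i j (t, θ) ≠ 0 := by
  have hp : Function.Periodic (fun θ => W i j (t, θ)) (2 * Real.pi) :=
    fun θ => hW.periodic i hi j hj t θ
  have hθ := toIcoMod_mem_Ico' Real.two_pi_pos θ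
  have := h (t, toIcoMod Real.two_pi_pos 0 θ) ⟨ht, hθ.1, hθ.2.le⟩
  rw [toIcoMod] at this
  rwa [← hp.sub_zsmul_eq (toIcoDiv Real.two_pi_pos 0 θ)]

/-- Elements of `H^{k,ℓ}` whose derivative in `θ` has no zeros belong to `U ∩ C^{1,2}`. -/
theorem mem_immersedPaths_inter_mixedC {k l : ℕ} (hk : 2 ≤ k) (hl : 3 ≤ l) {f : CylL2 d}
    {W : ℕ → ℕ → BoundedContinuousFunction (ℝ × ℝ) (EuclideanSpace ℝ (Fin d))}
    (hW : IsPartialSystem k l W) (hf : ∀ i < k, ∀ j < l, HasCylWeakDeriv i j f (contL2 d (W i j)))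
    (h : ∀ p ∈ closedCell, W 0 1 p ≠ 0) : f ∈ immersedPaths d ∩ mixedC d 1 2 := by
  have h0 := hf 0 (by omega) 0 (by omega)
  refine ⟨⟨⟨⟨WithLp.toLp 2 ![f, contL2 d (W 1 0), contL2 d (W 0 2), contL2 d (W 1 2)],
    hf 1 (by omega) 0 (by omega), hf 0 (by omega) 2 (by omega), hf 1 (by omega) 2 (by omega)⟩, rfl⟩,
    _, hW.isMixedCRep h0 (by omega) (by omega), fun t ht θ => ?_⟩,
    _, hW.isMixedCRep h0 (by omega) (by omega)⟩
  rw [hW.cylPartial_eq (by omega) (by omega) ht]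
  exact hW.ne_zero_of_closedCell (by omega) (by omega) h ht θ

end

theorem mainTheorem2 (d k l nt nθ mt mθ : ℕ)
    (hk : 2 ≤ k) (hknt : k ≤ nt) (hl : 3 ≤ l) (hlnθ : l ≤ nθ) (hmt : 1 ≤ mt) (hmθ : 1 ≤ mθ)
    (a₀ a₁ a₂ : ℝ) (c : mixedSobolev d k l) (hc : sobolevFun c ∈ immersedPaths d) :
    Integrable (energyIntegrand a₀ a₁ a₂ (sobolevFun c)) cylMeasure ∧
    (∀ᶠ N : ℕ × ℕ in atTop ×ˢ atTop,
      sobolevFun (splineProjection nt nθ N.1 N.2 c) ∈ immersedPaths d ∩ mixedC d 1 2) ∧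
    Tendsto (fun N : ℕ × ℕ => discreteEnergy a₀ a₁ a₂ mt mθ N.1 N.2
        (sobolevFun (splineProjection nt nθ N.1 N.2 c)))
      (atTop ×ˢ atTop) (𝓝 (energy a₀ a₁ a₂ (sobolevFun c))) := by
  obtain ⟨Φ, hΦ⟩ := exists_partialSystem d k l
  have hrep : ∀ x : mixedSobolev d k l,
      IsMixedCRep 1 2 (sobolevFun x) fun t θ => Φ 0 0 x (t, θ) := fun x =>
    (hΦ x).1.isMixedCRep ((hΦ x).2 0 (by omega) 0 (by omega)) (by omega) (by omega)
  -- the derivatives do not depend on the choice of the representative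
  have hpart : ∀ (x : mixedSobolev d k l) {i' j' : ℕ} {u : ℝ → ℝ → EuclideanSpace ℝ (Fin d)},
      IsMixedCRep i' j' (sobolevFun x) u → ∀ {i j : ℕ}, i < k → j < l → ∀ {t : ℝ},
      t ∈ Icc (0 : ℝ) 1 → ∀ θ, cylPartial i j u t θ = Φ i j x (t, θ) := by
    intro x i' j' u hu i j hi hj t ht θ
    rw [hu.cylPartial_eq (hrep x) i j ht]
    exact (hΦ x).1.cylPartial_eq hi hj ht θ
  obtain ⟨-, u, hu, hu0⟩ := hc
  have hne : ∀ p ∈ closedCell, Φ 0 1 c p ≠ 0 := fun p hp => by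
    have := hu0 p.1 hp.1 p.2
    rwa [hpart c hu (by omega) (by omega) hp.1] at this
  have hcont : ∀ i j, Continuous fun z : mixedSobolev d k l × (ℝ × ℝ) => Φ i j z.1 z.2 := fun i j =>
    ContinuousEval.continuous_eval.comp
      (((Φ i j).continuous.comp continuous_fst).prodMk continuous_snd)
  set F : mixedSobolev d k l → ℝ × ℝ → ℝ := fun x p =>
    energyDensity a₀ a₁ a₂ (Φ 0 1 x p) (Φ 0 2 x p) (Φ 1 0 x p) (Φ 1 1 x p) (Φ 1 2 x p) with hF
  have hFc : ∀ p ∈ closedCell,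
      ContinuousAt (fun z : mixedSobolev d k l × (ℝ × ℝ) => F z.1 z.2) (c, p) := fun p hp =>
    continuousAt_energyDensity a₀ a₁ a₂ (hcont 0 1).continuousAt (hcont 0 2).continuousAt
      (hcont 1 0).continuousAt (hcont 1 1).continuousAt (hcont 1 2).continuousAt (hne p hp)
  have hGat : ∀ p ∈ closedCell, ContinuousAt (F c) p := fun p hp =>
    ContinuousAt.comp (f := fun q : ℝ × ℝ => (c, q)) (hFc p hp) (by fun_prop)
  have hG : ContinuousOn (F c) closedCell := fun p hp => (hGat p hp).continuousWithinAt
  have hae : energyIntegrand a₀ a₁ a₂ (sobolevFun c) =ᵐ[cylMeasure] F c := by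
    have hw : ∀ {i j : ℕ}, i < k → j < l → weakPartial i j (sobolevFun c) =ᵐ[cylMeasure] Φ i j c :=
      fun hi hj => by
        rw [weakPartial_eq ((hΦ c).2 _ hi _ hj)]
        exact coeFn_contL2 _
    filter_upwards [hw (i := 0) (j := 1) (by omega) (by omega),
      hw (i := 0) (j := 2) (by omega) (by omega), hw (i := 1) (j := 0) (by omega) (by omega),
      hw (i := 1) (j := 1) (by omega) (by omega),
      hw (i := 1) (j := 2) (by omega) (by omega)] with p h1 h2 h3 h4 h5
    rw [energyIntegrand, h1, h2, h3, h4, h5]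
  -- being immersed and having nearly the same energy density are open conditions in `H^{k,ℓ}`, by
  -- compactness of `[0,1] × S¹`
  have hlim := tendsto_splineProjection (nt := nt) (nθ := nθ) (by omega) hknt hlnθ c
  have hmem : ∀ᶠ N : ℕ × ℕ in atTop ×ˢ atTop,
      sobolevFun (splineProjection nt nθ N.1 N.2 c) ∈ immersedPaths d ∩ mixedC d 1 2 := by
    have h : ∀ᶠ x in 𝓝 c, ∀ p ∈ closedCell, Φ 0 1 x p ≠ 0 :=
      isCompact_closedCell.eventually_forall_of_forall_eventually fun p hp =>
        (hcont 0 1).continuousAt.eventually_ne (hne p hp)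
    filter_upwards [hlim.eventually h] with N hN
    exact mem_immersedPaths_inter_mixedC hk hl (hΦ _).1 (hΦ _).2 hN
  refine ⟨hG.integrable_cylMeasure.congr hae.symm, hmem, ?_⟩
  rw [energy, integral_congr_ae hae, integral_cylMeasure_eq hG]
  refine tendsto_iterated_gaussQuadrature (G := fun t θ => F c (t, θ)) hmt hmθ zero_le_one
    Real.two_pi_pos.le hG fun ε hε => ?_
  have h : ∀ᶠ x in 𝓝 c, ∀ p ∈ closedCell, |F x p - F c p| < ε := by
    refine isCompact_closedCell.eventually_forall_of_forall_eventually
      (P := fun x p => |F x p - F c p| < ε) fun p hp => ?_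
    have h1 : ContinuousAt (fun z : mixedSobolev d k l × (ℝ × ℝ) => |F z.1 z.2 - F c z.2|) (c, p) :=
      ((hFc p hp).sub (ContinuousAt.comp (f := Prod.snd) (x := (c, p)) (hGat p hp)
        continuousAt_snd)).abs
    exact h1.eventually_lt_const (by simpa using hε)
  filter_upwards [hlim.eventually h, hmem] with N hN hN' t ht θ hθ
  have hr : IsMixedCRep 1 2 (sobolevFun (splineProjection nt nθ N.1 N.2 c))
      (mixedCRep 1 2 (sobolevFun (splineProjection nt nθ N.1 N.2 c))) := by
    have h : ∃ u, IsMixedCRep 1 2 (sobolevFun (splineProjection nt nθ N.1 N.2 c)) u := hN'.2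
    rw [mixedCRep, dif_pos h]
    exact h.choose_spec
  have hp := fun {i j : ℕ} (hi : i < k) (hj : j < l) => hpart _ hr hi hj ht θ
  rw [hp (i := 0) (j := 1) (by omega) (by omega), hp (i := 0) (j := 2) (by omega) (by omega),
    hp (i := 1) (j := 0) (by omega) (by omega), hp (i := 1) (j := 1) (by omega) (by omega),
    hp (i := 1) (j := 2) (by omega) (by omega)]
  exact (hN (t, θ) ⟨ht, hθ⟩).le
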